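/- Let $\phi(t)=\left(\frac{X(t)}{W(t)},\frac{Y(t)}{W(t)}\right)$, with $X,Y,W\in\mathbb{Q}[t]$, $W\neq 0$, $\gcd(X,Y,W)=1$, be a rational parametrization of a plane curve $\mathcal{C}\subset\mathbb{C}^2$ (the Zariski closure of the image of $\phi$) that is neither a line nor a circle, and let $n$ be its tracing index, i.e. all but finitely many points of $\mathcal{C}$ are of the form $\phi(t)$ for exactly $n$ values $t\in\mathbb{C}$. Let $d>0$ be real and put $U=X'W-XW'$, $V=Y'W-YW'$. The offset $\mathcal{O}_d(\mathcal{C})\subset\mathbb{C}^2$ is the Zariski closure of the set of all points $$q=\left(\frac{X(t)}{W(t)}\pm d\,\frac{V(t)}{\sqrt{U(t)^2+V(t)^2}},\ \frac{Y(t)}{W(t)}\mp d\,\frac{U(t)}{\sqrt{U(t)^2+V(t)^2}}\right),\qquad t\in\mathbb{C},\ W(t)\neq 0,\ U(t)^2+V(t)^2\neq 0;$$ such a $q$ is said to be generated by the point $\phi(t)$. An irreducible component of $\mathcal{O}_d(\mathcal{C})$ is simple if all but finitely many of its points are generated by exactly one point of $\mathcal{C}$, and special otherwise. Let $P,Q\in\mathbb{C}[x,y,t]$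 be obtained from $$\tilde P=U\,(Wx-X)+V\,(Wy-Y),\qquad \tilde Q=(Wx-X)^2+(Wy-Y)^2-d^2W^2$$ by dividing by their contents in $\mathbb{C}[t]$ (the greatest common divisor of the coefficients of the polynomial regarded as a polynomial in $x,y$ over $\mathbb{C}[t]$), and let $H(x,y)=\operatorname{Res}_t(P,Q)$. Then $H$ can be written as $H=F\cdot G$, where $F=0$ defines the set $\mathcal{O}_d(\mathcal{C})$ and $G$ is a (possibly empty) product of linear polynomials in $\mathbb{C}[x,y]$. Moreover, $\mathcal{O}_d(\mathcal{C})$ has at most two irreducible components and at most one special component; there are $f_1,f_2\in\mathbb{C}[x,y]$ such that $\mathcal{O}_d(\mathcal{C})=\{f_1=0\}\cup\{f_2=0\}$, $f_1$ is irreducible, $f_2$ is irreducible or $f_2=1$, $\{f_1=0\}\neq\{f_2=0\}$, and $f_2=0$ defines the special component if there is one. For every such $F,G$ and every such $f_1,f_2$, up to a nonzero constant factor: 1. if $\mathcal{O}_d(\mathcal{C})$ does not have any special component, then $F(x,y)=f_1(x,y)^n\cdot f_2(x,y)^n$; 2. if $\mathcal{O}_d(\mathcal{C})$ has a special component, then $F(x,y)=f_1(x,y)^n\cdot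 f_2(x,y)^{2n}$. -/

import Mathlib

/-- A rational parametrization `t ↦ (X(t)/W(t), Y(t)/W(t))` with rational coefficients, written
with a common denominator and in lowest terms: `gcd(X, Y, W) = 1`. -/
structure RatParam where
  X : Polynomial ℚ
  Y : Polynomial ℚ
  W : Polynomial ℚ
  W_ne_zero : W ≠ 0
  gcd_eq_one : ∀ a : Polynomial ℚ, a ∣ X → a ∣ Y → a ∣ W → IsUnit a

/-- The ring `ℂ[x, y]`; the variable `0` is `x` and the variable `1` is `y`. -/
abbrev PolyXY : Type := MvPolynomial (Fin 2) ℂ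

/-- The Zariski closure of a subset of the affine plane `ℂ²`. -/
def zariskiClosure (S : Set (Fin 2 → ℂ)) : Set (Fin 2 → ℂ) :=
  MvPolynomial.zeroLocus ℂ (MvPolynomial.vanishingIdeal ℂ S)

/-- The plane algebraic set `{f = 0} ⊆ ℂ²`. -/
def planeCurve (f : PolyXY) : Set (Fin 2 → ℂ) :=
  {p | MvPolynomial.eval p f = 0}

/-- `V` is an irreducible component of `S`: a maximal irreducible Zariski closed subset of `S`. -/
def IsIrredComponent (S V : Set (Fin 2 → ℂ)) : Prop :=
  Maximal (fun Z : Set (Fin 2 → ℂ) =>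
    zariskiClosure Z = Z ∧ (MvPolynomial.vanishingIdeal ℂ Z).IsPrime ∧ Z ⊆ S) V

/-- `p` is the primitive part, with respect to `t`, of `p₀ ∈ ℂ[x, y][t]`: it is `p₀` divided by
its content, the greatest common divisor in `ℂ[t]` of the coefficients of `p₀` regarded as a
polynomial in `x, y`. (A polynomial `a ∈ ℂ[t]` divides all those coefficients iff `a ∣ p₀`.) -/
def IsPrimitivePartT (p₀ p : Polynomial PolyXY) : Prop :=
  (∃ c : Polynomial ℂ, p₀ = c.map MvPolynomial.C * p) ∧
    ∀ a : Polynomial ℂ, a.map MvPolynomial.C ∣ p → IsUnit a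

namespace RatParam

noncomputable section

/-- `U = X' W - X W'`. -/
def U (φ : RatParam) : Polynomial ℚ :=
  Polynomial.derivative φ.X * φ.W - φ.X * Polynomial.derivative φ.W

/-- `V = Y' W - Y W'`. -/
def V (φ : RatParam) : Polynomial ℚ :=
  Polynomial.derivative φ.Y * φ.W - φ.Y * Polynomial.derivative φ.W

/-- The point `φ(t) ∈ ℂ²`; meaningful when `W(t) ≠ 0`. -/
def point (φ : RatParam) (t : ℂ) : Fin 2 → ℂ :=
  ![Polynomial.aeval t φ.X / Polynomial.aeval t φ.W,
    Polynomial.aeval t φ.Y / Polynomial.aeval t φ.W]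

/-- The algebraic set parametrized by `φ`. -/
def curve (φ : RatParam) : Set (Fin 2 → ℂ) :=
  zariskiClosure {p | ∃ t : ℂ, Polynomial.aeval t φ.W ≠ 0 ∧ p = φ.point t}

/-- The parameter values at which `φ` passes through `p`. -/
def fibre (φ : RatParam) (p : Fin 2 → ℂ) : Set ℂ :=
  {t | Polynomial.aeval t φ.W ≠ 0 ∧ φ.point t = p}

/-- `φ` has tracing index `n`: all but finitely many points of the curve are reached by exactly
`n` values of the parameter. -/
def HasTracingIndex (φ : RatParam) (n : ℕ) : Prop :=
  {p | p ∈ φ.curve ∧ (φ.fibre p).encard ≠ n}.Finite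

/-- `φ` parametrizes a (non-degenerate) curve that is neither a line nor a circle. -/
def IsAdmissible (φ : RatParam) : Prop :=
  φ.curve.Infinite ∧
  (∀ a b c : ℝ, (a ≠ 0 ∨ b ≠ 0) →
    φ.curve ≠ {p | (a : ℂ) * p 0 + (b : ℂ) * p 1 + (c : ℂ) = 0}) ∧
  (∀ a b r : ℝ, 0 < r →
    φ.curve ≠ {p | (p 0 - (a : ℂ)) ^ 2 + (p 1 - (b : ℂ)) ^ 2 = (r : ℂ) ^ 2})

/-- `t` generates `q` at distance `d`: `q = φ(t) + d (V, -U) / s`, where `s` is one of the two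
square roots of `U² + V² ≠ 0` at `t`. -/
def ParamGenerates (φ : RatParam) (d : ℝ) (t : ℂ) (q : Fin 2 → ℂ) : Prop :=
  Polynomial.aeval t φ.W ≠ 0 ∧
  ∃ s : ℂ, s ≠ 0 ∧
    s ^ 2 = Polynomial.aeval t φ.U ^ 2 + Polynomial.aeval t φ.V ^ 2 ∧
    q = ![φ.point t 0 + d * Polynomial.aeval t φ.V / s,
          φ.point t 1 - d * Polynomial.aeval t φ.U / s]

/-- The offset to the curve at distance `d`. -/
def offset (φ : RatParam) (d : ℝ) : Set (Fin 2 → ℂ) :=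
  zariskiClosure {q | ∃ t : ℂ, φ.ParamGenerates d t q}

/-- The points `φ(t)` of the curve that generate `q`. -/
def generators (φ : RatParam) (d : ℝ) (q : Fin 2 → ℂ) : Set (Fin 2 → ℂ) :=
  {p | ∃ t : ℂ, φ.ParamGenerates d t q ∧ p = φ.point t}

/-- A simple component of the offset: almost every point is generated by just one point. -/
def IsSimpleComponent (φ : RatParam) (d : ℝ) (Z : Set (Fin 2 → ℂ)) : Prop :=
  IsIrredComponent (φ.offset d) Z ∧ {q | q ∈ Z ∧ (φ.generators d q).encard ≠ 1}.Finite

/-- A special component of the offset: a component that is not simple. -/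
def IsSpecialComponent (φ : RatParam) (d : ℝ) (Z : Set (Fin 2 → ℂ)) : Prop :=
  IsIrredComponent (φ.offset d) Z ∧ ¬ φ.IsSimpleComponent d Z

/-- The offset has a special component. -/
def HasSpecialComponent (φ : RatParam) (d : ℝ) : Prop :=
  ∃ Z, φ.IsSpecialComponent d Z

/-- A polynomial in `t` with rational coefficients, as an element of `ℂ[x, y][t]`. -/
def liftT (a : Polynomial ℚ) : Polynomial PolyXY :=
  a.map (algebraMap ℚ PolyXY)

/-- The variable `x` in `ℂ[x, y][t]`. -/
def xT : Polynomial PolyXY := Polynomial.C (MvPolynomial.X 0)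

/-- The variable `y` in `ℂ[x, y][t]`. -/
def yT : Polynomial PolyXY := Polynomial.C (MvPolynomial.X 1)

/-- The normal line at `φ(t)`: `U (W x - X) + V (W y - Y)`. -/
def normalPoly (φ : RatParam) : Polynomial PolyXY :=
  liftT φ.U * (liftT φ.W * xT - liftT φ.X) + liftT φ.V * (liftT φ.W * yT - liftT φ.Y)

/-- The circle of radius `d` centred at `φ(t)`: `(W x - X)² + (W y - Y)² - d² W²`. -/
def circlePoly (φ : RatParam) (d : ℝ) : Polynomial PolyXY :=
  (liftT φ.W * xT - liftT φ.X) ^ 2 + (liftT φ.W * yT - liftT φ.Y) ^ 2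
    - Polynomial.C (MvPolynomial.C ((d : ℂ) ^ 2)) * liftT φ.W ^ 2

/-- `H = F * G`, where `{F = 0}` is the offset and `G` is a product of linear factors. -/
def IsOffsetFactorization (φ : RatParam) (d : ℝ) (H F G : PolyXY) : Prop :=
  H = F * G ∧ planeCurve F = φ.offset d ∧
    ∃ L : Multiset PolyXY, (∀ l ∈ L, l.totalDegree = 1) ∧ G = L.prod

/-- `f₁`, `f₂` are irreducible equations of the components of the offset. If there is only one
component, then `f₂ = 1`; if there is a special component, it is represented by `f₂`. -/
def AreComponentEquations (φ : RatParam) (d : ℝ) (f₁ f₂ : PolyXY) : Prop :=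
  Irreducible f₁ ∧ (Irreducible f₂ ∨ f₂ = 1) ∧ planeCurve f₁ ≠ planeCurve f₂ ∧
    planeCurve f₁ ∪ planeCurve f₂ = φ.offset d ∧
    ∀ Z, φ.IsSpecialComponent d Z → planeCurve f₂ = Z

end

end RatParam

open MvPolynomial
open scoped Topology

/-! Call a pair (t, s) with W(t) ≠ 0 and s ≠ 0 a root of s² = U² + V² a state. Its offset point is
q(t, s) = φ(t) + d N, with unit normal N = (V, -U)/s. The normal line and the circle at a state
parameter t meet exactly in the offset points over t, so H vanishes at all of these. Conversely, off
finitely many lines (`exceptional`, built from polynomials of degree at most one in x, y) every zero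
of H is an offset point. A line contains offset points of only finitely many parameters
(`finite_q_mem_line`), because its constant gradient would otherwise be normal to the curve
everywhere. Hence the nonlinear irreducible factors of H are the equations of the offset.

A polynomial evaluated along the states has the form A(t) + B(t)s up to a denominator. If it
vanishes at states over infinitely many t, then the norm A² - B²S is zero, and it vanishes at one of
the two states over every t. With two states per parameter, three distinct factors would have to
share infinitely many points, so there are at most two (`IsMain.associated_of_three`).

For the multiplicity a of a factor f, restrict to a line p + εv transversal to {f = 0} at a generic
p. There H becomes a power series of order a. The parameters of p are simple roots of P at ε = 0.
They lift by Hensel's lemma, and Q vanishes to order exactly one at each lift, so the resultant has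
order equal to the number of parameters over p (`PowerSeries.order_resultant`,
`IsGeneric.encard_params`).

At such p the gradient of f is normal to the curve at every generating state, so the unit normals
agree up to sign. Equal normals give equal curve points, so p has one or two generators, each with n
parameters, and a is n or 2n (`IsMain.exists_count`). Two generators cannot occur on every
component: the finite set of curve points having one given normal N would be stable under
translation by 2dN (`exists_point_not_two`). The rest is unique factorization in ℂ[x, y]. -/

/-! ### Plane curves: common zeros, Zariski closure, irreducible components -/

theorem exists_resultant_combination {R : Type*} [CommRing R] [IsDomain R]
    [UniqueFactorizationMonoid R] {f g : Polynomial R} (hf : Irreducible f) (hfg : ¬ f ∣ g) :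
    ∃ (r : R) (a b : Polynomial R), r ≠ 0 ∧ a * f + b * g = Polynomial.C r := by
  by_cases h0 : f.natDegree = 0
  · rw [Polynomial.natDegree_eq_zero] at h0
    obtain ⟨r, rfl⟩ := h0
    refine ⟨r, 1, 0, ?_, by simp⟩
    rintro rfl
    simp at hf
  -- By Gauss's lemma `f` stays irreducible over the fraction field. It is coprime to `g` there,
  -- since a quotient over `K` can be cleared of denominators and `f` divides no nonzero constant.
  -- So the resultant is nonzero.
  · let K := FractionRing R
    have hprim := hf.isPrimitive h0
    have hinj : Function.Injective (algebraMap R K) := IsFractionRing.injective R K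
    have hirr : Irreducible (f.map (algebraMap R K)) :=
      hprim.irreducible_iff_irreducible_map_fraction_map.1 hf
    have hcop : IsCoprime (f.map (algebraMap R K)) (g.map (algebraMap R K)) := by
      rw [hirr.coprime_iff_not_dvd]
      rintro ⟨h, hh⟩
      obtain ⟨b, hb, hbh⟩ := IsLocalization.integerNormalization_spec (nonZeroDivisors R) h
      apply hfg
      have hb0 : b ≠ 0 := nonZeroDivisors.ne_zero hb
      have e : Polynomial.C b * g = f * IsLocalization.integerNormalization (nonZeroDivisors R) h := by
        apply Polynomial.map_injective _ hinj
        rw [Polynomial.map_mul, Polynomial.map_mul, hbh, hh, Polynomial.map_C, Algebra.smul_def,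
          Polynomial.algebraMap_apply]
        ring
      have hp := hf.prime
      rcases hp.dvd_or_dvd ⟨_, e⟩ with h1 | h1
      · exact absurd (by simpa using Polynomial.natDegree_le_of_dvd h1 (by simpa using hb0)) h0
      · exact h1
    obtain ⟨p, q, -, -, e⟩ := Polynomial.exists_mul_add_mul_eq_C_resultant f g le_rfl le_rfl
      (Or.inl h0)
    refine ⟨f.resultant g, p, q, ?_, by rw [← e]; ring⟩
    intro h
    have h2 := Polynomial.resultant_map_map f g f.natDegree g.natDegree (algebraMap R K)
    rw [h, map_zero] at h2
    have h3 := (Polynomial.resultant_eq_zero_iff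
      (f := f.map (algebraMap R K)) (g := g.map (algebraMap R K))).1
      (by rw [Polynomial.natDegree_map_eq_of_injective hinj,
            Polynomial.natDegree_map_eq_of_injective hinj, h2])
    exact h3.2 hcop

/-- Eliminating `x` leaves a nonzero polynomial in `y` alone that lies in the ideal of `f` and `g`;
every such `y` is one of its roots. -/
theorem finite_snd_of_common_zeros {f g : PolyXY} (hf : Irreducible f) (hfg : ¬ f ∣ g) :
    {y : ℂ | ∃ x, eval ![x, y] f = 0 ∧ eval ![x, y] g = 0}.Finite := by
  let e := finSuccEquiv ℂ 1
  obtain ⟨r, a, b, hr, hab⟩ := exists_resultant_combination (f := e f) (g := e g)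
    ((MulEquiv.irreducible_iff e).2 hf) (by rwa [map_dvd_iff])
  have hr' : uniqueAlgEquiv ℂ (Fin 1) r ≠ 0 :=
    (map_ne_zero_iff _ (uniqueAlgEquiv ℂ (Fin 1)).injective).2 hr
  refine ((uniqueAlgEquiv ℂ (Fin 1) r).rootSet_finite ℂ).subset ?_
  rintro y ⟨x, h1, h2⟩
  rw [Polynomial.mem_rootSet]
  refine ⟨hr', ?_⟩
  have key : ∀ h : PolyXY, eval ![x, y] h = Polynomial.eval x ((e h).map (eval ![y])) := by
    intro h
    exact eval_eq_eval_mv_eval' ![y] x h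
  rw [key] at h1 h2
  have h3 := congrArg (fun p => Polynomial.eval x (p.map (eval ![y]))) hab
  simp only [Polynomial.map_add, Polynomial.map_mul, Polynomial.eval_add, Polynomial.eval_mul, h1,
    h2, mul_zero, add_zero, Polynomial.map_C, Polynomial.eval_C] at h3
  have h4 : ∀ r : MvPolynomial (Fin 1) ℂ,
      Polynomial.aeval y (uniqueAlgEquiv ℂ (Fin 1) r) = eval ![y] r := by
    intro r
    induction r using MvPolynomial.induction_on with
    | C a => simp [uniqueAlgEquiv]
    | add p q hp hq => simp_all
    | mul_X p i hp => 
      fin_cases i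
      simp_all [uniqueAlgEquiv]
  rw [h4, ← h3]

theorem finite_common_zeros {f g : PolyXY} (hf : Irreducible f) (hfg : ¬ f ∣ g) :
    {p : Fin 2 → ℂ | eval p f = 0 ∧ eval p g = 0}.Finite := by
  let σ : PolyXY ≃ₐ[ℂ] PolyXY := renameEquiv ℂ (Equiv.swap (0 : Fin 2) 1)
  have h1 := finite_snd_of_common_zeros hf hfg
  have h2 := finite_snd_of_common_zeros (f := σ f) (g := σ g)
    ((MulEquiv.irreducible_iff σ).2 hf) (by rwa [map_dvd_iff])
  have hσ : ∀ (x y : ℂ) (h : PolyXY), eval ![x, y] (σ h) = eval ![y, x] h := by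
    intro x y h
    simp only [σ, renameEquiv_apply, eval_rename]
    congr 2
    ext i; fin_cases i <;> simp
  have hp : ∀ p : Fin 2 → ℂ, p = ![p 0, p 1] := by
    intro p; ext i; fin_cases i <;> simp
  refine ((h2.prod h1).image (fun z => ![z.1, z.2])).subset ?_
  rintro p ⟨hp1, hp2⟩
  rw [hp p] at hp1 hp2
  refine ⟨(p 0, p 1), ⟨⟨p 1, ?_⟩, ⟨p 0, hp1, hp2⟩⟩, (hp p).symm⟩
  rw [hσ, hσ]
  exact ⟨hp1, hp2⟩

theorem dvd_of_infinite_common_zeros {f g : PolyXY} (hf : Irreducible f)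
    (h : {p : Fin 2 → ℂ | eval p f = 0 ∧ eval p g = 0}.Infinite) : f ∣ g := by
  by_contra hfg
  exact h (finite_common_zeros hf hfg)

theorem X_sub_C_planeCurve_infinite (a : ℂ) : (planeCurve (X 0 - C a)).Infinite := by
  refine Set.infinite_of_injective_forall_mem (f := fun y : ℂ => ![a, y]) ?_ ?_
  · intro y z h
    simpa using congrFun h 1
  · intro y
    simp [planeCurve]

theorem irreducible_X_sub_C (a : ℂ) : Irreducible (X 0 - C a : PolyXY) := by
  have : (X 0 - C a : PolyXY) =
      (finSuccEquiv ℂ 1).symm (Polynomial.X - Polynomial.C (C a)) := by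
    rw [AlgEquiv.eq_symm_apply, map_sub, finSuccEquiv_X_zero]
    congr 1
    exact (finSuccEquiv ℂ 1).commutes a
  rw [this, MulEquiv.irreducible_iff]
  exact Polynomial.irreducible_X_sub_C _

/-- By the Nullstellensatz, `f` would divide a power of a product of vertical lines through the
finitely many points. It would then be one of these lines up to a unit, and a line is infinite. -/
theorem planeCurve_infinite {f : PolyXY} (hf : Irreducible f) : (planeCurve f).Infinite := by
  intro hfin
  let g : PolyXY := ∏ p ∈ hfin.toFinset, (X 0 - C (p 0))
  have hg : g ∈ vanishingIdeal ℂ (zeroLocus ℂ (Ideal.span {f})) := by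
    intro p hp
    have hp' : p ∈ planeCurve f := by
      have := hp f (Ideal.mem_span_singleton_self f)
      simpa [planeCurve, aeval_eq_eval] using this
    simp only [g, map_prod]
    refine Finset.prod_eq_zero (hfin.mem_toFinset.2 hp') ?_
    simp
  rw [vanishingIdeal_zeroLocus_eq_radical] at hg
  obtain ⟨k, hk⟩ := hg
  rw [Ideal.mem_span_singleton] at hk
  obtain ⟨p, -, hp⟩ := (hf.prime.dvd_finsetProd_iff _).1 (hf.prime.dvd_of_dvd_pow hk)
  have hirr := irreducible_X_sub_C (p 0)
  have hass := hf.associated_of_dvd hirr hp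
  refine X_sub_C_planeCurve_infinite (p 0) (hfin.subset ?_)
  obtain ⟨w, hw⟩ := hass.symm.dvd
  intro z hz
  simp only [planeCurve, Set.mem_ofPred_eq] at hz ⊢
  rw [hw, map_mul, hz, zero_mul]

theorem totalDegree_pderiv_lt {σ : Type*} (i : σ) {f : MvPolynomial σ ℂ} (h : pderiv i f ≠ 0) :
    (pderiv i f).totalDegree < f.totalDegree := by
  obtain ⟨m, hm, hdeg⟩ := Finset.exists_mem_eq_sup (pderiv i f).support
    (by simpa [Finset.nonempty_iff_ne_empty] using h) (fun s => s.sum fun _ e => e)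
  have h1 : (pderiv i f).totalDegree = m.sum fun _ e => e := hdeg
  rw [mem_support_iff, coeff_pderiv] at hm
  have h2 := le_totalDegree (p := f) (s := m + Finsupp.single i 1)
    (mem_support_iff.2 (left_ne_zero_of_mul hm))
  rw [Finsupp.sum_add_index' (by simp) (by simp), Finsupp.sum_single_index rfl] at h2
  omega

theorem eq_C_of_pderiv_eq_zero {σ : Type*} {f : MvPolynomial σ ℂ} (h : ∀ i, pderiv i f = 0) :
    f = C (coeff 0 f) := by
  classical
  ext m
  rw [coeff_C]
  split_ifs with hm
  · rw [hm]
  · obtain ⟨i, hi⟩ := Finsupp.ne_iff.1 (Ne.symm hm)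
    have h1 := coeff_pderiv (i := i) f (m - Finsupp.single i 1)
    rw [h i, coeff_zero, tsub_add_cancel_of_le] at h1
    · rcases mul_eq_zero.1 h1.symm with h2 | h2
      · exact h2
      · exact absurd h2 (by norm_cast)
    · rw [Finsupp.single_le_iff]
      simp only [Finsupp.coe_zero, Pi.zero_apply] at hi
      omega

/-- A nonzero derivative has smaller degree than `f`, and in characteristic zero only constants have
all derivatives zero. -/
theorem exists_pderiv_not_dvd {f : PolyXY} (hf : Irreducible f) : ∃ i, ¬ f ∣ pderiv i f := by
  by_contra! h
  refine hf.not_isUnit ?_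
  have h0 : ∀ i, pderiv i f = 0 := by
    intro i
    by_contra hne
    have := totalDegree_le_of_dvd_of_isDomain (h i) hne
    exact absurd (totalDegree_pderiv_lt i hne) (by omega)
  have h1 := eq_C_of_pderiv_eq_zero h0
  have h2 : coeff 0 f ≠ 0 := by
    intro hc
    rw [hc, map_zero] at h1
    exact hf.ne_zero h1
  rw [h1]
  exact (isUnit_iff_ne_zero.2 h2).map C

theorem finite_singular_points {f : PolyXY} (hf : Irreducible f) :
    {p | p ∈ planeCurve f ∧ ∀ i, eval p (pderiv i f) = 0}.Finite := by
  obtain ⟨i, hi⟩ := exists_pderiv_not_dvd hf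
  exact (finite_common_zeros hf hi).subset fun p hp => ⟨hp.1, hp.2 i⟩

theorem mem_zariskiClosure {S : Set (Fin 2 → ℂ)} {p : Fin 2 → ℂ} :
    p ∈ zariskiClosure S ↔ ∀ g : PolyXY, (∀ z ∈ S, eval z g = 0) → eval p g = 0 :=
  Iff.rfl

theorem subset_zariskiClosure (S : Set (Fin 2 → ℂ)) : S ⊆ zariskiClosure S :=
  fun _ hp _ hg => hg _ hp

theorem zariskiClosure_subset_planeCurve {S : Set (Fin 2 → ℂ)} {f : PolyXY}
    (h : S ⊆ planeCurve f) : zariskiClosure S ⊆ planeCurve f :=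
  fun _ hp => mem_zariskiClosure.1 hp f fun _ hz => h hz

theorem zariskiClosure_planeCurve (f : PolyXY) : zariskiClosure (planeCurve f) = planeCurve f :=
  (zariskiClosure_subset_planeCurve subset_rfl).antisymm (subset_zariskiClosure _)

theorem zariskiClosure_finite {S : Set (Fin 2 → ℂ)} (h : S.Finite) : (zariskiClosure S).Finite := by
  refine ((h.image (fun p => p 0)).prod (h.image (fun p => p 1))).image
    (fun z => ![z.1, z.2]) |>.subset ?_
  have key : ∀ i, ∀ p ∈ zariskiClosure S, p i ∈ (fun p => p i) '' S := by
    intro i p hp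
    have := mem_zariskiClosure.1 hp (∏ q ∈ h.toFinset, (X i - C (q i))) (by
      intro z hz
      rw [map_prod]
      exact Finset.prod_eq_zero (h.mem_toFinset.2 hz) (by simp))
    rw [map_prod, Finset.prod_eq_zero_iff] at this
    obtain ⟨q, hq, hq2⟩ := this
    refine ⟨q, h.mem_toFinset.1 hq, ?_⟩
    simp only [map_sub, eval_X, eval_C] at hq2
    exact (sub_eq_zero.1 hq2).symm
  intro p hp
  refine ⟨(p 0, p 1), ⟨key 0 p hp, key 1 p hp⟩, ?_⟩
  ext i; fin_cases i <;> simp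

theorem planeCurve_subset_zariskiClosure {f : PolyXY} (hf : Irreducible f) {S : Set (Fin 2 → ℂ)}
    (h : (planeCurve f ∩ S).Infinite) : planeCurve f ⊆ zariskiClosure S := by
  intro p hp
  rw [mem_zariskiClosure]
  intro g hg
  obtain ⟨k, rfl⟩ := dvd_of_infinite_common_zeros hf (g := g)
    (h.mono fun z hz => ⟨hz.1, hg z hz.2⟩)
  rw [map_mul, show eval p f = 0 from hp, zero_mul]

theorem dvd_of_planeCurve_subset {f g : PolyXY} (hf : Irreducible f)
    (h : planeCurve f ⊆ planeCurve g) : f ∣ g :=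
  dvd_of_infinite_common_zeros hf ((planeCurve_infinite hf).mono fun _ hp => ⟨hp, h hp⟩)

theorem planeCurve_subset_of_dvd {f g : PolyXY} (h : f ∣ g) : planeCurve f ⊆ planeCurve g := by
  obtain ⟨k, rfl⟩ := h
  intro p hp
  simp only [planeCurve, Set.mem_ofPred_eq] at hp ⊢
  rw [map_mul, hp, zero_mul]

theorem planeCurve_mul (f g : PolyXY) : planeCurve (f * g) = planeCurve f ∪ planeCurve g := by
  ext p
  simp [planeCurve]

theorem planeCurve_one : planeCurve 1 = ∅ := by
  ext p
  simp [planeCurve]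

theorem mem_vanishingIdeal_planeCurve {f g : PolyXY} (hf : Irreducible f) :
    g ∈ vanishingIdeal ℂ (planeCurve f) ↔ f ∣ g :=
  ⟨fun h => dvd_of_planeCurve_subset hf fun p hp => h p hp,
    fun h _ hp => planeCurve_subset_of_dvd h hp⟩

theorem vanishingIdeal_planeCurve_isPrime {f : PolyXY} (hf : Irreducible f) :
    (vanishingIdeal ℂ (planeCurve f)).IsPrime := by
  have : vanishingIdeal ℂ (planeCurve f) = Ideal.span {f} := by
    ext g
    rw [mem_vanishingIdeal_planeCurve hf, Ideal.mem_span_singleton]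
  rw [this, Ideal.span_singleton_prime hf.ne_zero]
  exact hf.prime

/-- Maximality: the prime ideal of a larger `Z` contains an irreducible factor of `g`. That factor
vanishes on `{f = 0}`, so it is associated to `f`, which bounds `Z` from above. -/
theorem isIrredComponent_planeCurve {f g : PolyXY} (hf : Irreducible f) (hg : g ≠ 0)
    (hfg : f ∣ g) : IsIrredComponent (planeCurve g) (planeCurve f) := by
  refine ⟨⟨zariskiClosure_planeCurve f, vanishingIdeal_planeCurve_isPrime hf,
    planeCurve_subset_of_dvd hfg⟩, ?_⟩
  rintro Z ⟨hZ, hprime, hZg⟩ hfZ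
  have hle : ∀ h : PolyXY, h ∈ vanishingIdeal ℂ Z → f ∣ h := fun h hh =>
    (mem_vanishingIdeal_planeCurve hf).1 fun p hp => hh p (hfZ hp)
  obtain ⟨h, hgh, hdvd⟩ : ∃ h : PolyXY, h ∈ vanishingIdeal ℂ Z ∧ Irreducible h := by
    have hgZ : g ∈ vanishingIdeal ℂ Z := fun p hp => hZg hp
    obtain ⟨F, hF, hass⟩ := UniqueFactorizationMonoid.exists_prime_factors g hg
    obtain ⟨u, hu⟩ := hass.symm
    have : F.prod ∈ vanishingIdeal ℂ Z := by
      rw [← hu]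
      exact Ideal.mul_mem_right _ _ hgZ
    rw [hprime.multiset_prod_mem_iff_exists_mem] at this
    obtain ⟨h, hh, hhZ⟩ := this
    exact ⟨h, hhZ, (hF h hh).irreducible⟩
  have hass := (hf.associated_of_dvd hdvd (hle h hgh))
  have hfZ' : f ∈ vanishingIdeal ℂ Z := by
    obtain ⟨k, hk⟩ := hass.symm.dvd
    rw [hk]
    exact Ideal.mul_mem_right _ _ hgh
  exact fun p hp => hfZ' p hp

theorem IsIrredComponent.exists_irreducible_factor {g : PolyXY} (hg : g ≠ 0)
    {Z : Set (Fin 2 → ℂ)} (hZ : IsIrredComponent (planeCurve g) Z) :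
    ∃ f, Irreducible f ∧ f ∣ g ∧ Z = planeCurve f := by
  obtain ⟨⟨hcl, hprime, hsub⟩, hmax⟩ := hZ
  have hgZ : g ∈ vanishingIdeal ℂ Z := fun p hp => hsub hp
  obtain ⟨F, hF, hass⟩ := UniqueFactorizationMonoid.exists_prime_factors g hg
  obtain ⟨u, hu⟩ := hass.symm
  have : F.prod ∈ vanishingIdeal ℂ Z := by
    rw [← hu]
    exact Ideal.mul_mem_right _ _ hgZ
  rw [hprime.multiset_prod_mem_iff_exists_mem] at this
  obtain ⟨f, hf, hfZ⟩ := this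
  have hfi := (hF f hf).irreducible
  have hfg : f ∣ g := (Multiset.dvd_prod hf).trans hass.dvd
  have hZf : Z ⊆ planeCurve f := fun p hp => hfZ p hp
  exact ⟨f, hfi, hfg, hZf.antisymm (hmax ⟨zariskiClosure_planeCurve f,
    vanishingIdeal_planeCurve_isPrime hfi, planeCurve_subset_of_dvd hfg⟩ hZf)⟩

/-! ### Resultants over fields and over power series -/

/-- Only a bound on the degree of `g` is assumed, because specializing a point may lower the degree
of `Q`; the degree of `P` is preserved off `exceptional`. -/
theorem resultant_eq_zero_iff_exists_common_root {K : Type*} [Field K] [IsAlgClosed K]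
    {f g : Polynomial K} (hf : f ≠ 0) {n : ℕ} (hg : g.natDegree ≤ n) :
    Polynomial.resultant f g f.natDegree n = 0 ↔ ∃ z, f.eval z = 0 ∧ g.eval z = 0 := by
  rw [Polynomial.resultant_eq_prod_eval f g n hg (IsAlgClosed.splits f), mul_eq_zero,
    or_iff_right (pow_ne_zero _ (Polynomial.leadingCoeff_ne_zero.2 hf)), Multiset.prod_eq_zero_iff,
    Multiset.mem_map]
  simp [Polynomial.mem_roots hf]

/-- Hensel's lemma for the ideal generated by `X`; the leading coefficient is a unit, so `p` can be
made monic. -/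
theorem PowerSeries.exists_root_lift {K : Type*} [Field K] {p : Polynomial (PowerSeries K)}
    (hlc : constantCoeff p.leadingCoeff ≠ 0) {z : K}
    (hz : (p.map constantCoeff).eval z = 0)
    (hz' : (p.derivative.map constantCoeff).eval z ≠ 0) :
    ∃ τ : PowerSeries K, constantCoeff τ = z ∧ p.eval τ = 0 := by
  have hev : ∀ r : Polynomial (PowerSeries K),
      constantCoeff (r.eval (PowerSeries.C z)) = (r.map constantCoeff).eval z := by
    intro r
    rw [Polynomial.eval_map, ← Polynomial.eval₂_id, Polynomial.hom_eval₂, RingHom.comp_id,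
      PowerSeries.constantCoeff_C]
  obtain ⟨u, hu⟩ : IsUnit p.leadingCoeff :=
    PowerSeries.isUnit_iff_constantCoeff.2 (isUnit_iff_ne_zero.2 hlc)
  have hmonic : (Polynomial.C (u⁻¹ : (PowerSeries K)ˣ).1 * p).Monic := by
    apply Polynomial.monic_C_mul_of_mul_leadingCoeff_eq_one
    rw [← hu, Units.inv_mul]
  have hu0 : constantCoeff (u⁻¹ : (PowerSeries K)ˣ).1 ≠ 0 :=
    isUnit_iff_ne_zero.1 ((Units.isUnit _).map constantCoeff)
  obtain ⟨τ, hτ, hτz⟩ := HenselianRing.is_henselian (I := Ideal.span {(PowerSeries.X : PowerSeries K)})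
    _ hmonic (PowerSeries.C z) (by
      rw [Ideal.mem_span_singleton, PowerSeries.X_dvd_iff]
      rw [Polynomial.eval_mul, map_mul, hev p, hz, mul_zero]) (by
      refine IsUnit.map _ ?_
      rw [PowerSeries.isUnit_iff_constantCoeff, isUnit_iff_ne_zero, Polynomial.derivative_C_mul,
        Polynomial.eval_mul, map_mul, hev p.derivative, Polynomial.eval_C]
      exact mul_ne_zero hu0 hz')
  refine ⟨τ, ?_, ?_⟩
  · rw [Ideal.mem_span_singleton, PowerSeries.X_dvd_iff, map_sub, PowerSeries.constantCoeff_C] at hτz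
    exact sub_eq_zero.1 hτz
  · rw [Polynomial.IsRoot.def, Polynomial.eval_mul, Polynomial.eval_C] at hτ
    exact (Units.mul_right_eq_zero _).1 hτ

theorem PowerSeries.order_eq_zero_of_constantCoeff_ne_zero {K : Type*} [Field K]
    {a : PowerSeries K} (h : constantCoeff a ≠ 0) : a.order = 0 := by
  have : a.order ≤ (0 : ℕ) := PowerSeries.order_le 0 (by simpa using h)
  simpa using this

/-- The lifted roots split off a monic factor `A = ∏ (X - τ z)` from `p = A * b`. The resultant of
`A` and `q` is the product of the values `q(τ z)`, each of order one, and the resultant of `b` and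
`q` is a unit. -/
theorem PowerSeries.order_resultant {K : Type*} [Field K] [IsAlgClosed K]
    {p q : Polynomial (PowerSeries K)} {k : ℕ}
    (hlc : constantCoeff p.leadingCoeff ≠ 0) (hq : q.natDegree ≤ k) (Z : Finset K)
    (hZ : ∀ z, z ∈ Z ↔ (p.map constantCoeff).eval z = 0 ∧ (q.map constantCoeff).eval z = 0)
    (hsimple : ∀ z ∈ Z, (p.derivative.map constantCoeff).eval z ≠ 0)
    (horder : ∀ z ∈ Z, ∀ τ : PowerSeries K, constantCoeff τ = z → p.eval τ = 0 →
      (q.eval τ).order = 1) :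
    (Polynomial.resultant p q p.natDegree k).order = Z.card := by
  classical
  have hp0 : p ≠ 0 := by
    rintro rfl
    simp at hlc
  choose! τ hτz hτ using fun z (hz : z ∈ Z) =>
    PowerSeries.exists_root_lift hlc ((hZ z).1 hz).1 (hsimple z hz)
  obtain ⟨b, hb⟩ : (∏ z ∈ Z, (Polynomial.X - Polynomial.C (τ z))) ∣ p := by
    apply Finset.prod_dvd_of_coprime
    · intro z hz w hw hzw
      apply Polynomial.isCoprime_X_sub_C_of_isUnit_sub
      rw [PowerSeries.isUnit_iff_constantCoeff, isUnit_iff_ne_zero, map_sub, hτz z hz, hτz w hw]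
      exact sub_ne_zero.2 hzw
    · intro z hz
      exact Polynomial.dvd_iff_isRoot.2 (hτ z hz)
  set A := ∏ z ∈ Z, (Polynomial.X - Polynomial.C (τ z)) with hA
  have hAm : A.Monic := Polynomial.monic_prod_of_monic _ _ fun z _ => Polynomial.monic_X_sub_C _
  have hb0 : b ≠ 0 := by
    rintro rfl
    exact hp0 (by simpa using hb)
  have hlcb : constantCoeff b.leadingCoeff ≠ 0 := by
    rwa [hb, Polynomial.leadingCoeff_mul, hAm.leadingCoeff, one_mul] at hlc
  have hbdeg : (b.map (constantCoeff (R := K))).natDegree = b.natDegree :=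
    Polynomial.natDegree_map_of_leadingCoeff_ne_zero _ hlcb
  have hbmap : b.map (constantCoeff (R := K)) ≠ 0 := by
    intro h
    have := congrArg (fun r => Polynomial.coeff r b.natDegree) h
    simp only [Polynomial.coeff_map, Polynomial.coeff_zero] at this
    exact hlcb this
  have hres : constantCoeff (Polynomial.resultant b q b.natDegree k) ≠ 0 := by
    rw [← Polynomial.resultant_map_map, ← hbdeg, Ne,
      resultant_eq_zero_iff_exists_common_root hbmap (Polynomial.natDegree_map_le.trans hq)]
    rintro ⟨z, h1, h2⟩
    have hzZ : z ∈ Z := by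
      rw [hZ]
      refine ⟨?_, h2⟩
      rw [hb, Polynomial.map_mul, Polynomial.eval_mul, h1, mul_zero]
    -- A common root of the reductions of `b` and `q` lies in `Z`, so it is also a root of `A`, and
    -- hence a double root of `p`.
    apply hsimple z hzZ
    have hAz : (A.map (constantCoeff (R := K))).eval z = 0 := by
      rw [hA, Polynomial.map_prod, Polynomial.eval_prod]
      refine Finset.prod_eq_zero hzZ ?_
      simp [hτz z hzZ]
    rw [hb, Polynomial.derivative_mul, Polynomial.map_add, Polynomial.map_mul, Polynomial.map_mul,
      Polynomial.eval_add, Polynomial.eval_mul, Polynomial.eval_mul, h1, hAz]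
    ring
  have hdeg : p.natDegree = A.natDegree + b.natDegree := by
    rw [hb, Polynomial.natDegree_mul hAm.ne_zero hb0]
  rw [hdeg, hb, Polynomial.resultant_mul_left _ _ _ _ hq, PowerSeries.order_mul,
    PowerSeries.order_eq_zero_of_constantCoeff_ne_zero hres, add_zero, hA,
    Polynomial.resultant_prod_left _ _ _ _ (by simp) hq]
  have : ∀ s : Finset K, s ⊆ Z → (∏ z ∈ s, (Polynomial.X - Polynomial.C (τ z)).resultant q
      (Polynomial.X - Polynomial.C (τ z)).natDegree k).order = (s.card : ℕ∞) := by
    intro s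
    induction s using Finset.induction with
    | empty => intro _; simp
    | insert a s ha ih =>
      intro hs
      rw [Finset.prod_insert ha, PowerSeries.order_mul, ih ((Finset.subset_insert _ _).trans hs),
        Finset.card_insert_of_notMem ha, Polynomial.natDegree_X_sub_C,
        Polynomial.resultant_X_sub_C_left _ _ _ hq,
        horder a (hs (Finset.mem_insert_self _ _)) _ (hτz a (hs (Finset.mem_insert_self _ _)))
          (hτ a (hs (Finset.mem_insert_self _ _)))]
      push_cast
      ring
  exact this Z subset_rfl

/-! ### States, offset points and the norm to ℂ[t] -/

/-- A complex rational parametrization `(X / W, Y / W)` together with a distance `d`, whose image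
lies on no line and on no circle of radius `d`. -/
structure OffsetData where
  X : Polynomial ℂ
  Y : Polynomial ℂ
  W : Polynomial ℂ
  d : ℂ
  W_ne_zero : W ≠ 0
  d_ne_zero : d ≠ 0
  no_line : ∀ a b c : ℂ, Polynomial.C a * X + Polynomial.C b * Y = Polynomial.C c * W →
    a = 0 ∧ b = 0
  no_circle : ∀ a b : ℂ, (X - Polynomial.C a * W) ^ 2 + (Y - Polynomial.C b * W) ^ 2 ≠
    Polynomial.C (d ^ 2) * W ^ 2

/-- Two polynomials with vanishing Wronskian are proportional. -/
theorem exists_eq_C_mul_of_derivative_mul_eq {K : Type*} [Field K] [CharZero K]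
    {A W : Polynomial K} (hW : W ≠ 0)
    (h : Polynomial.derivative A * W = A * Polynomial.derivative W) :
    ∃ c : K, A = Polynomial.C c * W := by
  -- The top coefficients of both sides are the product of the leading coefficients times one of the
  -- two degrees, so the degrees agree. Applied below to `A` minus the multiple of `W` with the same
  -- leading term, this forces that difference to vanish.
  have key : ∀ B : Polynomial K, Polynomial.derivative B * W = B * Polynomial.derivative W →
      B ≠ 0 → B.natDegree = W.natDegree := by
    intro B hB hB0
    have h1 := congrArg (fun p => Polynomial.coeff p (B.natDegree + W.natDegree - 1)) hB
    by_cases hb : B.natDegree = 0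
    · by_contra hne
      obtain ⟨b, rfl⟩ := Polynomial.natDegree_eq_zero.1 hb
      rw [Polynomial.derivative_C, zero_mul, eq_comm, mul_eq_zero] at hB
      rcases hB with hB | hB
      · exact hB0 hB
      · rw [hb] at hne
        exact hne (Polynomial.derivative_eq_zero.1 hB).symm
    · by_cases hw : W.natDegree = 0
      · obtain ⟨w, rfl⟩ := Polynomial.natDegree_eq_zero.1 hw
        rw [Polynomial.derivative_C, mul_zero, mul_eq_zero] at hB
        rcases hB with hB | hB
        · exact absurd (Polynomial.derivative_eq_zero.1 hB) hb
        · exact absurd hB hW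
      · have e1 : B.natDegree + W.natDegree - 1 = (B.natDegree - 1) + W.natDegree := by omega
        have e2 : B.natDegree + W.natDegree - 1 = B.natDegree + (W.natDegree - 1) := by omega
        nth_rewrite 1 [e1] at h1
        rw [e2, Polynomial.coeff_mul_add_eq_of_natDegree_le (Polynomial.natDegree_derivative_le _) le_rfl,
          Polynomial.coeff_mul_add_eq_of_natDegree_le le_rfl (Polynomial.natDegree_derivative_le _),
          Polynomial.coeff_derivative, Polynomial.coeff_derivative, Nat.sub_add_cancel (by omega),
          Nat.sub_add_cancel (by omega)] at h1
        have hb' : B.coeff B.natDegree ≠ 0 := Polynomial.leadingCoeff_ne_zero.2 hB0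
        have hw' : W.coeff W.natDegree ≠ 0 := Polynomial.leadingCoeff_ne_zero.2 hW
        have h2 : ((B.natDegree - 1 : ℕ) : K) + 1 = ((W.natDegree - 1 : ℕ) : K) + 1 := by
          apply mul_left_cancel₀ (mul_ne_zero hb' hw')
          linear_combination h1
        have h3 : B.natDegree - 1 = W.natDegree - 1 := by
          exact_mod_cast add_right_cancel h2
        omega
  by_cases hA : A = 0
  · exact ⟨0, by simp [hA]⟩
  have hdeg := key A h hA
  refine ⟨A.leadingCoeff / W.leadingCoeff, ?_⟩
  by_contra hne
  have hlw : W.leadingCoeff ≠ 0 := Polynomial.leadingCoeff_ne_zero.2 hW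
  have hB0 : A - Polynomial.C (A.leadingCoeff / W.leadingCoeff) * W ≠ 0 := sub_ne_zero.2 hne
  have hBdeg := key _ (by
    simp only [Polynomial.derivative_sub, Polynomial.derivative_mul, Polynomial.derivative_C]
    linear_combination h) hB0
  have hco : (A - Polynomial.C (A.leadingCoeff / W.leadingCoeff) * W).leadingCoeff = 0 := by
    rw [Polynomial.leadingCoeff, hBdeg, Polynomial.coeff_sub, Polynomial.coeff_C_mul, ← hdeg,
      Polynomial.coeff_natDegree, hdeg, Polynomial.coeff_natDegree, div_mul_cancel₀ _ hlw, sub_self]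
  exact hB0 (Polynomial.leadingCoeff_eq_zero.1 hco)

theorem Polynomial.finite_zeros {p : Polynomial ℂ} (hp : p ≠ 0) : {t | p.eval t = 0}.Finite := by
  refine (p.rootSet_finite ℂ).subset fun t ht => ?_
  rw [Polynomial.mem_rootSet]
  exact ⟨hp, by simpa using ht⟩

theorem Polynomial.eq_zero_of_infinite_zeros {p : Polynomial ℂ} (h : {t | p.eval t = 0}.Infinite) :
    p = 0 := by
  by_contra hp
  exact h (Polynomial.finite_zeros hp)

/-- The value at `(q, t)` of a polynomial in `x, y, t`. -/
noncomputable def evalXYT (g : Polynomial PolyXY) (q : Fin 2 → ℂ) (t : ℂ) : ℂ :=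
  (g.map (MvPolynomial.eval q)).eval t

namespace OffsetData

noncomputable section

variable (D : OffsetData)

def U : Polynomial ℂ :=
  Polynomial.derivative D.X * D.W - D.X * Polynomial.derivative D.W

def V : Polynomial ℂ :=
  Polynomial.derivative D.Y * D.W - D.Y * Polynomial.derivative D.W

def S : Polynomial ℂ := D.U ^ 2 + D.V ^ 2

/-- `s` is a nonzero square root of `U² + V²` at a parameter `t` where the point is defined. -/
def IsState (t s : ℂ) : Prop :=
  D.W.eval t ≠ 0 ∧ s ≠ 0 ∧ s ^ 2 = D.S.eval t

def qx (t s : ℂ) : ℂ := D.X.eval t / D.W.eval t + D.d * D.V.eval t / s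

def qy (t s : ℂ) : ℂ := D.Y.eval t / D.W.eval t - D.d * D.U.eval t / s

/-- The offset point of the state `(t, s)`. -/
def q (t s : ℂ) : Fin 2 → ℂ := ![D.qx t s, D.qy t s]

/-- The point of the curve. -/
def pt (t : ℂ) : Fin 2 → ℂ := ![D.X.eval t / D.W.eval t, D.Y.eval t / D.W.eval t]

/-- The combination is the Wronskian of `aX + bY` and `W`, so its vanishing would put the curve on a
line. -/
theorem eq_zero_of_combination {a b : ℂ}
    (h : Polynomial.C a * D.U + Polynomial.C b * D.V = 0) : a = 0 ∧ b = 0 := by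
  obtain ⟨c, hc⟩ := exists_eq_C_mul_of_derivative_mul_eq (A := Polynomial.C a * D.X + Polynomial.C b * D.Y)
    D.W_ne_zero (by
      simp only [Polynomial.derivative_add, Polynomial.derivative_mul, Polynomial.derivative_C]
      simp only [U, V] at h
      linear_combination h)
  exact D.no_line a b c hc

/-- Over ℂ the form factors as `(U + iV)(U - iV)`, and neither factor is zero by
`eq_zero_of_combination`. -/
theorem S_ne_zero : D.S ≠ 0 := by
  intro h
  have hI : Polynomial.C Complex.I * Polynomial.C Complex.I = (-1 : Polynomial ℂ) := by
    rw [← Polynomial.C_mul, Complex.I_mul_I]; simp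
  have : (D.U + Polynomial.C Complex.I * D.V) * (D.U - Polynomial.C Complex.I * D.V) = 0 := by
    rw [S] at h
    linear_combination h - D.V ^ 2 * hI
  rcases mul_eq_zero.1 this with h1 | h1
  · have := D.eq_zero_of_combination (a := 1) (b := Complex.I) (by simpa using h1)
    simp at this
  · have := D.eq_zero_of_combination (a := 1) (b := -Complex.I) (by
      simpa [sub_eq_add_neg] using h1)
    simp at this

variable {D}

theorem IsState.S_ne_zero {t s : ℂ} (h : D.IsState t s) : D.S.eval t ≠ 0 := by
  rw [← h.2.2]
  exact pow_ne_zero 2 h.2.1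

theorem IsState.neg {t s : ℂ} (h : D.IsState t s) : D.IsState t (-s) :=
  ⟨h.1, neg_ne_zero.2 h.2.1, by rw [neg_sq]; exact h.2.2⟩

theorem IsState.sq {t s : ℂ} (h : D.IsState t s) : s ^ 2 = D.U.eval t ^ 2 + D.V.eval t ^ 2 := by
  rw [h.2.2, S]; simp

theorem IsState.eq_or_eq_neg {t s s' : ℂ} (h : D.IsState t s) (h' : D.IsState t s') :
    s' = s ∨ s' = -s := by
  rw [← sq_eq_sq_iff_eq_or_eq_neg, h.2.2, h'.2.2]

variable (D)

theorem exists_isState {t : ℂ} (hW : D.W.eval t ≠ 0) (hS : D.S.eval t ≠ 0) :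
    ∃ s, D.IsState t s := by
  obtain ⟨s, hs⟩ := IsAlgClosed.exists_pow_nat_eq (D.S.eval t) (n := 2) (by norm_num)
  refine ⟨s, hW, ?_, hs⟩
  rintro rfl
  exact hS (by rw [← hs]; simp)

theorem finite_not_good : {t : ℂ | ¬ ∃ s, D.IsState t s}.Finite := by
  refine (Polynomial.finite_zeros (mul_ne_zero D.W_ne_zero D.S_ne_zero)).subset fun t ht => ?_
  simp only [Set.mem_ofPred_eq] at ht ⊢
  by_contra h
  rw [Polynomial.eval_mul, mul_eq_zero, not_or] at h
  exact ht (D.exists_isState h.1 h.2)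

theorem exists_isState_notMem {T : Set ℂ} (hT : T.Finite) : ∃ t s, t ∉ T ∧ D.IsState t s := by
  obtain ⟨t, ht⟩ := (hT.union D.finite_not_good).infinite_compl.nonempty
  simp only [Set.mem_compl_iff, Set.mem_union, not_or, Set.mem_ofPred_eq, not_not] at ht
  obtain ⟨ht, s, hs⟩ := ht
  exact ⟨t, s, ht, hs⟩

/-- Such parameters give points of the curve at distance `d` from `p`, and the curve is not
contained in that circle. -/
theorem finite_q_eq (p : Fin 2 → ℂ) : {t | ∃ s, D.IsState t s ∧ D.q t s = p}.Finite := by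
  refine (Polynomial.finite_zeros (sub_ne_zero.2 (D.no_circle (p 0) (p 1)))).subset ?_
  rintro t ⟨s, hs, rfl⟩
  obtain ⟨hW, hs0, hs2⟩ := id hs
  have := hs.sq
  simp only [q, qx, qy, Set.mem_ofPred_eq, Matrix.cons_val_zero, Matrix.cons_val_one, Polynomial.eval_sub,
    Polynomial.eval_add, Polynomial.eval_mul, Polynomial.eval_pow, Polynomial.eval_C]
  field_simp
  linear_combination (- D.d ^ 2 * D.W.eval t ^ 2) * this

theorem finite_q_mem {T : Set (Fin 2 → ℂ)} (hT : T.Finite) :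
    {t | ∃ s, D.IsState t s ∧ D.q t s ∈ T}.Finite := by
  refine (hT.biUnion fun p _ => D.finite_q_eq p).subset ?_
  rintro t ⟨s, hs, h⟩
  simp only [Set.mem_iUnion]
  exact ⟨_, h, s, hs, rfl⟩

/-- The coordinates of `q` lie in ℂ(t)[s] with `s² = S`, where `1/s = s/S`; so the only denominators
are powers of `W S`. -/
theorem exists_norm_form (g : Polynomial PolyXY) : ∃ (A B : Polynomial ℂ) (k : ℕ),
    ∀ t s, D.IsState t s →
      (D.W.eval t * D.S.eval t) ^ k * evalXYT g (D.q t s) t = A.eval t + B.eval t * s := by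
  have hmul : ∀ g h : Polynomial PolyXY,
      (∃ (A B : Polynomial ℂ) (k : ℕ), ∀ t s, D.IsState t s →
        (D.W.eval t * D.S.eval t) ^ k * evalXYT g (D.q t s) t = A.eval t + B.eval t * s) →
      (∃ (A B : Polynomial ℂ) (k : ℕ), ∀ t s, D.IsState t s →
        (D.W.eval t * D.S.eval t) ^ k * evalXYT h (D.q t s) t = A.eval t + B.eval t * s) →
      (∃ (A B : Polynomial ℂ) (k : ℕ), ∀ t s, D.IsState t s →
        (D.W.eval t * D.S.eval t) ^ k * evalXYT (g * h) (D.q t s) t = A.eval t + B.eval t * s) := by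
    rintro g h ⟨A, B, k, h1⟩ ⟨A', B', k', h2⟩
    refine ⟨A * A' + B * B' * D.S, A * B' + A' * B, k + k', fun t s hs => ?_⟩
    simp only [evalXYT, Polynomial.map_mul, Polynomial.eval_mul, Polynomial.eval_add] at h1 h2 ⊢
    rw [pow_add, ← hs.2.2]
    have e1 := h1 t s hs
    have e2 := h2 t s hs
    rw [← hs.2.2] at e1 e2
    linear_combination (D.W.eval t * s ^ 2) ^ k' * (h.map (MvPolynomial.eval (D.q t s))).eval t * e1 +
      (A.eval t + B.eval t * s) * e2
  have hadd : ∀ g h : Polynomial PolyXY,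
      (∃ (A B : Polynomial ℂ) (k : ℕ), ∀ t s, D.IsState t s →
        (D.W.eval t * D.S.eval t) ^ k * evalXYT g (D.q t s) t = A.eval t + B.eval t * s) →
      (∃ (A B : Polynomial ℂ) (k : ℕ), ∀ t s, D.IsState t s →
        (D.W.eval t * D.S.eval t) ^ k * evalXYT h (D.q t s) t = A.eval t + B.eval t * s) →
      (∃ (A B : Polynomial ℂ) (k : ℕ), ∀ t s, D.IsState t s →
        (D.W.eval t * D.S.eval t) ^ k * evalXYT (g + h) (D.q t s) t = A.eval t + B.eval t * s) := by
    rintro g h ⟨A, B, k, h1⟩ ⟨A', B', k', h2⟩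
    refine ⟨(D.W * D.S) ^ k' * A + (D.W * D.S) ^ k * A',
      (D.W * D.S) ^ k' * B + (D.W * D.S) ^ k * B', k + k', fun t s hs => ?_⟩
    simp only [evalXYT, Polynomial.map_add, Polynomial.eval_mul, Polynomial.eval_add,
      Polynomial.eval_pow] at h1 h2 ⊢
    rw [pow_add]
    linear_combination (D.W.eval t * D.S.eval t) ^ k' * h1 t s hs +
      (D.W.eval t * D.S.eval t) ^ k * h2 t s hs
  induction g using Polynomial.induction_on' with
  | add p q hp hq => exact hadd p q hp hq
  | monomial n a =>
    rw [← Polynomial.C_mul_X_pow_eq_monomial]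
    apply hmul
    · induction a using MvPolynomial.induction_on with
      | C a =>
        refine ⟨Polynomial.C a, 0, 0, fun t s hs => ?_⟩
        simp [evalXYT]
      | add p q hp hq =>
        rw [Polynomial.C_add]
        exact hadd _ _ hp hq
      | mul_X p i hp =>
        rw [Polynomial.C_mul]
        refine hmul _ _ hp ?_
        fin_cases i
        · refine ⟨D.X * D.S, Polynomial.C D.d * D.V * D.W, 1, fun t s hs => ?_⟩
          obtain ⟨hW, hs0, hs2⟩ := id hs
          simp only [evalXYT, q, qx, ← hs2, Polynomial.map_C, Polynomial.eval_C, Polynomial.eval_mul,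
            Fin.zero_eta, MvPolynomial.eval_X, Matrix.cons_val_zero]
          field_simp
        · refine ⟨D.Y * D.S, - Polynomial.C D.d * D.U * D.W, 1, fun t s hs => ?_⟩
          obtain ⟨hW, hs0, hs2⟩ := id hs
          simp only [evalXYT, q, qy, ← hs2, Polynomial.map_C, Polynomial.eval_C, Polynomial.eval_mul,
            Fin.mk_one, MvPolynomial.eval_X, Matrix.cons_val_one, Matrix.cons_val_fin_one, Polynomial.eval_neg]
          field_simp
          ring
    · exact ⟨Polynomial.X ^ n, 0, 0, fun t s hs => by simp [evalXYT]⟩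

theorem mul_eq_zero_of_infinite {g : Polynomial PolyXY} {A B : Polynomial ℂ} {k : ℕ}
    (hAB : ∀ t s, D.IsState t s →
      (D.W.eval t * D.S.eval t) ^ k * evalXYT g (D.q t s) t = A.eval t + B.eval t * s)
    (h : {t | ∃ s, D.IsState t s ∧ evalXYT g (D.q t s) t = 0}.Infinite) :
    A ^ 2 - B ^ 2 * D.S = 0 := by
  refine Polynomial.eq_zero_of_infinite_zeros (h.mono ?_)
  rintro t ⟨s, hs, h0⟩
  have := hAB t s hs
  rw [h0, mul_zero] at this
  simp only [Set.mem_ofPred_eq, Polynomial.eval_sub, Polynomial.eval_mul, Polynomial.eval_pow, ← hs.2.2]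
  linear_combination (B.eval t * s - A.eval t) * this

/-- Vanishing over infinitely many parameters kills the norm `A² - B²S`, which is the product of the
values `A ± Bs` at the two signs. -/
theorem exists_state_zero_of_infinite {g : Polynomial PolyXY}
    (h : {t | ∃ s, D.IsState t s ∧ evalXYT g (D.q t s) t = 0}.Infinite) {t s : ℂ}
    (hs : D.IsState t s) :
    evalXYT g (D.q t s) t = 0 ∨ evalXYT g (D.q t (-s)) t = 0 := by
  obtain ⟨A, B, k, hAB⟩ := D.exists_norm_form g
  have h0 := congrArg (Polynomial.eval t) (D.mul_eq_zero_of_infinite hAB h)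
  simp only [Polynomial.eval_sub, Polynomial.eval_mul, Polynomial.eval_pow, ← hs.2.2,
    Polynomial.eval_zero] at h0
  have hne : (D.W.eval t * D.S.eval t) ^ k ≠ 0 := pow_ne_zero _ (mul_ne_zero hs.1 hs.S_ne_zero)
  have h1 := hAB t s hs
  have h2 := hAB t (-s) hs.neg
  have : (A.eval t + B.eval t * s) * (A.eval t + B.eval t * -s) = 0 := by
    linear_combination h0
  rw [← h1, ← h2] at this
  simpa [hne] using this

/-- Over almost all `t` both signs give zero, so `A` and `B` are themselves zero and no exceptional
state remains. -/
theorem forall_state_zero_of_finite {g : Polynomial PolyXY}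
    (h : {t | ∃ s, D.IsState t s ∧ evalXYT g (D.q t s) t ≠ 0}.Finite) {t s : ℂ}
    (hs : D.IsState t s) : evalXYT g (D.q t s) t = 0 := by
  obtain ⟨A, B, k, hAB⟩ := D.exists_norm_form g
  have hinf : ∀ P : Polynomial ℂ, (∀ t s, D.IsState t s → A.eval t + B.eval t * s = 0 →
      A.eval t + B.eval t * -s = 0 → P.eval t = 0) → P = 0 := by
    intro P hP
    refine Polynomial.eq_zero_of_infinite_zeros
      ((h.union D.finite_not_good).infinite_compl.mono ?_)
    intro t ht
    simp only [Set.mem_compl_iff, Set.mem_union, not_or, Set.mem_ofPred_eq, not_not] at ht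
    obtain ⟨ht, s, hs⟩ := ht
    have h0 : ∀ s, D.IsState t s → evalXYT g (D.q t s) t = 0 := fun s hs => by
      by_contra hne
      exact ht ⟨s, hs, hne⟩
    refine hP t s hs ?_ ?_
    · rw [← hAB t s hs, h0 s hs, mul_zero]
    · rw [← hAB t _ hs.neg, h0 _ hs.neg, mul_zero]
  have hA : A = 0 := hinf A fun t s hs h1 h2 => by linear_combination (h1 + h2) / 2
  have hB : B = 0 := hinf B fun t s hs h1 h2 => by
    have : B.eval t * s = 0 := by linear_combination (h1 - h2) / 2
    simpa [hs.2.1] using this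
  have := hAB t s hs
  rw [hA, hB] at this
  simpa [hs.1, hs.S_ne_zero] using this

end

end OffsetData

/-! ### Analytic branches of the offset and their tangents -/

theorem hasDerivAt_eval_mvPolynomial (f : PolyXY) {x y : ℂ → ℂ} {x' y' t : ℂ}
    (hx : HasDerivAt x x' t) (hy : HasDerivAt y y' t) :
    HasDerivAt (fun u => eval ![x u, y u] f)
      (eval ![x t, y t] (pderiv 0 f) * x' + eval ![x t, y t] (pderiv 1 f) * y') t := by
  induction f using MvPolynomial.induction_on with
  | C a => simpa using hasDerivAt_const t a
  | add p q hp hq =>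
    simp only [map_add]
    exact (hp.fun_add hq).congr_deriv (by ring)
  | mul_X p i hp =>
    fin_cases i
    · simp only [map_mul, Derivation.leibniz, smul_eq_mul, map_add, eval_X, Fin.zero_eta,
        Matrix.cons_val_zero]
      exact (hp.fun_mul hx).congr_deriv (by simp; ring)
    · simp only [map_mul, Derivation.leibniz, smul_eq_mul, map_add, eval_X, Fin.mk_one,
        Matrix.cons_val_one]
      exact (hp.fun_mul hy).congr_deriv (by simp; ring)

namespace OffsetData

noncomputable section

variable (D : OffsetData)

/-- The polynomial `a ∈ ℂ[t]` as an element of `ℂ[x, y][t]`. -/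
def lift (a : Polynomial ℂ) : Polynomial PolyXY := a.map MvPolynomial.C

/-- The normal line at the point of parameter `t`. -/
def normal : Polynomial PolyXY :=
  lift D.U * (lift D.W * RatParam.xT - lift D.X) + lift D.V * (lift D.W * RatParam.yT - lift D.Y)

/-- The circle of radius `d` about the point of parameter `t`. -/
def circle : Polynomial PolyXY :=
  (lift D.W * RatParam.xT - lift D.X) ^ 2 + (lift D.W * RatParam.yT - lift D.Y) ^ 2
    - Polynomial.C (MvPolynomial.C (D.d ^ 2)) * lift D.W ^ 2

theorem map_eval_lift (a : Polynomial ℂ) (p : Fin 2 → ℂ) : (lift a).map (eval p) = a := by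
  rw [lift, Polynomial.map_map]
  rw [show (eval p).comp C = RingHom.id ℂ from RingHom.ext fun x => eval_C x, Polynomial.map_id]

theorem map_eval_normal (p : Fin 2 → ℂ) : D.normal.map (eval p) =
    D.U * (D.W * Polynomial.C (p 0) - D.X) + D.V * (D.W * Polynomial.C (p 1) - D.Y) := by
  simp [normal, map_eval_lift, RatParam.xT, RatParam.yT]

theorem map_eval_circle (p : Fin 2 → ℂ) : D.circle.map (eval p) =
    (D.W * Polynomial.C (p 0) - D.X) ^ 2 + (D.W * Polynomial.C (p 1) - D.Y) ^ 2 -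
      Polynomial.C (D.d ^ 2) * D.W ^ 2 := by
  simp [circle, map_eval_lift, RatParam.xT, RatParam.yT]

theorem evalXYT_normal (p : Fin 2 → ℂ) (t : ℂ) : evalXYT D.normal p t =
    D.U.eval t * (D.W.eval t * p 0 - D.X.eval t) + D.V.eval t * (D.W.eval t * p 1 - D.Y.eval t) := by
  simp [evalXYT, map_eval_normal]

theorem evalXYT_circle (p : Fin 2 → ℂ) (t : ℂ) : evalXYT D.circle p t =
    (D.W.eval t * p 0 - D.X.eval t) ^ 2 + (D.W.eval t * p 1 - D.Y.eval t) ^ 2 -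
      D.d ^ 2 * D.W.eval t ^ 2 := by
  simp [evalXYT, map_eval_circle]

theorem evalXYT_derivative_normal (p : Fin 2 → ℂ) (t : ℂ) :
    evalXYT (Polynomial.derivative D.normal) p t =
      D.U.derivative.eval t * (D.W.eval t * p 0 - D.X.eval t) +
      D.U.eval t * (D.W.derivative.eval t * p 0 - D.X.derivative.eval t) +
      (D.V.derivative.eval t * (D.W.eval t * p 1 - D.Y.eval t) +
      D.V.eval t * (D.W.derivative.eval t * p 1 - D.Y.derivative.eval t)) := by
  rw [evalXYT, ← Polynomial.derivative_map, map_eval_normal]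
  simp

/-- The state `(t, s)` gives a critical point of the parametrization of the offset. -/
def IsCritical (t s : ℂ) : Prop := evalXYT (Polynomial.derivative D.normal) (D.q t s) t = 0

variable {D}

/-- The quotient `S(t)/S(t₀)` equals 1 at `t₀`, so its principal square root is analytic there;
multiplied by `s₀` it gives the root of `S`. -/
theorem IsState.exists_branch {t₀ s₀ : ℂ} (h : D.IsState t₀ s₀) :
    ∃ σ : ℂ → ℂ, AnalyticAt ℂ σ t₀ ∧ σ t₀ = s₀ ∧ ∀ᶠ t in 𝓝 t₀, D.IsState t (σ t) := by
  have hS := h.S_ne_zero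
  have hquot : AnalyticAt ℂ (fun t => D.S.eval t / D.S.eval t₀) t₀ :=
    (D.S.differentiable.analyticAt t₀).div analyticAt_const hS
  have h1 : D.S.eval t₀ / D.S.eval t₀ = 1 := div_self hS
  have hσ : AnalyticAt ℂ (fun t => s₀ * (D.S.eval t / D.S.eval t₀) ^ (1 / 2 : ℂ)) t₀ := by
    refine analyticAt_const.mul (hquot.cpow analyticAt_const ?_)
    rw [h1]
    exact Complex.one_mem_slitPlane
  refine ⟨_, hσ, by simp [h1], ?_⟩
  have e1 : ∀ᶠ t in 𝓝 t₀, D.W.eval t ≠ 0 := D.W.continuous.continuousAt.eventually_ne h.1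
  have e2 : ∀ᶠ t in 𝓝 t₀, D.S.eval t ≠ 0 := D.S.continuous.continuousAt.eventually_ne hS
  filter_upwards [e1, e2] with t h1 h2
  refine ⟨h1, ?_, ?_⟩
  · refine mul_ne_zero h.2.1 ?_
    rw [Ne, Complex.cpow_eq_zero_iff]
    simp [h2, hS]
  · rw [mul_pow, h.2.2, ← Complex.cpow_nat_mul]
    norm_num
    field_simp

/-- The offset is parallel to the curve: its velocity is proportional to `(U, V)`. The last identity
is the chain rule for the normal polynomial, which vanishes along the branch; it shows that the
velocity vanishes only at critical states. -/
theorem branch_hasDerivAt {σ : ℂ → ℂ} {t : ℂ} (hσ : DifferentiableAt ℂ σ t)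
    (hst : ∀ᶠ u in 𝓝 t, D.IsState u (σ u)) :
    ∃ x' y' : ℂ, HasDerivAt (fun u => D.qx u (σ u)) x' t ∧ HasDerivAt (fun u => D.qy u (σ u)) y' t ∧
      D.V.eval t * x' = D.U.eval t * y' ∧
      evalXYT (Polynomial.derivative D.normal) (D.q t (σ t)) t +
        D.W.eval t * (D.U.eval t * x' + D.V.eval t * y') = 0 := by
  have hs := hst.self_of_nhds
  obtain ⟨hW, hs0, hs2⟩ := id hs
  have hd := hσ.hasDerivAt
  set s' := deriv σ t with hs'
  have hrel : σ t * s' = D.U.eval t * D.U.derivative.eval t + D.V.eval t * D.V.derivative.eval t := by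
    have e1 : HasDerivAt (fun u => σ u ^ 2) (2 * σ t * s') t := by
      simpa using hd.fun_pow 2
    have e2 : HasDerivAt (fun u => σ u ^ 2) (D.S.derivative.eval t) t := by
      refine (D.S.hasDerivAt t).congr_of_eventuallyEq ?_
      filter_upwards [hst] with u hu using hu.2.2
    have := e1.unique e2
    simp only [S, Polynomial.derivative_add, Polynomial.derivative_pow, Polynomial.eval_add,
      Polynomial.eval_mul, Polynomial.eval_pow] at this
    simp at this
    linear_combination this / 2
  have hx := ((D.X.hasDerivAt t).div (D.W.hasDerivAt t) hW).add
    (((D.V.hasDerivAt t).const_mul D.d).div hd hs0)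
  have hy := ((D.Y.hasDerivAt t).div (D.W.hasDerivAt t) hW).sub
    (((D.U.hasDerivAt t).const_mul D.d).div hd hs0)
  have hsq := hs.sq
  have hU : D.U.eval t = D.X.derivative.eval t * D.W.eval t - D.X.eval t * D.W.derivative.eval t := by
    simp [U]
  have hV : D.V.eval t = D.Y.derivative.eval t * D.W.eval t - D.Y.eval t * D.W.derivative.eval t := by
    simp [V]
  rw [← hU] at hx
  rw [← hV] at hy
  refine ⟨_, _, hx, hy, ?_, ?_⟩
  · field_simp
    linear_combination D.d * D.W.eval t ^ 2 * (s' * hsq - σ t * hrel)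
  · rw [evalXYT_derivative_normal]
    simp only [q, qx, qy, Matrix.cons_val_zero, Matrix.cons_val_one]
    have hX' : D.X.derivative.eval t = (D.U.eval t + D.X.eval t * D.W.derivative.eval t) / D.W.eval t := by
      rw [hU]; field_simp; ring
    have hY' : D.Y.derivative.eval t = (D.V.eval t + D.Y.eval t * D.W.derivative.eval t) / D.W.eval t := by
      rw [hV]; field_simp; ring
    rw [hX', hY']
    field_simp
    ring

/-- Along a branch on which `f` vanishes, the gradient of `f` is normal to the curve. -/
theorem gradient_normal_of_branch {σ : ℂ → ℂ} {t : ℂ} (hσ : DifferentiableAt ℂ σ t)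
    (hst : ∀ᶠ u in 𝓝 t, D.IsState u (σ u)) {f : PolyXY}
    (hf : ∀ᶠ u in 𝓝 t, eval (D.q u (σ u)) f = 0) (hcrit : ¬ D.IsCritical t (σ t)) :
    eval (D.q t (σ t)) (pderiv 0 f) * D.U.eval t + eval (D.q t (σ t)) (pderiv 1 f) * D.V.eval t = 0 := by
  obtain ⟨x', y', hx, hy, h1, h2⟩ := branch_hasDerivAt hσ hst
  have hs := hst.self_of_nhds
  have e1 := hasDerivAt_eval_mvPolynomial f hx hy
  have e2 : HasDerivAt (fun u => eval ![D.qx u (σ u), D.qy u (σ u)] f) 0 t :=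
    (hasDerivAt_const t (0 : ℂ)).congr_of_eventuallyEq hf
  have h3 := e1.unique e2
  change eval (D.q t (σ t)) (pderiv 0 f) * x' + eval (D.q t (σ t)) (pderiv 1 f) * y' = 0 at h3
  have hne : D.U.eval t * x' + D.V.eval t * y' ≠ 0 := by
    intro h0
    rw [h0, mul_zero, add_zero] at h2
    exact hcrit h2
  apply mul_left_cancel₀ hne
  rw [mul_zero]
  linear_combination (D.U.eval t ^ 2 + D.V.eval t ^ 2) * h3 +
    (eval (D.q t (σ t)) (pderiv 1 f) * D.U.eval t - eval (D.q t (σ t)) (pderiv 0 f) * D.V.eval t) * h1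

variable (D)

/-- The product of the analytic functions `A + Bσ` and `A - Bσ` is the norm, which is zero, so one
of them vanishes identically near `t₀`. -/
theorem exists_branch_zero {g : Polynomial PolyXY}
    (h : {t | ∃ s, D.IsState t s ∧ evalXYT g (D.q t s) t = 0}.Infinite) :
    ∃ (t₀ : ℂ) (σ : ℂ → ℂ), AnalyticAt ℂ σ t₀ ∧ (∀ᶠ t in 𝓝 t₀, D.IsState t (σ t)) ∧
      ∀ᶠ t in 𝓝 t₀, evalXYT g (D.q t (σ t)) t = 0 := by
  obtain ⟨A, B, k, hAB⟩ := D.exists_norm_form g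
  have h0 := D.mul_eq_zero_of_infinite hAB h
  obtain ⟨t₀, s₀, -, hs₀⟩ := D.exists_isState_notMem Set.finite_empty
  obtain ⟨σ, hσ, -, hst⟩ := hs₀.exists_branch
  have key : ∀ ρ : ℂ → ℂ, (∀ᶠ t in 𝓝 t₀, D.IsState t (ρ t)) →
      (∀ᶠ t in 𝓝 t₀, A.eval t + B.eval t * ρ t = 0) →
      ∀ᶠ t in 𝓝 t₀, evalXYT g (D.q t (ρ t)) t = 0 := by
    intro ρ h1 h2
    filter_upwards [h1, h2] with t h1 h2
    have := hAB t _ h1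
    rw [h2] at this
    simpa [h1.1, h1.S_ne_zero] using this
  have hA1 : AnalyticAt ℂ (fun t => A.eval t + B.eval t * σ t) t₀ :=
    (A.differentiable.analyticAt t₀).add ((B.differentiable.analyticAt t₀).mul hσ)
  have hneg : ∀ᶠ t in 𝓝 t₀, D.IsState t (-σ t) := by
    filter_upwards [hst] with t ht using ht.neg
  rcases hA1.eventually_eq_zero_or_eventually_ne_zero with h1 | h1
  · exact ⟨t₀, σ, hσ, hst, key σ hst h1⟩
  · have hA2 : AnalyticAt ℂ (fun t => A.eval t + B.eval t * -σ t) t₀ :=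
      (A.differentiable.analyticAt t₀).add ((B.differentiable.analyticAt t₀).mul hσ.neg)
    refine ⟨t₀, fun t => -σ t, hσ.neg, hneg, key _ hneg ?_⟩
    rcases hA2.eventually_eq_zero_or_eventually_ne_zero with h2 | h2
    · exact h2
    · exfalso
      obtain ⟨t, ⟨h3, h4⟩, h5⟩ :=
        ((h1.and h2).and (hst.filter_mono nhdsWithin_le_nhds)).exists
      have := congrArg (Polynomial.eval t) h0
      simp only [Polynomial.eval_sub, Polynomial.eval_mul, Polynomial.eval_pow, ← h5.2.2,
        Polynomial.eval_zero] at this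
      exact mul_ne_zero h3 h4 (by linear_combination this)

/-- Otherwise a whole branch is critical. Then its velocity is zero and it is constant, against
`finite_q_eq`. -/
theorem finite_critical : {t | ∃ s, D.IsState t s ∧ D.IsCritical t s}.Finite := by
  by_contra hinf
  obtain ⟨t₀, σ, hσ, hst, h0⟩ := D.exists_branch_zero hinf
  have hdiff : ∀ᶠ t in 𝓝 t₀, DifferentiableAt ℂ σ t :=
    hσ.eventually_analyticAt.mono fun t ht => ht.differentiableAt
  have hder : ∀ᶠ t in 𝓝 t₀, HasDerivAt (fun u => D.qx u (σ u)) 0 t ∧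
      HasDerivAt (fun u => D.qy u (σ u)) 0 t := by
    filter_upwards [hdiff, hst.eventually_nhds, h0] with t h1 h2 h3
    obtain ⟨x', y', hx, hy, e1, e2⟩ := branch_hasDerivAt h1 h2
    have hs := h2.self_of_nhds
    rw [h3, zero_add, mul_eq_zero, or_iff_right hs.1] at e2
    have hS := hs.S_ne_zero
    rw [← hs.2.2, hs.sq] at hS
    have hx0 : x' = 0 := by
      apply mul_left_cancel₀ hS
      linear_combination D.U.eval t * e2 + D.V.eval t * e1
    have hy0 : y' = 0 := by
      apply mul_left_cancel₀ hS
      linear_combination D.V.eval t * e2 - D.U.eval t * e1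
    subst hx0 hy0
    exact ⟨hx, hy⟩
  obtain ⟨r, hr, hball⟩ := Metric.eventually_nhds_iff_ball.1 (hder.and hst)
  have hconst : ∀ f : ℂ → ℂ, (∀ t ∈ Metric.ball t₀ r, HasDerivAt f 0 t) →
      ∀ t ∈ Metric.ball t₀ r, f t = f t₀ := by
    intro f hf t ht
    refine Metric.isOpen_ball.is_const_of_deriv_eq_zero (convex_ball t₀ r).isPreconnected
      (fun u hu => (hf u hu).differentiableAt.differentiableWithinAt) (fun u hu => (hf u hu).deriv)
      ht (Metric.mem_ball_self hr)
  have hx := hconst _ fun t ht => (hball t ht).1.1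
  have hy := hconst _ fun t ht => (hball t ht).1.2
  refine (infinite_of_mem_nhds t₀ (Metric.ball_mem_nhds t₀ hr))
    ((D.finite_q_eq (D.q t₀ (σ t₀))).subset fun t ht => ⟨σ t, (hball t ht).2, ?_⟩)
  rw [q, q, hx t ht, hy t ht]

/-- Only finitely many parameters give offset points on a given line. -/
theorem finite_q_mem_line {l : PolyXY} (hl : l.totalDegree = 1) :
    {t | ∃ s, D.IsState t s ∧ eval (D.q t s) l = 0}.Finite := by
  by_contra hinf
  have hC : ∀ (p : Fin 2 → ℂ) (t : ℂ), evalXYT (Polynomial.C l) p t = eval p l := by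
    intro p t; simp [evalXYT]
  have hinf' : {t | ∃ s, D.IsState t s ∧ evalXYT (Polynomial.C l) (D.q t s) t = 0}.Infinite := by
    intro h
    exact hinf (by simpa only [hC] using h)
  obtain ⟨t₀, σ, hσ, hst, h0⟩ := D.exists_branch_zero hinf'
  simp only [hC] at h0
  have hconst : ∀ i, pderiv i l = C (coeff 0 (pderiv i l)) := by
    intro i
    rw [← totalDegree_eq_zero_iff_eq_C]
    by_cases h : pderiv i l = 0
    · simp [h]
    · have := totalDegree_pderiv_lt i h
      omega
  have hdiff : ∀ᶠ t in 𝓝 t₀, DifferentiableAt ℂ σ t :=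
    hσ.eventually_analyticAt.mono fun t ht => ht.differentiableAt
  -- The gradient of `l` is a constant vector; along the branch it is normal to the curve at
  -- infinitely many noncritical parameters.
  have hzero : Polynomial.C (coeff 0 (pderiv 0 l)) * D.U + Polynomial.C (coeff 0 (pderiv 1 l)) * D.V = 0 := by
    obtain ⟨r, hr, hball⟩ := Metric.eventually_nhds_iff_ball.1
      ((hdiff.and hst.eventually_nhds).and h0.eventually_nhds)
    refine Polynomial.eq_zero_of_infinite_zeros
      (((infinite_of_mem_nhds t₀ (Metric.ball_mem_nhds t₀ hr)).sdiff D.finite_critical).mono ?_)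
    rintro t ⟨ht, hcrit⟩
    obtain ⟨⟨h1, h2⟩, h3⟩ := hball t ht
    have := gradient_normal_of_branch h1 h2 h3 fun hc => hcrit ⟨σ t, h2.self_of_nhds, hc⟩
    rw [hconst 0, hconst 1] at this
    simpa using this
  obtain ⟨h1, h2⟩ := D.eq_zero_of_combination hzero
  have : l = C (coeff 0 l) := by
    apply eq_C_of_pderiv_eq_zero
    intro i
    rw [hconst i]
    fin_cases i
    · simpa using h1
    · simpa using h2
  rw [this, totalDegree_C] at hl
  omega

end

end OffsetData

/-! ### Primitive parts in t and common zeros of the normal and the circle -/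

theorem evalXYT_mul (g h : Polynomial PolyXY) (p : Fin 2 → ℂ) (t : ℂ) :
    evalXYT (g * h) p t = evalXYT g p t * evalXYT h p t := by
  simp [evalXYT]

theorem evalXYT_map_C (c : Polynomial ℂ) (p : Fin 2 → ℂ) (t : ℂ) :
    evalXYT (c.map MvPolynomial.C) p t = c.eval t := by
  rw [evalXYT]
  congr 1
  exact OffsetData.map_eval_lift c p

theorem evalXYT_C (f : PolyXY) (p : Fin 2 → ℂ) (t : ℂ) :
    evalXYT (Polynomial.C f) p t = eval p f := by
  simp [evalXYT]

theorem eval_eval_C (g : Polynomial PolyXY) (p : Fin 2 → ℂ) (t : ℂ) :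
    eval p (g.eval (C t)) = evalXYT g p t := by
  rw [evalXYT, Polynomial.eval_map, ← Polynomial.eval₂_id, Polynomial.hom_eval₂, RingHom.comp_id,
    eval_C]

theorem IsPrimitivePartT.eval_C_ne_zero {p₀ p : Polynomial PolyXY} (h : IsPrimitivePartT p₀ p)
    (t : ℂ) : p.eval (C t) ≠ 0 := by
  intro h0
  have := h.2 (Polynomial.X - Polynomial.C t) (by
    simpa using Polynomial.dvd_iff_isRoot.2 h0)
  exact Polynomial.not_isUnit_X_sub_C t this

/-- The degree in `x, y` of a polynomial does not grow when a factor in `t` is removed. -/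
theorem totalDegree_coeff_le_of_mul {p₀ p : Polynomial PolyXY} {c : Polynomial ℂ} (hp₀ : p₀ ≠ 0)
    (h : p₀ = c.map C * p) {N : ℕ} (hN : ∀ k, (p₀.coeff k).totalDegree ≤ N) (k : ℕ) :
    (p.coeff k).totalDegree ≤ N := by
  classical
  have hc : c ≠ 0 := by
    rintro rfl
    simp at h
    exact hp₀ h
  have hev : ∀ (g : Polynomial PolyXY) (m : Fin 2 →₀ ℕ) (t : ℂ),
      coeff m (g.eval (C t)) =
        (∑ k ∈ Finset.range (g.natDegree + 1), Polynomial.monomial k (coeff m (g.coeff k))).eval t := by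
    intro g m t
    rw [Polynomial.eval_eq_sum_range, coeff_sum, Polynomial.eval_finsetSum]
    refine Finset.sum_congr rfl fun k _ => ?_
    rw [← C_pow, mul_comm, coeff_C_mul, Polynomial.eval_monomial, mul_comm]
  refine Finset.sup_le fun m hm => ?_
  by_contra! hlt
  refine mem_support_iff.1 hm ?_
  -- The coefficient of the monomial `m` is a polynomial in `t`. Wherever `c(t) ≠ 0` it vanishes,
  -- because the corresponding coefficient of `p₀` does.
  have hzero : (∑ k ∈ Finset.range (p.natDegree + 1),
      Polynomial.monomial k (coeff m (p.coeff k))) = 0 := by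
    refine Polynomial.eq_zero_of_infinite_zeros
      ((Polynomial.finite_zeros hc).infinite_compl.mono fun t ht => ?_)
    have h1 : p₀.eval (C t) = C (c.eval t) * p.eval (C t) := by
      rw [h, Polynomial.eval_mul, Polynomial.eval_map, Polynomial.eval₂_at_apply]
    have h2 : coeff m (p₀.eval (C t)) = 0 := by
      rw [hev, Polynomial.eval_finsetSum]
      refine Finset.sum_eq_zero fun k _ => ?_
      rw [coeff_eq_zero_of_totalDegree_lt ((hN k).trans_lt hlt)]
      simp
    rw [h1, coeff_C_mul, hev] at h2
    exact (mul_eq_zero.1 h2).resolve_left ht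
  by_cases hk : k < p.natDegree + 1
  · have := congrArg (fun r => Polynomial.coeff r k) hzero
    simp only [Polynomial.finsetSum_coeff, Polynomial.coeff_monomial, Polynomial.coeff_zero] at this
    rwa [Finset.sum_ite_eq' , if_pos (Finset.mem_range.2 hk)] at this
  · rw [Polynomial.coeff_eq_zero_of_natDegree_lt (by omega), coeff_zero]

theorem totalDegree_pos_of_irreducible {f : PolyXY} (hf : Irreducible f) : 0 < f.totalDegree := by
  rw [Nat.pos_iff_ne_zero, Ne, totalDegree_eq_zero_iff_eq_C]
  intro h
  refine hf.not_isUnit ?_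
  have h2 : coeff 0 f ≠ 0 := by
    intro hc
    rw [hc, map_zero] at h
    exact hf.ne_zero h
  rw [h]
  exact (isUnit_iff_ne_zero.2 h2).map C

theorem not_dvd_of_totalDegree_le_one {f g : PolyXY} (hf : Irreducible f)
    (hf1 : f.totalDegree ≠ 1) (hg : g ≠ 0) (hg1 : g.totalDegree ≤ 1) : ¬ f ∣ g := by
  intro h
  have := totalDegree_le_of_dvd_of_isDomain h hg
  have := totalDegree_pos_of_irreducible hf
  omega

theorem exists_eval_ne_zero {f : PolyXY} (hf : f ≠ 0) : ∃ p, eval p f ≠ 0 := by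
  by_contra! h
  exact hf (MvPolynomial.funext fun p => by rw [h p, map_zero])

namespace OffsetData

noncomputable section

variable (D : OffsetData)

theorem normal_eq : D.normal =
    Polynomial.map C (D.U * D.W) * RatParam.xT + Polynomial.map C (D.V * D.W) * RatParam.yT -
      Polynomial.map C (D.U * D.X + D.V * D.Y) := by
  simp only [normal, lift, Polynomial.map_mul, Polynomial.map_add]
  ring

theorem totalDegree_normal_coeff (k : ℕ) : (D.normal.coeff k).totalDegree ≤ 1 := by
  have hmul : ∀ (a : ℂ) (i : Fin 2), (C a * MvPolynomial.X i : PolyXY).totalDegree ≤ 1 := fun a i =>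
    (totalDegree_mul _ _).trans (by simp)
  rw [normal_eq, Polynomial.coeff_sub, Polynomial.coeff_add, RatParam.xT, RatParam.yT,
    Polynomial.coeff_mul_C, Polynomial.coeff_mul_C, Polynomial.coeff_map, Polynomial.coeff_map,
    Polynomial.coeff_map]
  refine (totalDegree_sub _ _).trans (max_le ((totalDegree_add _ _).trans
    (max_le (hmul _ _) (hmul _ _))) (by rw [totalDegree_C]; exact Nat.zero_le 1))

theorem normal_ne_zero : D.normal ≠ 0 := by
  intro h
  have h1 := D.map_eval_normal ![1, 0]
  have h2 := D.map_eval_normal ![0, 0]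
  have h3 := D.map_eval_normal ![0, 1]
  simp only [h, Polynomial.map_zero, Matrix.cons_val_zero, Matrix.cons_val_one, map_zero, map_one] at h1 h2 h3
  have hU : D.U = 0 := by
    apply mul_right_cancel₀ D.W_ne_zero
    linear_combination h2 - h1
  have hV : D.V = 0 := by
    apply mul_right_cancel₀ D.W_ne_zero
    linear_combination h2 - h3
  exact D.S_ne_zero (by rw [S, hU, hV]; simp)

/-- `p` is the offset point of some state. -/
def Generated (p : Fin 2 → ℂ) : Prop := ∃ t s, D.IsState t s ∧ D.q t s = p

variable {D}

theorem IsState.normal_eq_zero {t s : ℂ} (h : D.IsState t s) : evalXYT D.normal (D.q t s) t = 0 := by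
  obtain ⟨hW, hs0, hs2⟩ := id h
  rw [evalXYT_normal]
  simp only [q, qx, qy, Matrix.cons_val_zero, Matrix.cons_val_one]
  field_simp
  ring

theorem IsState.circle_eq_zero {t s : ℂ} (h : D.IsState t s) : evalXYT D.circle (D.q t s) t = 0 := by
  obtain ⟨hW, hs0, hs2⟩ := id h
  have := h.sq
  rw [evalXYT_circle]
  simp only [q, qx, qy, Matrix.cons_val_zero, Matrix.cons_val_one]
  field_simp
  linear_combination (- D.d ^ 2 * D.W.eval t ^ 2) * this

theorem exists_isState_of_eq_zero {t s₀ : ℂ} (h : D.IsState t s₀) {p : Fin 2 → ℂ}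
    (h1 : evalXYT D.normal p t = 0) (h2 : evalXYT D.circle p t = 0) :
    ∃ s, D.IsState t s ∧ D.q t s = p := by
  rw [evalXYT_normal] at h1
  rw [evalXYT_circle] at h2
  obtain ⟨hW, hs0, hs2⟩ := id h
  have hsq := h.sq
  have hd := D.d_ne_zero
  set a := D.W.eval t * p 0 - D.X.eval t with ha
  set b := D.W.eval t * p 1 - D.Y.eval t with hb
  set u := D.U.eval t
  set v := D.V.eval t
  set w := D.W.eval t
  -- A vector orthogonal to the nonisotropic `(u, v)` is a multiple of `(v, -u)`.
  obtain ⟨l, hl1, hl2⟩ : ∃ l, a = l * v ∧ b = - l * u := by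
    refine ⟨(a * v - b * u) / s₀ ^ 2, ?_, ?_⟩
    · field_simp
      linear_combination a * hsq + u * h1
    · field_simp
      linear_combination b * hsq + v * h1
  have hl : l ^ 2 * s₀ ^ 2 = D.d ^ 2 * w ^ 2 := by
    rw [hl1, hl2] at h2
    linear_combination h2 + l ^ 2 * hsq
  have hl0 : l ≠ 0 := by
    rintro rfl
    have : D.d ^ 2 * w ^ 2 ≠ 0 := mul_ne_zero (pow_ne_zero _ hd) (pow_ne_zero _ hW)
    exact this (by rw [← hl]; ring)
  -- The displacement is `(l/w)(v, -u)` and must equal `(d/s)(v, -u)`.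
  refine ⟨D.d * w / l, ⟨hW, div_ne_zero (mul_ne_zero hd hW) hl0, ?_⟩, ?_⟩
  · rw [← hs2, div_pow, mul_pow, ← hl]
    field_simp
  · have e0 : D.qx t (D.d * w / l) = p 0 := by
      change D.X.eval t / w + D.d * v / (D.d * w / l) = p 0
      field_simp
      linear_combination ha - hl1
    have e1 : D.qy t (D.d * w / l) = p 1 := by
      change D.Y.eval t / w - D.d * u / (D.d * w / l) = p 1
      field_simp
      linear_combination hb - hl2
    ext i
    fin_cases i
    · exact e0
    · exact e1

variable (D)

theorem finite_of_finite_params {T : Set ℂ} (hT : T.Finite) :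
    {p | ∃ t ∈ T, ∃ s, D.IsState t s ∧ D.q t s = p}.Finite := by
  have : {p | ∃ t ∈ T, ∃ s, D.IsState t s ∧ D.q t s = p} =
      ⋃ t ∈ T, {p | ∃ s, D.IsState t s ∧ D.q t s = p} := by
    ext p; simp
  rw [this]
  refine hT.biUnion fun t _ => ?_
  by_cases h : ∃ s, D.IsState t s
  · obtain ⟨s, hs⟩ := h
    refine (Set.toFinite {D.q t s, D.q t (-s)}).subset ?_
    rintro p ⟨s', hs', rfl⟩
    rcases hs.eq_or_eq_neg hs' with rfl | rfl <;> simp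
  · refine Set.finite_empty.subset ?_
    rintro p ⟨s, hs, -⟩
    exact h ⟨s, hs⟩

theorem infinite_params_of_infinite {A : Set (Fin 2 → ℂ)} (h : {p | p ∈ A ∧ D.Generated p}.Infinite) :
    {t | ∃ s, D.IsState t s ∧ D.q t s ∈ A}.Infinite := by
  intro hfin
  refine h ((D.finite_of_finite_params hfin).subset ?_)
  rintro p ⟨hp, t, s, hs, rfl⟩
  exact ⟨t, ⟨s, hs, hp⟩, s, hs, rfl⟩

end

end OffsetData

/-! ### The zero set of the resultant -/

/-- The data of an offset computation by the resultant of the primitive parts of the normal and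
circle polynomials. -/
structure OffsetResultant where
  D : OffsetData
  P : Polynomial PolyXY
  Q : Polynomial PolyXY
  hP : IsPrimitivePartT D.normal P
  hQ : IsPrimitivePartT D.circle Q

namespace OffsetResultant

noncomputable section

variable (R : OffsetResultant)

def H : PolyXY := Polynomial.resultant R.P R.Q

variable {R}

theorem exists_content_P : ∃ c : Polynomial ℂ, R.D.normal = c.map C * R.P ∧
    ∀ t s, R.D.IsState t s → c.eval t ≠ 0 := by
  obtain ⟨c, hc⟩ := R.hP.1
  refine ⟨c, hc, fun t s hs h0 => hs.S_ne_zero ?_⟩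
  have h : ∀ p, evalXYT R.D.normal p t = 0 := by
    intro p
    rw [hc, evalXYT_mul, evalXYT_map_C, h0, zero_mul]
  -- Differences of the normal polynomial in `x` and in `y` give `UW` and `VW`, which cannot both
  -- vanish at a state.
  have h1 := h ![1, 0]
  have h2 := h ![0, 0]
  have h3 := h ![0, 1]
  rw [OffsetData.evalXYT_normal] at h1 h2 h3
  simp only [Matrix.cons_val_zero, Matrix.cons_val_one] at h1 h2 h3
  have hU : R.D.U.eval t = 0 := by
    apply mul_right_cancel₀ hs.1
    linear_combination h1 - h2
  have hV : R.D.V.eval t = 0 := by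
    apply mul_right_cancel₀ hs.1
    linear_combination h3 - h2
  rw [← hs.2.2, hs.sq, hU, hV]
  ring

theorem exists_content_Q : ∃ c : Polynomial ℂ, R.D.circle = c.map C * R.Q ∧
    ∀ t s, R.D.IsState t s → c.eval t ≠ 0 := by
  obtain ⟨c, hc⟩ := R.hQ.1
  refine ⟨c, hc, fun t s hs h0 => hs.1 ?_⟩
  have h : ∀ p, evalXYT R.D.circle p t = 0 := by
    intro p
    rw [hc, evalXYT_mul, evalXYT_map_C, h0, zero_mul]
  -- The second difference of the circle polynomial over `x = -1, 0, 1` is `2W²`.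
  have h1 := h ![1, 0]
  have h2 := h ![0, 0]
  have h3 := h ![-1, 0]
  rw [OffsetData.evalXYT_circle] at h1 h2 h3
  simp only [Matrix.cons_val_zero, Matrix.cons_val_one] at h1 h2 h3
  have : R.D.W.eval t ^ 2 = 0 := by linear_combination (h1 + h3 - 2 * h2) / 2
  exact pow_eq_zero_iff (two_ne_zero) |>.1 this

theorem evalXYT_P_eq_zero_iff {t s : ℂ} (h : R.D.IsState t s) (p : Fin 2 → ℂ) :
    evalXYT R.P p t = 0 ↔ evalXYT R.D.normal p t = 0 := by
  obtain ⟨c, hc, hc0⟩ := exists_content_P (R := R)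
  rw [hc, evalXYT_mul, evalXYT_map_C, mul_eq_zero, or_iff_right (hc0 t s h)]

theorem evalXYT_Q_eq_zero_iff {t s : ℂ} (h : R.D.IsState t s) (p : Fin 2 → ℂ) :
    evalXYT R.Q p t = 0 ↔ evalXYT R.D.circle p t = 0 := by
  obtain ⟨c, hc, hc0⟩ := exists_content_Q (R := R)
  rw [hc, evalXYT_mul, evalXYT_map_C, mul_eq_zero, or_iff_right (hc0 t s h)]

theorem eval_q_H {t s : ℂ} (h : R.D.IsState t s) : eval (R.D.q t s) R.H = 0 := by
  have hP := (evalXYT_P_eq_zero_iff h _).2 h.normal_eq_zero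
  have hQ := (evalXYT_Q_eq_zero_iff h _).2 h.circle_eq_zero
  -- If `Q` had degree zero in `t`, the circle polynomial at `q` would vanish for every parameter,
  -- putting the curve on a circle of radius `d` about `q`.
  have hdeg : R.Q.natDegree ≠ 0 := by
    intro h0
    obtain ⟨r, hr⟩ := Polynomial.natDegree_eq_zero.1 h0
    rw [← hr, evalXYT_C] at hQ
    obtain ⟨c, hc⟩ := R.hQ.1
    apply R.D.no_circle (R.D.q t s 0) (R.D.q t s 1)
    have := R.D.map_eval_circle (R.D.q t s)
    rw [hc, ← hr, Polynomial.map_mul, Polynomial.map_C, hQ, map_zero, mul_zero] at this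
    linear_combination -this
  obtain ⟨a, b, -, -, e⟩ := Polynomial.exists_mul_add_mul_eq_C_resultant R.P R.Q le_rfl le_rfl
    (Or.inr hdeg)
  have := congrArg (fun g => evalXYT g (R.D.q t s) t) e
  simp only [evalXYT_C] at this
  rw [H, ← this, evalXYT, Polynomial.map_add, Polynomial.eval_add, Polynomial.map_mul,
    Polynomial.map_mul, Polynomial.eval_mul, Polynomial.eval_mul]
  change evalXYT _ _ _ * _ + evalXYT _ _ _ * _ = 0
  rw [hP, hQ]
  ring

/-- This keeps every irreducible factor of `exceptional` linear, so no nonlinear factor of the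
resultant can divide it. -/
theorem eval_C_P_totalDegree (t : ℂ) : (R.P.eval (C t)).totalDegree ≤ 1 := by
  obtain ⟨c, hc⟩ := R.hP.1
  have := totalDegree_coeff_le_of_mul R.D.normal_ne_zero hc R.D.totalDegree_normal_coeff
  rw [Polynomial.eval_eq_sum_range]
  refine totalDegree_finsetSum_le fun k _ => ?_
  rw [← C_pow]
  exact (totalDegree_mul _ _).trans (by rw [totalDegree_C]; exact this k)

theorem leadingCoeff_P_totalDegree : R.P.leadingCoeff.totalDegree ≤ 1 := by
  obtain ⟨c, hc⟩ := R.hP.1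
  exact totalDegree_coeff_le_of_mul R.D.normal_ne_zero hc R.D.totalDegree_normal_coeff _

theorem P_ne_zero : R.P ≠ 0 := by
  intro h
  exact R.hP.eval_C_ne_zero 0 (by simp [h])

variable (R)

/-- A product of polynomials of degree at most one; outside its zeros, the zeros of the resultant
are offset points. -/
def exceptional : PolyXY :=
  R.P.leadingCoeff * ∏ t ∈ R.D.finite_not_good.toFinset, R.P.eval (C t)

variable {R}

theorem exceptional_ne_zero : R.exceptional ≠ 0 :=
  mul_ne_zero (Polynomial.leadingCoeff_ne_zero.2 P_ne_zero)
    (Finset.prod_ne_zero_iff.2 fun t _ => R.hP.eval_C_ne_zero t)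

theorem not_dvd_exceptional {f : PolyXY} (hf : Irreducible f) (hf1 : f.totalDegree ≠ 1) :
    ¬ f ∣ R.exceptional := by
  intro h
  rcases hf.prime.dvd_or_dvd h with h | h
  · exact not_dvd_of_totalDegree_le_one hf hf1 (Polynomial.leadingCoeff_ne_zero.2 P_ne_zero)
      leadingCoeff_P_totalDegree h
  · obtain ⟨t, -, ht⟩ := (hf.prime.dvd_finsetProd_iff _).1 h
    exact not_dvd_of_totalDegree_le_one hf hf1 (R.hP.eval_C_ne_zero t) (eval_C_P_totalDegree t) ht

theorem natDegree_map_P {p : Fin 2 → ℂ} (hp : eval p R.exceptional ≠ 0) :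
    (R.P.map (eval p)).natDegree = R.P.natDegree := by
  rw [exceptional, map_mul] at hp
  exact Polynomial.natDegree_map_of_leadingCoeff_ne_zero _ (left_ne_zero_of_mul hp)

theorem isState_of_common_root {p : Fin 2 → ℂ} (hp : eval p R.exceptional ≠ 0) {t : ℂ}
    (h1 : evalXYT R.P p t = 0) (h2 : evalXYT R.Q p t = 0) :
    ∃ s, R.D.IsState t s ∧ R.D.q t s = p := by
  rw [exceptional, map_mul, map_prod] at hp
  have hgood : ∃ s, R.D.IsState t s := by
    by_contra hbad
    refine Finset.prod_ne_zero_iff.1 (right_ne_zero_of_mul hp) t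
      (R.D.finite_not_good.mem_toFinset.2 hbad) ?_
    rw [eval_eval_C, h1]
  obtain ⟨s, hs⟩ := hgood
  exact OffsetData.exists_isState_of_eq_zero hs ((evalXYT_P_eq_zero_iff hs p).1 h1)
    ((evalXYT_Q_eq_zero_iff hs p).1 h2)

theorem generated_of_eval_H {p : Fin 2 → ℂ} (hp : eval p R.exceptional ≠ 0) (h : eval p R.H = 0) :
    R.D.Generated p := by
  have hlc : eval p R.P.leadingCoeff ≠ 0 := by
    rw [exceptional, map_mul] at hp
    exact left_ne_zero_of_mul hp
  have hne : R.P.map (eval p) ≠ 0 := by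
    intro h0
    have := congrArg (fun r => Polynomial.coeff r R.P.natDegree) h0
    simp only [Polynomial.coeff_map, Polynomial.coeff_zero] at this
    exact hlc this
  rw [H, ← Polynomial.resultant_map_map, ← natDegree_map_P hp,
    resultant_eq_zero_iff_exists_common_root hne Polynomial.natDegree_map_le] at h
  obtain ⟨t, h1, h2⟩ := h
  exact ⟨t, isState_of_common_root hp h1 h2⟩

theorem finite_not_generated {f : PolyXY} (hf : Irreducible f) (hfE : ¬ f ∣ R.exceptional)
    (hfH : f ∣ R.H) : {p | p ∈ planeCurve f ∧ ¬ R.D.Generated p}.Finite := by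
  refine (finite_common_zeros hf hfE).subset ?_
  rintro p ⟨hp, hg⟩
  refine ⟨hp, ?_⟩
  by_contra hE
  exact hg (generated_of_eval_H hE (planeCurve_subset_of_dvd hfH hp))

theorem infinite_generated {f : PolyXY} (hf : Irreducible f) (hfE : ¬ f ∣ R.exceptional)
    (hfH : f ∣ R.H) : {p | p ∈ planeCurve f ∧ R.D.Generated p}.Infinite := by
  intro hfin
  refine planeCurve_infinite hf ((hfin.union (finite_not_generated hf hfE hfH)).subset fun p hp => ?_)
  by_cases h : R.D.Generated p
  · exact Or.inl ⟨hp, h⟩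
  · exact Or.inr ⟨hp, h⟩

/-- If the resultant were zero, almost every point of a vertical line not dividing `exceptional`
would be an offset point, against `finite_q_mem_line`. -/
theorem H_ne_zero : R.H ≠ 0 := by
  intro h0
  obtain ⟨p, hp⟩ := exists_eval_ne_zero (exceptional_ne_zero (R := R))
  have hndvd : ¬ (X 0 - C (p 0) : PolyXY) ∣ R.exceptional := by
    rintro ⟨k, hk⟩
    apply hp
    rw [hk]
    simp
  refine R.D.infinite_params_of_infinite
    (infinite_generated (irreducible_X_sub_C (p 0)) hndvd (by rw [h0]; exact dvd_zero _))
    (R.D.finite_q_mem_line ?_)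
  have h1 : (X 0 - C (p 0) : PolyXY).totalDegree ≤ 1 :=
    (totalDegree_sub _ _).trans (by simp)
  have h2 := totalDegree_pos_of_irreducible (irreducible_X_sub_C (p 0))
  omega

end

end OffsetResultant

/-! ### The nonlinear factors of the resultant -/

namespace OffsetResultant

noncomputable section

variable (R : OffsetResultant)

/-- The nonlinear irreducible factors of the resultant. -/
def IsMain (f : PolyXY) : Prop := Irreducible f ∧ f.totalDegree ≠ 1 ∧ f ∣ R.H

variable {R}

theorem IsMain.finite_not_generated {f : PolyXY} (h : R.IsMain f) :
    {p | p ∈ planeCurve f ∧ ¬ R.D.Generated p}.Finite :=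
  OffsetResultant.finite_not_generated h.1 (not_dvd_exceptional h.1 h.2.1) h.2.2

theorem IsMain.infinite_generated {f : PolyXY} (h : R.IsMain f) :
    {p | p ∈ planeCurve f ∧ R.D.Generated p}.Infinite :=
  OffsetResultant.infinite_generated h.1 (not_dvd_exceptional h.1 h.2.1) h.2.2

theorem IsMain.eval_state {f : PolyXY} (h : R.IsMain f) {t s : ℂ} (hs : R.D.IsState t s) :
    eval (R.D.q t s) f = 0 ∨ eval (R.D.q t (-s)) f = 0 := by
  have := R.D.exists_state_zero_of_infinite (g := Polynomial.C f) (by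
    simp only [evalXYT_C]
    exact R.D.infinite_params_of_infinite h.infinite_generated) hs
  simpa only [evalXYT_C] using this

/-- For all but finitely many parameters, no point of either sign is common to two
nonassociated main factors. -/
theorem IsMain.finite_common {f g : PolyXY} (hf : R.IsMain f) (hg : R.IsMain g)
    (hfg : ¬ Associated f g) :
    {t | ∃ s, R.D.IsState t s ∧ R.D.q t s ∈ {p | eval p f = 0 ∧ eval p g = 0}}.Finite :=
  R.D.finite_q_mem (finite_common_zeros hf.1 fun h => hfg (hf.1.associated_of_dvd hg.1 h))

/-- Pigeonhole: over a generic parameter each factor vanishes at one of only two states, so two of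
three factors would share a point there. -/
theorem IsMain.associated_of_three {f g h : PolyXY} (hf : R.IsMain f) (hg : R.IsMain g)
    (hh : R.IsMain h) (hfg : ¬ Associated f g) : Associated h f ∨ Associated h g := by
  by_contra! hne
  obtain ⟨hhf, hhg⟩ := hne
  obtain ⟨t, s, ht, hs⟩ := R.D.exists_isState_notMem
    (((hf.finite_common hg hfg).union (hh.finite_common hf hhf)).union (hh.finite_common hg hhg))
  simp only [Set.mem_union, Set.mem_ofPred_eq, not_or, not_exists, not_and] at ht
  obtain ⟨⟨h1, h2⟩, h3⟩ := ht
  rcases hf.eval_state hs with ef | ef <;> rcases hg.eval_state hs with eg | eg <;>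
    rcases hh.eval_state hs with eh | eh
  · exact h1 s hs ef eg
  · exact h1 s hs ef eg
  · exact h2 s hs eh ef
  · exact h3 _ hs.neg eh eg
  · exact h3 s hs eh eg
  · exact h2 _ hs.neg eh ef
  · exact h1 _ hs.neg ef eg
  · exact h1 _ hs.neg ef eg

/-- At each state some irreducible factor of the resultant vanishes, and linear factors account for
only finitely many parameters. -/
theorem forall_state_zero {F : PolyXY} (hF : ∀ f, R.IsMain f → f ∣ F) {t s : ℂ}
    (hs : R.D.IsState t s) : eval (R.D.q t s) F = 0 := by
  classical
  rw [← evalXYT_C F _ t]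
  refine R.D.forall_state_zero_of_finite ?_ hs
  obtain ⟨L, hL, hass⟩ := UniqueFactorizationMonoid.exists_prime_factors R.H H_ne_zero
  have hfin : (⋃ l ∈ {l ∈ L.toFinset | l.totalDegree = 1},
      {t | ∃ s, R.D.IsState t s ∧ eval (R.D.q t s) l = 0}).Finite := by
    refine Set.Finite.biUnion (Finset.finite_toSet _) fun l hl => ?_
    simp only [Finset.coe_filter, Set.mem_ofPred_eq] at hl
    exact R.D.finite_q_mem_line hl.2
  refine hfin.subset ?_
  rintro t ⟨s, hs, hne⟩
  rw [evalXYT_C] at hne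
  obtain ⟨k, hk⟩ := hass.symm.dvd
  have h0 : eval (R.D.q t s) L.prod = 0 := by rw [hk, map_mul, eval_q_H hs, zero_mul]
  rw [map_multiset_prod, Multiset.prod_eq_zero_iff, Multiset.mem_map] at h0
  obtain ⟨l, hl, hl0⟩ := h0
  have hl1 : l.totalDegree = 1 := by
    by_contra hl1
    obtain ⟨k, rfl⟩ := hF l ⟨(hL l hl).irreducible, hl1, (Multiset.dvd_prod hl).trans hass.dvd⟩
    rw [map_mul, hl0, zero_mul] at hne
    exact hne rfl
  simp only [Set.mem_iUnion]
  exact ⟨l, by simp [hl, hl1], s, hs, hl0⟩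

variable (R)

/-- `f` and `g` represent all the main factors; `g = 1` if there is only one. -/
def IsMainPair (f g : PolyXY) : Prop :=
  R.IsMain f ∧ (g = 1 ∨ R.IsMain g ∧ ¬ Associated f g) ∧ ∀ h, R.IsMain h → h ∣ f * g

theorem exists_isMainPair : ∃ f g, R.IsMainPair f g := by
  obtain ⟨f, hf⟩ : ∃ f, R.IsMain f := by
    by_contra! h
    obtain ⟨t, s, -, hs⟩ := R.D.exists_isState_notMem Set.finite_empty
    have := forall_state_zero (F := 1) (fun f hf => absurd hf (h f)) hs
    simp at this
  by_cases hg : ∃ g, R.IsMain g ∧ ¬ Associated f g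
  · obtain ⟨g, hg, hfg⟩ := hg
    refine ⟨f, g, hf, Or.inr ⟨hg, hfg⟩, fun h hh => ?_⟩
    rcases hf.associated_of_three hg hh hfg with h1 | h1
    · exact h1.dvd.trans (dvd_mul_right _ _)
    · exact h1.dvd.trans (dvd_mul_left _ _)
  · push Not at hg
    exact ⟨f, 1, hf, Or.inl rfl, fun h hh => by simpa using (hg h hh).symm.dvd⟩

variable {R}

theorem IsMainPair.ne_zero {f g : PolyXY} (h : R.IsMainPair f g) : f * g ≠ 0 := by
  refine mul_ne_zero h.1.1.ne_zero ?_
  rcases h.2.1 with rfl | hg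
  · exact one_ne_zero
  · exact hg.1.1.ne_zero

theorem IsMainPair.eval_q {f g : PolyXY} (h : R.IsMainPair f g) {t s : ℂ} (hs : R.D.IsState t s) :
    eval (R.D.q t s) (f * g) = 0 := forall_state_zero h.2.2 hs

theorem IsMainPair.isMain_of_dvd {f g h : PolyXY} (hp : R.IsMainPair f g) (hh : Irreducible h)
    (hdvd : h ∣ f * g) : R.IsMain h := by
  have key : ∀ k, R.IsMain k → h ∣ k → R.IsMain h := by
    intro k hk hhk
    refine ⟨hh, fun h1 => ?_, hhk.trans hk.2.2⟩
    have h2 := (hh.associated_of_dvd hk.1 hhk).symm.dvd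
    have := totalDegree_le_of_dvd_of_isDomain h2 hh.ne_zero
    have h3 := totalDegree_pos_of_irreducible hk.1
    exact hk.2.1 (by omega)
  rcases hh.prime.dvd_or_dvd hdvd with h1 | h1
  · exact key f hp.1 h1
  · rcases hp.2.1 with rfl | hg
    · exact absurd (isUnit_of_dvd_one h1) hh.not_isUnit
    · exact key g hg.1 h1

theorem IsMainPair.zariskiClosure_generated {f g : PolyXY} (h : R.IsMainPair f g) :
    zariskiClosure {p | R.D.Generated p} = planeCurve (f * g) := by
  apply Set.Subset.antisymm
  · refine zariskiClosure_subset_planeCurve ?_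
    rintro p ⟨t, s, hs, rfl⟩
    exact h.eval_q hs
  · rw [planeCurve_mul]
    have key : ∀ k, R.IsMain k → planeCurve k ⊆ zariskiClosure {p | R.D.Generated p} :=
      fun k hk => planeCurve_subset_zariskiClosure hk.1 hk.infinite_generated
    refine Set.union_subset (key f h.1) ?_
    rcases h.2.1 with rfl | hg
    · rw [planeCurve_one]; exact Set.empty_subset _
    · exact key g hg.1

/-! ### Multiplicities by restriction to transversal lines -/

variable (R)

/-- The restriction of polynomials to the line `p + ε v`. -/
def lineHom (p v : Fin 2 → ℂ) : PolyXY →+* PowerSeries ℂ :=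
  eval₂Hom PowerSeries.C fun i => PowerSeries.C (p i) + PowerSeries.C (v i) * PowerSeries.X

theorem constantCoeff_lineHom (p v : Fin 2 → ℂ) (f : PolyXY) :
    PowerSeries.constantCoeff (lineHom p v f) = eval p f := by
  have : (PowerSeries.constantCoeff (R := ℂ)).comp (lineHom p v) = eval p := by
    ext i <;> simp [lineHom]
  rw [← this]
  rfl

theorem constantCoeff_comp_lineHom (p v : Fin 2 → ℂ) :
    (PowerSeries.constantCoeff (R := ℂ)).comp (lineHom p v) = eval p :=
  RingHom.ext (constantCoeff_lineHom p v)

theorem constantCoeff_derivative_lineHom (p v : Fin 2 → ℂ) (f : PolyXY) :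
    PowerSeries.constantCoeff (PowerSeries.derivative ℂ (lineHom p v f)) =
      v 0 * eval p (pderiv 0 f) + v 1 * eval p (pderiv 1 f) := by
  induction f using MvPolynomial.induction_on with
  | C a => simp [lineHom]
  | add p q hp hq => simp only [map_add, hp, hq]; ring
  | mul_X g i hg =>
    rw [map_mul, Derivation.leibniz, map_add, smul_eq_mul, smul_eq_mul, map_mul, map_mul,
      constantCoeff_lineHom, constantCoeff_lineHom, hg]
    have hX : PowerSeries.constantCoeff (PowerSeries.derivative ℂ (lineHom p v (X i))) = v i := by
      simp [lineHom]
    rw [hX]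
    fin_cases i <;> simp <;> ring

theorem order_eq_one_of {K : Type*} [Field K] {a : PowerSeries K}
    (h0 : PowerSeries.constantCoeff a = 0)
    (h1 : PowerSeries.constantCoeff (PowerSeries.derivative K a) ≠ 0) : a.order = 1 := by
  refine PowerSeries.order_eq_nat (n := 1) |>.2 ⟨?_, ?_⟩
  · rw [← PowerSeries.coeff_zero_eq_constantCoeff_apply, PowerSeries.coeff_derivative] at h1
    simpa using h1
  · intro i hi
    have : i = 0 := by omega
    subst this
    simpa using h0

end

end OffsetResultant

namespace OffsetResultant

noncomputable section

variable (R : OffsetResultant)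

/-- The points of `{f = 0}` at which the offset is smooth and the parametrization is immersive. -/
structure IsGeneric (f f' h : PolyXY) (p : Fin 2 → ℂ) : Prop where
  mem : eval p f = 0
  exceptional_ne : eval p R.exceptional ≠ 0
  cofactor_ne : eval p h ≠ 0
  other_ne : eval p f' ≠ 0
  smooth : ∃ i, eval p (pderiv i f) ≠ 0
  not_critical : ∀ t s, R.D.IsState t s → R.D.q t s = p → ¬ R.D.IsCritical t s

variable {R}

theorem finite_not_isGeneric {f f' h : PolyXY} (hf : R.IsMain f) (hfh : ¬ f ∣ h)
    (hff' : ¬ f ∣ f') : {p | p ∈ planeCurve f ∧ ¬ R.IsGeneric f f' h p}.Finite := by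
  have h1 := finite_common_zeros hf.1 (not_dvd_exceptional (R := R) hf.1 hf.2.1)
  have h2 := finite_common_zeros hf.1 hfh
  have h3 := finite_common_zeros hf.1 hff'
  have h4 := finite_singular_points hf.1
  have h5 := R.D.finite_of_finite_params R.D.finite_critical

  have hcrit : {p | ∃ t s, R.D.IsState t s ∧ R.D.q t s = p ∧ R.D.IsCritical t s}.Finite := by
    refine h5.subset ?_
    rintro p ⟨t, s, hs, hq, hc⟩
    exact ⟨t, ⟨s, hs, hc⟩, s, hs, hq⟩
  refine (hcrit.union (h1.union (h2.union (h3.union h4)))).subset ?_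
  rintro p ⟨hp, hn⟩
  by_contra hc
  simp only [Set.mem_union, not_or] at hc
  obtain ⟨c5, c1, c2, c3, c4⟩ := hc
  refine hn ⟨hp, fun h0 => c1 ⟨hp, h0⟩, fun h0 => c2 ⟨hp, h0⟩, fun h0 => c3 ⟨hp, h0⟩, ?_, ?_⟩
  · by_contra! h0
    exact c4 ⟨hp, h0⟩
  · intro t s hs hq hcr
    exact c5 ⟨t, s, hs, hq, hcr⟩

/-- At a generic offset point, the gradient of the component is normal to the curve. -/
theorem IsGeneric.gradient_normal {f f' h : PolyXY}
    (hzero : ∀ t s, R.D.IsState t s → eval (R.D.q t s) (f * f') = 0) {t s : ℂ}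
    (hp : R.IsGeneric f f' h (R.D.q t s)) (hs : R.D.IsState t s) :
    eval (R.D.q t s) (pderiv 0 f) * R.D.U.eval t + eval (R.D.q t s) (pderiv 1 f) * R.D.V.eval t = 0 := by
  obtain ⟨σ, hσ, rfl, hst⟩ := hs.exists_branch
  have := OffsetData.gradient_normal_of_branch hσ.differentiableAt hst (f := f * f')
    (by filter_upwards [hst] with u hu using hzero u _ hu) (hp.not_critical t _ hs rfl)
  simp only [Derivation.leibniz, smul_eq_mul, map_add, map_mul, hp.mem, zero_mul, zero_add] at this
  apply mul_left_cancel₀ hp.other_ne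
  linear_combination this

theorem eval_map_lineHom_map_C (p v : Fin 2 → ℂ) (a : Polynomial ℂ) (τ : PowerSeries ℂ) :
    ((a.map MvPolynomial.C).map (lineHom p v)).eval τ = Polynomial.aeval τ a := by
  have : (lineHom p v).comp MvPolynomial.C = algebraMap ℂ (PowerSeries ℂ) := by
    refine RingHom.ext fun x => ?_
    rw [RingHom.comp_apply, lineHom, coe_eval₂Hom, eval₂_C]
    rfl
  rw [Polynomial.map_map, this, Polynomial.eval_map_algebraMap]

theorem constantCoeff_aeval (a : Polynomial ℂ) (τ : PowerSeries ℂ) :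
    PowerSeries.constantCoeff (Polynomial.aeval τ a) = a.eval (PowerSeries.constantCoeff τ) := by
  rw [Polynomial.aeval_def, Polynomial.hom_eval₂, ← Polynomial.eval₂_id]
  congr 1

theorem constantCoeff_derivative_aeval (a : Polynomial ℂ) (τ : PowerSeries ℂ) :
    PowerSeries.constantCoeff (PowerSeries.derivative ℂ (Polynomial.aeval τ a)) =
      a.derivative.eval (PowerSeries.constantCoeff τ) *
        PowerSeries.constantCoeff (PowerSeries.derivative ℂ τ) := by
  rw [Derivation.map_aeval, smul_eq_mul, map_mul, constantCoeff_aeval]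

/-- Along a line transversal to the offset, the circle equation vanishes to first order. -/
theorem order_circle_eq_one {t s : ℂ} (hs : R.D.IsState t s) {v : Fin 2 → ℂ}
    (hv : R.D.V.eval t * v 0 - R.D.U.eval t * v 1 ≠ 0) {τ : PowerSeries ℂ}
    (hτ : PowerSeries.constantCoeff τ = t) :
    ((R.D.circle.map (lineHom (R.D.q t s) v)).eval τ).order = 1 := by
  set D := R.D
  set p := D.q t s with hp
  have hexp : (D.circle.map (lineHom p v)).eval τ =
      (Polynomial.aeval τ D.W * lineHom p v (X 0) - Polynomial.aeval τ D.X) ^ 2 +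
      (Polynomial.aeval τ D.W * lineHom p v (X 1) - Polynomial.aeval τ D.Y) ^ 2 -
        PowerSeries.C (D.d ^ 2) * Polynomial.aeval τ D.W ^ 2 := by
    have hC : lineHom p v (MvPolynomial.C (D.d ^ 2)) = PowerSeries.C (D.d ^ 2) := by
      rw [lineHom, coe_eval₂Hom, eval₂_C]
    simp only [OffsetData.circle, RatParam.xT, RatParam.yT, Polynomial.map_sub, Polynomial.map_add,
      Polynomial.map_pow, Polynomial.map_mul, Polynomial.map_C, Polynomial.eval_sub,
      Polynomial.eval_add, Polynomial.eval_pow, Polynomial.eval_mul, Polynomial.eval_C, hC,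
      OffsetData.lift, eval_map_lineHom_map_C]
  have hcc : PowerSeries.constantCoeff ((D.circle.map (lineHom p v)).eval τ) = 0 := by
    have h0 := hs.circle_eq_zero
    rw [OffsetData.evalXYT_circle] at h0
    rw [hexp]
    simp only [map_sub, map_add, map_mul, map_pow, constantCoeff_aeval, constantCoeff_lineHom, hτ,
      eval_X, PowerSeries.constantCoeff_C]
    simpa using h0
  refine order_eq_one_of hcc ?_
  rw [hexp]
  have hX : ∀ i, PowerSeries.constantCoeff (PowerSeries.derivative ℂ (lineHom p v (X i))) = v i := by
    intro i
    rw [constantCoeff_derivative_lineHom]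
    fin_cases i <;> simp
  simp only [map_sub, map_add, Derivation.leibniz_pow, Derivation.leibniz, smul_eq_mul, map_mul,
    map_pow, constantCoeff_aeval, constantCoeff_derivative_aeval, constantCoeff_lineHom, hX, hτ,
    eval_X, PowerSeries.constantCoeff_C, PowerSeries.derivative_C, nsmul_eq_mul, map_zero]
  obtain ⟨hW, hs0, hs2⟩ := id hs
  have hsq := hs.sq
  have hU : D.U.eval t = D.X.derivative.eval t * D.W.eval t - D.X.eval t * D.W.derivative.eval t := by
    simp [OffsetData.U]
  have hV : D.V.eval t = D.Y.derivative.eval t * D.W.eval t - D.Y.eval t * D.W.derivative.eval t := by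
    simp [OffsetData.V]
  obtain ⟨e, he⟩ : ∃ e, e * s = D.d := ⟨D.d / s, div_mul_cancel₀ _ hs0⟩
  have hp0 : D.W.eval t * p 0 - D.X.eval t = D.W.eval t * e * D.V.eval t := by
    have : p 0 = D.X.eval t / D.W.eval t + D.d * D.V.eval t / s := rfl
    rw [this, ← he]
    field_simp
    ring
  have hp1 : D.W.eval t * p 1 - D.Y.eval t = - (D.W.eval t * e * D.U.eval t) := by
    have : p 1 = D.Y.eval t / D.W.eval t - D.d * D.U.eval t / s := rfl
    rw [this, ← he]
    field_simp
    ring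
  have he0 : e ≠ 0 := by
    rintro rfl
    exact D.d_ne_zero (by rw [← he, zero_mul])
  -- This is the first-order term. It does not involve the derivative of `τ`, because the
  -- `t`-derivative of the circle polynomial vanishes at `q(t, s)`: the offset is an envelope of the
  -- circles.
  have hne : 2 * D.W.eval t ^ 2 * e * (D.V.eval t * v 0 - D.U.eval t * v 1) ≠ 0 :=
    mul_ne_zero (mul_ne_zero (mul_ne_zero two_ne_zero (pow_ne_zero _ hW)) he0) hv
  convert hne using 1
  rw [Nat.cast_ofNat, map_ofNat]
  generalize PowerSeries.constantCoeff (PowerSeries.derivative ℂ τ) = τ'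
  generalize D.W.eval t = w at *
  generalize D.W.derivative.eval t = w' at *
  generalize D.X.derivative.eval t = x' at *
  generalize D.Y.derivative.eval t = y' at *
  generalize D.U.eval t = u at *
  generalize D.V.eval t = v' at *
  linear_combination (2 * (w * v 0 + τ' * (w' * p 0 - x')) + 2 * e * τ' * v' * w') * hp0 +
    2 * e * τ' * v' * hU + (2 * (w * v 1 + τ' * (w' * p 1 - y')) - 2 * e * τ' * u * w') * hp1 -
    2 * e * τ' * u * hV - 2 * w * w' * τ' * e ^ 2 * hsq + 2 * w * w' * τ' * (e * s + D.d) * he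

theorem IsGeneric.order_lineHom_H {f f' h : PolyXY} {a : ℕ} (hH : R.H = f ^ a * h) {p v : Fin 2 → ℂ}
    (hp : R.IsGeneric f f' h p)
    (hv : v 0 * eval p (pderiv 0 f) + v 1 * eval p (pderiv 1 f) ≠ 0) :
    (lineHom p v R.H).order = a := by
  rw [hH, map_mul, map_pow, PowerSeries.order_mul, PowerSeries.order_pow,
    PowerSeries.order_eq_zero_of_constantCoeff_ne_zero (a := lineHom p v h)
      (by rw [constantCoeff_lineHom]; exact hp.cofactor_ne),
    order_eq_one_of (a := lineHom p v f) (by rw [constantCoeff_lineHom]; exact hp.mem)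
      (by rw [constantCoeff_derivative_lineHom]; exact hv)]
  simp

/-- The multiplicity of a component in the resultant is the number of parameters that generate a
generic point of that component. -/
theorem IsGeneric.encard_params {f f' h : PolyXY} {a : ℕ} (hH : R.H = f ^ a * h)
    (hzero : ∀ t s, R.D.IsState t s → eval (R.D.q t s) (f * f') = 0) {p : Fin 2 → ℂ}
    (hp : R.IsGeneric f f' h p) :
    {t | ∃ s, R.D.IsState t s ∧ R.D.q t s = p}.encard = a := by
  classical
  obtain ⟨i, hi⟩ := hp.smooth
  obtain ⟨v, hv⟩ : ∃ v : Fin 2 → ℂ,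
      v 0 * eval p (pderiv 0 f) + v 1 * eval p (pderiv 1 f) ≠ 0 := by
    refine ⟨Pi.single i 1, ?_⟩
    fin_cases i <;> simpa using hi
  have hfin := R.D.finite_q_eq p
  have hlc : PowerSeries.constantCoeff (lineHom p v R.P.leadingCoeff) ≠ 0 := by
    rw [constantCoeff_lineHom]
    have := hp.exceptional_ne
    rw [exceptional, map_mul] at this
    exact left_ne_zero_of_mul this
  have hlc0 : lineHom p v R.P.leadingCoeff ≠ 0 := by
    intro h0
    rw [h0, map_zero] at hlc
    exact hlc rfl
  have hdeg : (R.P.map (lineHom p v)).natDegree = R.P.natDegree :=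
    Polynomial.natDegree_map_of_leadingCoeff_ne_zero _ hlc0
  have hmm : ∀ g : Polynomial PolyXY, ∀ z, ((g.map (lineHom p v)).map
      (PowerSeries.constantCoeff (R := ℂ))).eval z = evalXYT g p z := by
    intro g z
    rw [Polynomial.map_map, constantCoeff_comp_lineHom, evalXYT]
  obtain ⟨cP, hcP, hcP0⟩ := exists_content_P (R := R)
  obtain ⟨cQ, hcQ, hcQ0⟩ := exists_content_Q (R := R)
  -- The leading coefficient of `P` does not vanish at `p`, so `P` keeps its degree on the line and
  -- the resultant commutes with the restriction.
  have key := PowerSeries.order_resultant (p := R.P.map (lineHom p v)) (q := R.Q.map (lineHom p v))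
    (k := R.Q.natDegree) (by rwa [Polynomial.leadingCoeff, hdeg, Polynomial.coeff_map])
    Polynomial.natDegree_map_le hfin.toFinset ?_ ?_ ?_
  · rw [hdeg, Polynomial.resultant_map_map] at key
    change (lineHom p v R.H).order = _ at key
    rw [hp.order_lineHom_H hH hv] at key
    rw [hfin.encard_eq_coe_toFinset_card, key]
  · intro z
    rw [hmm, hmm, Set.Finite.mem_toFinset]
    constructor
    · rintro ⟨s, hs, rfl⟩
      exact ⟨(evalXYT_P_eq_zero_iff hs _).2 hs.normal_eq_zero,
        (evalXYT_Q_eq_zero_iff hs _).2 hs.circle_eq_zero⟩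
    · rintro ⟨h1, h2⟩
      exact isState_of_common_root hp.exceptional_ne h1 h2
  -- A double root of `P` at a state would be one of the normal polynomial, which differs from `P`
  -- by a factor in ℂ[t]; the state would then be critical.
  · intro z hz h0
    rw [Set.Finite.mem_toFinset] at hz
    obtain ⟨s, hs, rfl⟩ := hz
    rw [Polynomial.derivative_map, hmm] at h0
    refine hp.not_critical z s hs rfl ?_
    have hP0 := (evalXYT_P_eq_zero_iff hs _).2 hs.normal_eq_zero
    rw [OffsetData.IsCritical, hcP, Polynomial.derivative_mul]
    rw [evalXYT, Polynomial.map_add, Polynomial.eval_add, Polynomial.map_mul, Polynomial.map_mul,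
      Polynomial.eval_mul, Polynomial.eval_mul]
    change _ * evalXYT _ _ _ + _ * evalXYT _ _ _ = 0
    rw [hP0, h0]
    ring
  · intro z hz τ hτ _
    rw [Set.Finite.mem_toFinset] at hz
    obtain ⟨s, hs, rfl⟩ := hz
    have hgrad := hp.gradient_normal hzero hs
    -- The tangent of `{f = 0}` at `p` has direction `(U, V)`, and `v` is transversal to it.
    have hV : R.D.V.eval z * v 0 - R.D.U.eval z * v 1 ≠ 0 := by
      intro h0
      have hS := hs.S_ne_zero
      rw [← hs.2.2, hs.sq] at hS
      apply hv
      apply mul_left_cancel₀ hS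
      linear_combination (R.D.U.eval z * v 0 + R.D.V.eval z * v 1) * hgrad + (R.D.V.eval z *
        eval (R.D.q z s) (pderiv 0 f) - R.D.U.eval z * eval (R.D.q z s) (pderiv 1 f)) * h0
    have hord := order_circle_eq_one hs hV hτ
    rw [hcQ, Polynomial.map_mul, Polynomial.eval_mul, eval_map_lineHom_map_C, PowerSeries.order_mul,
      PowerSeries.order_eq_zero_of_constantCoeff_ne_zero
        (by rw [constantCoeff_aeval, hτ]; exact hcQ0 z s hs), zero_add] at hord
    exact hord

end

end OffsetResultant

/-! ### The curve: equation, fibres and unit normals -/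

theorem trdeg_fractionRing_polynomial {K : Type*} [Field K] :
    Algebra.trdeg K (FractionRing (Polynomial K)) = 1 := by
  have h := trdeg_add_eq K (Polynomial K) (A := FractionRing (Polynomial K))
  have h2 : Algebra.IsAlgebraic (Polynomial K) (FractionRing (Polynomial K)) :=
    IsLocalization.isAlgebraic _ (nonZeroDivisors (Polynomial K))
  rw [Polynomial.trdeg_of_isDomain, trdeg_eq_zero, add_zero] at h
  exact h.symm

namespace OffsetData

noncomputable section

variable (D : OffsetData)

/-- One numerator serves both pointwise values and the function field, so an algebraic relation in
ℂ(t) can be evaluated at parameters. -/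
theorem exists_numerator (f : PolyXY) : ∃ (A : Polynomial ℂ) (k : ℕ),
    (∀ t, D.W.eval t ≠ 0 → D.W.eval t ^ k * eval (D.pt t) f = A.eval t) ∧
    (algebraMap _ (FractionRing (Polynomial ℂ)) D.W) ^ k *
      aeval ![algebraMap _ (FractionRing (Polynomial ℂ)) D.X /
          algebraMap _ (FractionRing (Polynomial ℂ)) D.W,
        algebraMap _ (FractionRing (Polynomial ℂ)) D.Y /
          algebraMap _ (FractionRing (Polynomial ℂ)) D.W] f = algebraMap _ _ A := by
  have hW : algebraMap _ (FractionRing (Polynomial ℂ)) D.W ≠ 0 := by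
    rw [Ne, IsFractionRing.to_map_eq_zero_iff]
    exact D.W_ne_zero
  induction f using MvPolynomial.induction_on with
  | C a =>
    refine ⟨Polynomial.C a, 0, by simp, ?_⟩
    rw [pow_zero, one_mul, ← algebraMap_eq, AlgHom.commutes,
      IsScalarTower.algebraMap_apply ℂ (Polynomial ℂ)]
    rfl
  | add p q hp hq =>
    obtain ⟨A, k, h1, h2⟩ := hp
    obtain ⟨A', k', h1', h2'⟩ := hq
    refine ⟨D.W ^ k' * A + D.W ^ k * A', k + k', fun t ht => ?_, ?_⟩
    · simp only [map_add, Polynomial.eval_add, Polynomial.eval_mul, Polynomial.eval_pow]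
      rw [← h1 t ht, ← h1' t ht]
      ring
    · simp only [map_add, map_mul, map_pow]
      rw [← h2, ← h2']
      ring
  | mul_X p i hp =>
    obtain ⟨A, k, h1, h2⟩ := hp
    fin_cases i
    · refine ⟨A * D.X, k + 1, fun t ht => ?_, ?_⟩
      · simp only [map_mul, Polynomial.eval_mul, eval_X, ← h1 t ht, pt, Fin.zero_eta,
          Matrix.cons_val_zero]
        field_simp
        ring
      · simp only [map_mul, aeval_X, ← h2, Fin.zero_eta, Matrix.cons_val_zero]
        field_simp
        ring
    · refine ⟨A * D.Y, k + 1, fun t ht => ?_, ?_⟩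
      · simp only [map_mul, Polynomial.eval_mul, eval_X, ← h1 t ht, pt, Fin.mk_one,
          Matrix.cons_val_one, Matrix.cons_val_fin_one]
        field_simp
        ring
      · simp only [map_mul, aeval_X, ← h2, Fin.mk_one, Matrix.cons_val_one, Matrix.cons_val_fin_one]
        field_simp
        ring

/-- The two coordinate functions are algebraically dependent, since ℂ(t) has transcendence degree
one. -/
theorem exists_curve_equation :
    ∃ f : PolyXY, f ≠ 0 ∧ ∀ t, D.W.eval t ≠ 0 → eval (D.pt t) f = 0 := by
  set x : Fin 2 → FractionRing (Polynomial ℂ) :=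
    ![algebraMap _ (FractionRing (Polynomial ℂ)) D.X /
          algebraMap _ (FractionRing (Polynomial ℂ)) D.W,
        algebraMap _ (FractionRing (Polynomial ℂ)) D.Y /
          algebraMap _ (FractionRing (Polynomial ℂ)) D.W] with hx
  have hdep : ¬ AlgebraicIndependent ℂ x := by
    intro h
    have := h.cardinalMk_le_trdeg
    rw [trdeg_fractionRing_polynomial] at this
    simp at this
  rw [algebraicIndependent_iff] at hdep
  push Not at hdep
  obtain ⟨f, hf, hf0⟩ := hdep
  refine ⟨f, hf0, fun t ht => ?_⟩
  obtain ⟨A, k, h1, h2⟩ := D.exists_numerator f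
  rw [← hx, hf, mul_zero, eq_comm, IsFractionRing.to_map_eq_zero_iff] at h2
  have := h1 t ht
  rw [h2, Polynomial.eval_zero] at this
  simpa [ht] using this

/-- A polynomial vanishing on the curve, whose gradient vanishes at only finitely many
parameters. -/
theorem exists_smooth_curve_equation : ∃ f : PolyXY,
    (∀ t, D.W.eval t ≠ 0 → eval (D.pt t) f = 0) ∧
    {t | D.W.eval t ≠ 0 ∧ ∀ i, eval (D.pt t) (pderiv i f) = 0}.Finite := by
  classical
  have hex : ∃ m : ℕ, ∃ f : PolyXY, f ≠ 0 ∧ (∀ t, D.W.eval t ≠ 0 → eval (D.pt t) f = 0) ∧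
      f.totalDegree = m := by
    obtain ⟨f, h1, h2⟩ := D.exists_curve_equation
    exact ⟨_, f, h1, h2, rfl⟩
  obtain ⟨f, hf0, hf, hdeg⟩ := Nat.find_spec hex
  -- `f` has least degree among the nonzero equations, so a derivative vanishing at infinitely many
  -- parameters, being an equation of smaller degree, is zero.
  have hmin : ∀ g : PolyXY, (∀ t, D.W.eval t ≠ 0 → eval (D.pt t) g = 0) →
      g.totalDegree < f.totalDegree → g = 0 := by
    intro g hg hlt
    by_contra hg0
    rw [hdeg] at hlt
    exact Nat.find_min hex hlt ⟨g, hg0, hg, rfl⟩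
  refine ⟨f, hf, ?_⟩
  by_contra hinf
  have hzero : ∀ i, pderiv i f = 0 := by
    intro i
    by_contra hne
    refine hne (hmin _ (fun t ht => ?_) (totalDegree_pderiv_lt i hne))
    obtain ⟨A, k, h1, -⟩ := D.exists_numerator (pderiv i f)
    have hA : A = 0 := by
      refine Polynomial.eq_zero_of_infinite_zeros (Set.Infinite.mono ?_ hinf)
      rintro u ⟨hu, hu0⟩
      change A.eval u = 0
      rw [← h1 u hu, hu0 i, mul_zero]
    have := h1 t ht
    rw [hA, Polynomial.eval_zero] at this
    simpa [ht] using this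
  have hC := eq_C_of_pderiv_eq_zero hzero
  obtain ⟨t, s, -, hs⟩ := D.exists_isState_notMem Set.finite_empty
  have h0 := hf t hs.1
  rw [hC, eval_C] at h0
  rw [h0, map_zero] at hC
  exact hf0 hC

theorem gradient_curve_normal {f : PolyXY} (hf : ∀ t, D.W.eval t ≠ 0 → eval (D.pt t) f = 0) {t : ℂ}
    (ht : D.W.eval t ≠ 0) :
    eval (D.pt t) (pderiv 0 f) * D.U.eval t + eval (D.pt t) (pderiv 1 f) * D.V.eval t = 0 := by
  have hx := (D.X.hasDerivAt t).fun_div (D.W.hasDerivAt t) ht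
  have hy := (D.Y.hasDerivAt t).fun_div (D.W.hasDerivAt t) ht
  have e1 := hasDerivAt_eval_mvPolynomial f hx hy
  have e2 : HasDerivAt (fun u => eval ![D.X.eval u / D.W.eval u, D.Y.eval u / D.W.eval u] f) 0 t := by
    refine (hasDerivAt_const t (0 : ℂ)).congr_of_eventuallyEq ?_
    filter_upwards [D.W.continuous.continuousAt.eventually_ne ht] with u hu using hf u hu
  have h3 := e1.unique e2
  have hU : D.U.eval t = D.X.derivative.eval t * D.W.eval t - D.X.eval t * D.W.derivative.eval t := by
    simp [U]
  have hV : D.V.eval t = D.Y.derivative.eval t * D.W.eval t - D.Y.eval t * D.W.derivative.eval t := by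
    simp [V]
  rw [← hU, ← hV] at h3
  change eval (D.pt t) (pderiv 0 f) * _ + eval (D.pt t) (pderiv 1 f) * _ = 0 at h3
  field_simp at h3
  rwa [mul_zero] at h3

/-- The parameters of a point of the curve. -/
def fib (z : Fin 2 → ℂ) : Set ℂ := {t | D.W.eval t ≠ 0 ∧ D.pt t = z}

theorem finite_fib (z : Fin 2 → ℂ) : (D.fib z).Finite := by
  have hne : D.X - Polynomial.C (z 0) * D.W ≠ 0 := by
    intro h
    have := D.no_line 1 0 (z 0) (by simpa using sub_eq_zero.1 h)
    simp at this
  refine (Polynomial.finite_zeros hne).subset ?_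
  rintro t ⟨ht, rfl⟩
  simp [pt, ht]

/-- The unit normal of the state `(t, s)`. -/
def nrm (t s : ℂ) : Fin 2 → ℂ := ![D.V.eval t / s, - (D.U.eval t / s)]

theorem q_eq (t s : ℂ) : D.q t s = D.pt t + D.d • D.nrm t s := by
  ext i
  fin_cases i <;> simp [q, qx, qy, pt, nrm] <;> ring

theorem nrm_neg (t s : ℂ) : D.nrm t (-s) = - D.nrm t s := by
  ext i
  fin_cases i <;> simp [nrm, div_neg]

variable {D}

theorem IsState.nrm_ne_zero {t s : ℂ} (h : D.IsState t s) : D.nrm t s ≠ 0 := by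
  intro h0
  have h1 := congrFun h0 0
  have h2 := congrFun h0 1
  simp only [nrm, Matrix.cons_val_zero, Matrix.cons_val_one, Pi.zero_apply, neg_eq_zero,
    div_eq_zero_iff, h.2.1, or_false] at h1 h2
  refine h.S_ne_zero ?_
  rw [← h.2.2, h.sq, h1, h2]
  ring

/-- States with parallel velocities have equal or opposite unit normals. -/
theorem nrm_eq_or_eq_neg {t s t' s' : ℂ} (h : D.IsState t s) (h' : D.IsState t' s')
    (hpar : D.U.eval t * D.V.eval t' = D.V.eval t * D.U.eval t') :
    D.nrm t' s' = D.nrm t s ∨ D.nrm t' s' = - D.nrm t s := by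
  obtain ⟨-, hs0, -⟩ := id h
  obtain ⟨-, hs0', -⟩ := id h'
  have e := h.sq
  have e' := h'.sq
  obtain ⟨l, hl1, hl2⟩ : ∃ l, D.U.eval t' = l * D.U.eval t ∧ D.V.eval t' = l * D.V.eval t := by
    refine ⟨(D.U.eval t * D.U.eval t' + D.V.eval t * D.V.eval t') / s ^ 2, ?_, ?_⟩
    · field_simp
      linear_combination D.U.eval t' * e - D.V.eval t * hpar
    · field_simp
      linear_combination D.V.eval t' * e + D.U.eval t * hpar
  have hl : s' ^ 2 = (l * s) ^ 2 := by
    rw [e', hl1, hl2]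
    linear_combination - l ^ 2 * e
  have hl0 : l ≠ 0 := by
    rintro rfl
    apply hs0'
    simpa using hl
  rcases sq_eq_sq_iff_eq_or_eq_neg.1 hl with h1 | h1
  · left
    ext i
    fin_cases i <;> simp only [nrm, hl1, hl2, h1] <;> simp <;> field_simp
  · right
    ext i
    fin_cases i <;> simp only [nrm, hl1, hl2, h1] <;> simp <;> field_simp

theorem exists_nrm_eq {t s t' s' : ℂ} (h : D.IsState t s) (h' : D.IsState t' s')
    (hpar : D.U.eval t * D.V.eval t' = D.V.eval t * D.U.eval t') :
    ∃ s'', D.IsState t' s'' ∧ D.nrm t' s'' = D.nrm t s := by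
  rcases nrm_eq_or_eq_neg h h' hpar with h1 | h1
  · exact ⟨s', h', h1⟩
  · exact ⟨-s', h'.neg, by rw [nrm_neg, h1, neg_neg]⟩

theorem parallel_of_nrm_eq {t s t' s' : ℂ} (h : D.IsState t s) (h' : D.IsState t' s')
    (e : D.nrm t' s' = D.nrm t s) :
    D.U.eval t * D.V.eval t' = D.V.eval t * D.U.eval t' := by
  obtain ⟨-, hs0, -⟩ := id h
  obtain ⟨-, hs0', -⟩ := id h'
  have h1 := congrFun e 0
  have h2 := congrFun e 1
  simp only [nrm, Matrix.cons_val_zero, Matrix.cons_val_one, neg_inj] at h1 h2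
  field_simp at h1 h2
  apply mul_left_cancel₀ hs0
  linear_combination D.U.eval t * h1 - D.V.eval t * h2

theorem parallel_of_gradient {a b u v u' v' : ℂ} (hab : a ≠ 0 ∨ b ≠ 0) (h : a * u + b * v = 0)
    (h' : a * u' + b * v' = 0) : u * v' = v * u' := by
  rcases hab with ha | hb
  · apply mul_left_cancel₀ ha
    linear_combination v' * h - v * h'
  · apply mul_left_cancel₀ hb
    linear_combination u * h' - u' * h

variable (D)

/-- A velocity of constant direction would make the curve a line. -/
theorem finite_parallel {t₀ s₀ : ℂ} (h : D.IsState t₀ s₀) :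
    {t | D.U.eval t₀ * D.V.eval t = D.V.eval t₀ * D.U.eval t}.Finite := by
  have hne : Polynomial.C (- D.V.eval t₀) * D.U + Polynomial.C (D.U.eval t₀) * D.V ≠ 0 := by
    intro h0
    obtain ⟨h1, h2⟩ := D.eq_zero_of_combination h0
    refine h.S_ne_zero ?_
    rw [← h.2.2, h.sq, h2, neg_eq_zero.1 h1]
    ring
  refine (Polynomial.finite_zeros hne).subset fun t ht => ?_
  simp only [Set.mem_ofPred_eq] at ht ⊢
  simp [ht]

/-- The curve points that generate `p`. -/
def gens (p : Fin 2 → ℂ) : Set (Fin 2 → ℂ) := {z | ∃ t s, D.IsState t s ∧ D.q t s = p ∧ z = D.pt t}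

end

end OffsetData

theorem not_add_mem_of_finite {A : Set (Fin 2 → ℂ)} (hA : A.Finite) {w : Fin 2 → ℂ} (hw : w ≠ 0)
    (hne : A.Nonempty) : ∃ z ∈ A, z + w ∉ A := by
  by_contra! h
  obtain ⟨z, hz⟩ := hne
  have hmem : ∀ k : ℕ, z + (k : ℂ) • w ∈ A := by
    intro k
    induction k with
    | zero => simpa using hz
    | succ k ih =>
      have := h _ ih
      convert this using 1
      push_cast
      module
  refine Set.infinite_of_injective_forall_mem (f := fun k : ℕ => z + (k : ℂ) • w) ?_ hmem hA
  intro k l hkl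
  have h1 := add_left_cancel hkl
  exact_mod_cast smul_left_injective ℂ hw h1

namespace OffsetData

noncomputable section

variable (D : OffsetData)

/-- All but finitely many points of the curve have `n` parameters. -/
def HasIndex (n : ℕ) : Prop := {t | D.W.eval t ≠ 0 ∧ (D.fib (D.pt t)).encard ≠ n}.Finite

variable {D}

theorem HasIndex.ne_zero {n : ℕ} (hn : D.HasIndex n) : n ≠ 0 := by
  rintro rfl
  obtain ⟨t, s, ht, hs⟩ := D.exists_isState_notMem hn
  refine ht ⟨hs.1, ?_⟩
  rw [Nat.cast_zero, Set.encard_ne_zero]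
  exact ⟨t, hs.1, rfl⟩

/-- Outside finitely many parameters, all parameters of a curve point generate the same offset
points. -/
theorem HasIndex.exists_finite_bad {n : ℕ} (hn : D.HasIndex n) : ∃ T : Set ℂ, T.Finite ∧
    ∀ t s, t ∉ T → D.IsState t s → (D.fib (D.pt t)).encard = n ∧
      ∀ u ∈ D.fib (D.pt t), ∃ s', D.IsState u s' ∧ D.q u s' = D.q t s := by
  obtain ⟨c, hc, hcfin⟩ := D.exists_smooth_curve_equation
  -- Whole fibres through stateless parameters are discarded, so that each parameter of a remaining
  -- curve point has a state. At a nonsingular point these states have parallel velocities.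
  have hfib : (⋃ u ∈ {u | ¬ ∃ s, D.IsState u s}, D.fib (D.pt u)).Finite :=
    D.finite_not_good.biUnion fun u _ => D.finite_fib _
  refine ⟨_, (hn.union hcfin).union hfib, fun t s ht hs => ?_⟩
  simp only [Set.mem_union, not_or, Set.mem_iUnion, not_exists] at ht
  obtain ⟨⟨h1, h2⟩, h3⟩ := ht
  refine ⟨?_, fun u hu => ?_⟩
  · by_contra hne
    exact h1 ⟨hs.1, hne⟩
  · obtain ⟨s₁, hs₁⟩ : ∃ s, D.IsState u s := by
      by_contra hbad
      exact h3 u (not_exists.1 hbad) ⟨hs.1, hu.2.symm⟩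
    have hgrad : eval (D.pt t) (pderiv 0 c) ≠ 0 ∨ eval (D.pt t) (pderiv 1 c) ≠ 0 := by
      by_contra! h0
      refine h2 ⟨hs.1, fun i => ?_⟩
      fin_cases i
      · exact h0.1
      · exact h0.2
    have e1 := D.gradient_curve_normal hc hs.1
    have e2 := D.gradient_curve_normal hc hs₁.1
    rw [hu.2] at e2
    obtain ⟨s', hs', he⟩ := exists_nrm_eq hs hs₁ (parallel_of_gradient hgrad e1 e2)
    exact ⟨s', hs', by rw [q_eq, q_eq, he, hu.2]⟩

end

end OffsetData

/-! ### Counting the generators of a generic offset point -/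

namespace OffsetResultant

noncomputable section

variable {R : OffsetResultant}

theorem IsGeneric.nrm_eq_or_eq_neg {f f' h : PolyXY}
    (hzero : ∀ t s, R.D.IsState t s → eval (R.D.q t s) (f * f') = 0) {t s t' s' : ℂ}
    (hp : R.IsGeneric f f' h (R.D.q t s)) (hs : R.D.IsState t s) (hs' : R.D.IsState t' s')
    (hq : R.D.q t' s' = R.D.q t s) :
    R.D.nrm t' s' = R.D.nrm t s ∨ R.D.nrm t' s' = - R.D.nrm t s := by
  have e1 := hp.gradient_normal hzero hs
  have e2 := (hq ▸ hp : R.IsGeneric f f' h (R.D.q t' s')).gradient_normal hzero hs'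
  rw [hq] at e2
  have hgrad : eval (R.D.q t s) (pderiv 0 f) ≠ 0 ∨ eval (R.D.q t s) (pderiv 1 f) ≠ 0 := by
    obtain ⟨i, hi⟩ := hp.smooth
    fin_cases i
    · exact Or.inl hi
    · exact Or.inr hi
  exact OffsetData.nrm_eq_or_eq_neg hs hs' (OffsetData.parallel_of_gradient hgrad e1 e2)

variable (R)

/-- The two generators of `p` lie on opposite sides: any two states over `p` have the same curve
point or opposite normals. -/
def HasOppositeNormals (p : Fin 2 → ℂ) : Prop :=
  ∀ t s t' s', R.D.IsState t s → R.D.IsState t' s' → R.D.q t s = p → R.D.q t' s' = p →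
    R.D.pt t' = R.D.pt t ∨ R.D.nrm t' s' = - R.D.nrm t s

variable {R}

/-- Normals over `p` agree up to sign, and `p = φ(t) + dN` recovers the curve point from `N`. -/
theorem IsGeneric.hasOppositeNormals {f f' h : PolyXY}
    (hzero : ∀ t s, R.D.IsState t s → eval (R.D.q t s) (f * f') = 0) {p : Fin 2 → ℂ}
    (hp : R.IsGeneric f f' h p) : R.HasOppositeNormals p := by
  rintro t s t' s' hs hs' rfl hq
  rcases hp.nrm_eq_or_eq_neg hzero hs hs' hq with h1 | h1
  · left
    rw [OffsetData.q_eq, OffsetData.q_eq, h1] at hq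
    exact add_right_cancel hq
  · exact Or.inr h1

/-- The number of parameters over a generic point is `n` or `2 n`, according to the number of its
generators. -/
theorem encard_params_of_hasOppositeNormals {n : ℕ} {T : Set ℂ}
    (hT : ∀ t s, t ∉ T → R.D.IsState t s → (R.D.fib (R.D.pt t)).encard = n ∧
      ∀ u ∈ R.D.fib (R.D.pt t), ∃ s', R.D.IsState u s' ∧ R.D.q u s' = R.D.q t s)
    {p : Fin 2 → ℂ} (hg : R.D.Generated p) (hopp : R.HasOppositeNormals p)
    (hpT : ∀ t s, R.D.IsState t s → R.D.q t s = p → t ∉ T) :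
    ∃ k : ℕ, (k = 1 ∨ k = 2) ∧ (R.D.gens p).encard = k ∧
      {t | ∃ s, R.D.IsState t s ∧ R.D.q t s = p}.encard = (n * k : ℕ) := by
  have hunion : {t | ∃ s, R.D.IsState t s ∧ R.D.q t s = p} = ⋃ z ∈ R.D.gens p, R.D.fib z := by
    ext t
    simp only [Set.mem_iUnion, Set.mem_ofPred_eq]
    constructor
    · rintro ⟨s, hs, hq⟩
      exact ⟨R.D.pt t, ⟨t, s, hs, hq, rfl⟩, hs.1, rfl⟩
    · rintro ⟨z, ⟨u, s, hs, hq, rfl⟩, ht⟩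
      obtain ⟨s', hs', hq'⟩ := (hT u s (hpT u s hs hq) hs).2 t ht
      exact ⟨s', hs', hq'.trans hq⟩
  have hcard : ∀ z ∈ R.D.gens p, (R.D.fib z).encard = n := by
    rintro z ⟨u, s, hs, hq, rfl⟩
    exact (hT u s (hpT u s hs hq) hs).1
  obtain ⟨t, s, hs, hq⟩ := hg
  have hmem : R.D.pt t ∈ R.D.gens p := ⟨t, s, hs, hq, rfl⟩
  have hrest : ∀ z ∈ R.D.gens p, z = R.D.pt t ∨ z = p + R.D.d • R.D.nrm t s := by
    rintro z ⟨t', s', hs', hq', rfl⟩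
    rcases hopp t s t' s' hs hs' hq hq' with h1 | h1
    · exact Or.inl h1
    · right
      rw [← hq', OffsetData.q_eq, h1]
      simp
  rw [hunion]
  by_cases h2 : ∃ z ∈ R.D.gens p, z ≠ R.D.pt t
  · obtain ⟨z, hz, hzne⟩ := h2
    have hgens : R.D.gens p = {R.D.pt t, z} := by
      apply Set.Subset.antisymm
      · intro y hy
        have hz' := (hrest z hz).resolve_left hzne
        rcases hrest y hy with rfl | h1
        · exact Or.inl rfl
        · exact Or.inr (h1.trans hz'.symm)
      · rintro y (rfl | rfl)
        · exact hmem
        · exact hz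
    refine ⟨2, Or.inr rfl, by rw [hgens, Set.encard_pair hzne.symm]; rfl, ?_⟩
    rw [hgens, Set.biUnion_pair, Set.encard_union_eq, hcard _ hmem, hcard _ hz]
    · push_cast
      rw [mul_two]
    · rw [Set.disjoint_left]
      rintro u ⟨-, hu⟩ ⟨-, hu'⟩
      exact hzne (hu'.symm.trans hu)
  · push Not at h2
    have hgens : R.D.gens p = {R.D.pt t} := by
      apply Set.Subset.antisymm
      · intro y hy
        exact h2 y hy
      · rintro y rfl
        exact hmem
    refine ⟨1, Or.inl rfl, by rw [hgens]; simp, ?_⟩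
    rw [hgens, Set.biUnion_singleton, hcard _ hmem, mul_one]

theorem exists_multiplicity {f : PolyXY} (hf : Irreducible f) : ∃ (a : ℕ) (h : PolyXY),
    R.H = f ^ a * h ∧ ¬ f ∣ h := by
  have hfin : FiniteMultiplicity f R.H := FiniteMultiplicity.of_not_isUnit hf.not_isUnit H_ne_zero
  obtain ⟨h, h1, h2⟩ := hfin.exists_eq_pow_mul_and_not_dvd
  exact ⟨_, h, h1, h2⟩

/-- The multiplicity of a main factor is `n` times the number of generators of its generic
points. -/
theorem IsMain.exists_count {n : ℕ} (hn : R.D.HasIndex n) {f f' : PolyXY} (hf : R.IsMain f)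
    (hff' : ¬ f ∣ f') (hzero : ∀ t s, R.D.IsState t s → eval (R.D.q t s) (f * f') = 0) :
    ∃ k : ℕ, (k = 1 ∨ k = 2) ∧ (∃ h, R.H = f ^ (n * k) * h ∧ ¬ f ∣ h) ∧
      {p | p ∈ planeCurve f ∧
        ¬ ((R.D.gens p).encard = k ∧ R.HasOppositeNormals p)}.Finite := by
  obtain ⟨a, h, hH, hfh⟩ := exists_multiplicity (R := R) hf.1
  obtain ⟨T, hTfin, hT⟩ := hn.exists_finite_bad
  have hbad := (finite_not_isGeneric hf hfh hff').union
    (hf.finite_not_generated.union (R.D.finite_of_finite_params hTfin))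
  have key : ∀ p ∈ planeCurve f, p ∉ {p | p ∈ planeCurve f ∧ ¬ R.IsGeneric f f' h p} ∪
      ({p | p ∈ planeCurve f ∧ ¬ R.D.Generated p} ∪
        {p | ∃ t ∈ T, ∃ s, R.D.IsState t s ∧ R.D.q t s = p}) →
      ∃ k : ℕ, (k = 1 ∨ k = 2) ∧ a = n * k ∧ (R.D.gens p).encard = k ∧
        R.HasOppositeNormals p := by
    intro p hp hpb
    simp only [Set.mem_union, not_or] at hpb
    obtain ⟨b1, b2, b3⟩ := hpb
    have hgen : R.IsGeneric f f' h p := by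
      by_contra hc
      exact b1 ⟨hp, hc⟩
    have hg : R.D.Generated p := by
      by_contra hc
      exact b2 ⟨hp, hc⟩
    obtain ⟨k, hk, h1, h2⟩ := encard_params_of_hasOppositeNormals hT hg
      (hgen.hasOppositeNormals hzero) (fun t s hs hq ht => b3 ⟨t, ht, s, hs, hq⟩)
    rw [hgen.encard_params hH hzero] at h2
    exact ⟨k, hk, by exact_mod_cast h2, h1, hgen.hasOppositeNormals hzero⟩
  -- The multiplicity `a` does not depend on the point and `n ≠ 0`, so the `k` found at one good
  -- point holds at all of them.
  obtain ⟨p₀, hp₀, hp₀b⟩ := ((planeCurve_infinite hf.1).sdiff hbad).nonempty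
  obtain ⟨k, hk, rfl, -, -⟩ := key p₀ hp₀ hp₀b
  refine ⟨k, hk, ⟨h, hH, hfh⟩, hbad.subset ?_⟩
  rintro p ⟨hp, hnot⟩
  by_contra hpb
  obtain ⟨k', -, hkk', h1, h2⟩ := key p hp hpb
  have : k' = k := (Nat.eq_of_mul_eq_mul_left (Nat.pos_of_ne_zero hn.ne_zero) hkk').symm
  subst this
  exact hnot ⟨h1, h2⟩

/-- Not every component of the offset is special. -/
theorem exists_point_not_two {F : PolyXY}
    (hzero : ∀ t s, R.D.IsState t s → eval (R.D.q t s) F = 0)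
    (hfin : {p | p ∈ planeCurve F ∧
      ¬ ((R.D.gens p).encard = 2 ∧ R.HasOppositeNormals p)}.Finite) : False := by
  set D := R.D
  have hT := D.finite_q_mem hfin
  -- Choosing `t₀` with velocity parallel to that of no bad parameter ensures that every state
  -- sharing its normal has a good offset point.
  have hpar : (⋃ b ∈ {t | ∃ s, D.IsState t s ∧ D.q t s ∈ {p | p ∈ planeCurve F ∧
      ¬ ((D.gens p).encard = 2 ∧ R.HasOppositeNormals p)}},
      {t | D.U.eval b * D.V.eval t = D.V.eval b * D.U.eval t}).Finite := by
    refine hT.biUnion ?_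
    rintro b ⟨s, hs, -⟩
    exact D.finite_parallel hs
  obtain ⟨t₀, s₀, ht₀, hs₀⟩ := D.exists_isState_notMem hpar
  let A : Set (Fin 2 → ℂ) := {z | ∃ t s, D.IsState t s ∧ D.nrm t s = D.nrm t₀ s₀ ∧ z = D.pt t}
  have hA : A.Finite := by
    refine ((D.finite_parallel hs₀).image D.pt).subset ?_
    rintro z ⟨t, s, hs, hN, rfl⟩
    exact ⟨t, OffsetData.parallel_of_nrm_eq hs₀ hs hN, rfl⟩
  obtain ⟨z, ⟨t, s, hs, hN, rfl⟩, hz⟩ := not_add_mem_of_finite hA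
    (w := (2 * D.d) • D.nrm t₀ s₀)
    (smul_ne_zero (mul_ne_zero two_ne_zero D.d_ne_zero) hs₀.nrm_ne_zero)
    ⟨D.pt t₀, t₀, s₀, hs₀, rfl, rfl⟩
  apply hz
  have hgood : (D.gens (D.q t s)).encard = 2 ∧ R.HasOppositeNormals (D.q t s) := by
    by_contra hc
    refine ht₀ ?_
    simp only [Set.mem_iUnion]
    refine ⟨t, ⟨s, hs, hzero t s hs, hc⟩, ?_⟩
    exact OffsetData.parallel_of_nrm_eq hs hs₀ hN.symm
  obtain ⟨hcard, hopp⟩ := hgood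
  obtain ⟨z, hz, hzne⟩ : ∃ z ∈ D.gens (D.q t s), z ≠ D.pt t := by
    by_contra! hall
    have : (D.gens (D.q t s)).encard ≤ 1 := by
      refine (Set.encard_le_encard (t := {D.pt t}) fun y hy => hall y hy).trans ?_
      simp
    rw [hcard] at this
    exact absurd this (by norm_num)
  obtain ⟨t', s', hs', hq', rfl⟩ := hz
  have hN' := (hopp t s t' s' hs hs' rfl hq').resolve_left hzne
  -- The second generator is `φ(t) + 2dN` with normal `-N`. The other root there has normal `N`, so
  -- this point is again in `A`.
  refine ⟨t', -s', hs'.neg, by rw [OffsetData.nrm_neg, hN', neg_neg, hN], ?_⟩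
  have e := hq'
  rw [OffsetData.q_eq, OffsetData.q_eq, hN', hN] at e
  rw [← sub_eq_zero] at e ⊢
  rw [← neg_eq_zero, ← e]
  module

end

end OffsetResultant

/-! ### Factorization of the resultant and its uniqueness -/

theorem associated_iff_planeCurve_eq {f g : PolyXY} (hf : Irreducible f) (hg : Irreducible g) :
    Associated f g ↔ planeCurve f = planeCurve g :=
  ⟨fun h => (planeCurve_subset_of_dvd h.dvd).antisymm (planeCurve_subset_of_dvd h.symm.dvd),
    fun h => hf.associated_of_dvd hg (dvd_of_planeCurve_subset hf h.subset)⟩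

theorem exists_eq_C_mul_of_associated {f g : PolyXY} (h : Associated f g) :
    ∃ c : ℂ, c ≠ 0 ∧ g = C c * f := by
  obtain ⟨u, rfl⟩ := h
  obtain ⟨c, hc, hu⟩ := isUnit_iff_eq_C_of_isReduced.1 u.isUnit
  exact ⟨c, isUnit_iff_ne_zero.1 hc, by rw [hu, mul_comm]⟩

theorem planeCurve_pow (f : PolyXY) {n : ℕ} (hn : n ≠ 0) : planeCurve (f ^ n) = planeCurve f := by
  ext p
  simp [planeCurve, hn]

/-- Two polynomials without a common irreducible factor are relatively prime. -/
theorem isRelPrime_of_irreducible {f g : PolyXY} (hf : f ≠ 0)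
    (h : ∀ l, Irreducible l → l ∣ f → ¬ l ∣ g) : IsRelPrime f g := by
  intro a haf hag
  by_contra hu
  obtain ⟨l, hl, hla⟩ := WfDvdMonoid.exists_irreducible_factor hu (ne_zero_of_dvd_ne_zero hf haf)
  exact h l hl (hla.trans haf) (hla.trans hag)

theorem totalDegree_eq_one_of_dvd_prod {L : Multiset PolyXY} (hL : ∀ l ∈ L, l.totalDegree = 1)
    {f : PolyXY} (hf : Irreducible f) (h : f ∣ L.prod) : f.totalDegree = 1 := by
  obtain ⟨l, hl, hfl⟩ := hf.prime.exists_mem_multiset_dvd h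
  have hl1 := hL l hl
  by_contra hne
  refine not_dvd_of_totalDegree_le_one hf hne ?_ hl1.le hfl
  rintro rfl
  simp at hl1

namespace OffsetResultant

noncomputable section

variable {R : OffsetResultant}

/-- The main factors and their multiplicities: `f` occurs `n` times, and `g`, if it is not `1`,
occurs `n * e` times, where `e` is the number of generators of its generic points. -/
structure IsStructure (R : OffsetResultant) (n : ℕ) (f g : PolyXY) (e : ℕ) : Prop where
  pair : R.IsMainPair f g
  e_eq : e = 1 ∨ e = 2 ∧ g ≠ 1
  pow_f : ∃ h, R.H = f ^ n * h ∧ ¬ f ∣ h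
  pow_g : g ≠ 1 → ∃ h, R.H = g ^ (n * e) * h ∧ ¬ g ∣ h
  gens_f : {p | p ∈ planeCurve f ∧ (R.D.gens p).encard ≠ 1}.Finite
  gens_g : {p | p ∈ planeCurve g ∧ (R.D.gens p).encard ≠ e}.Finite

theorem IsMainPair.not_dvd {f g : PolyXY} (h : R.IsMainPair f g) : ¬ f ∣ g := by
  rcases h.2.1 with rfl | hg
  · exact fun h1 => h.1.1.not_isUnit (isUnit_of_dvd_one h1)
  · exact fun h1 => hg.2 (h.1.1.associated_of_dvd hg.1.1 h1)

theorem IsMainPair.symm {f g : PolyXY} (h : R.IsMainPair f g) (hg : g ≠ 1) : R.IsMainPair g f := by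
  have h2 := h.2.1.resolve_left hg
  exact ⟨h2.1, Or.inr ⟨h.1, fun h3 => h2.2 h3.symm⟩, fun k hk => by
    rw [mul_comm]; exact h.2.2 k hk⟩

theorem exists_isStructure {n : ℕ} (hn : R.D.HasIndex n) : ∃ f g e, R.IsStructure n f g e := by
  obtain ⟨f, g, hp⟩ := R.exists_isMainPair
  obtain ⟨k, hk, hkpow, hkfin⟩ := hp.1.exists_count hn hp.not_dvd fun t s hs => hp.eval_q hs
  have hweak : ∀ (h : PolyXY) (k : ℕ), {p | p ∈ planeCurve h ∧
        ¬ ((R.D.gens p).encard = k ∧ R.HasOppositeNormals p)}.Finite →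
      {p | p ∈ planeCurve h ∧ (R.D.gens p).encard ≠ k}.Finite := by
    intro h k hfin
    exact hfin.subset fun p hp => ⟨hp.1, fun h => hp.2 h.1⟩
  by_cases hg : g = 1
  · subst hg
    have hk1 : k = 1 := by
      rcases hk with hk | rfl
      · exact hk
      · exfalso
        refine exists_point_not_two (R := R) (F := f) (fun t s hs => ?_) hkfin
        simpa using hp.eval_q hs
    subst hk1
    refine ⟨f, 1, 1, hp, Or.inl rfl, by simpa using hkpow, fun h => absurd rfl h,
      by simpa using hweak f 1 hkfin, ?_⟩
    rw [planeCurve_one]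
    simp
  · have hp' := hp.symm hg
    obtain ⟨l, hl, hlpow, hlfin⟩ := hp'.1.exists_count hn hp'.not_dvd fun t s hs => hp'.eval_q hs
    rcases hk with rfl | rfl
    · exact ⟨f, g, l, hp, hl.imp id fun h => ⟨h, hg⟩, by simpa using hkpow, fun _ => hlpow,
        by simpa using hweak f 1 hkfin, hweak g l hlfin⟩
    -- Here `f` has two generators per generic point. The roles are swapped so that the second
    -- equation is the special one.
    · rcases hl with rfl | rfl
      · exact ⟨g, f, 2, hp', Or.inr ⟨rfl, fun h1 => hp.1.1.not_isUnit (h1 ▸ isUnit_one)⟩,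
          by simpa using hlpow, fun _ => hkpow, by simpa using hweak g 1 hlfin, hweak f 2 hkfin⟩
      · exfalso
        refine exists_point_not_two (R := R) (F := f * g) (fun t s hs => hp.eval_q hs) ?_
        refine (hkfin.union hlfin).subset ?_
        rintro p ⟨hpm, hpn⟩
        rw [planeCurve_mul] at hpm
        exact hpm.imp (fun h => ⟨h, hpn⟩) fun h => ⟨h, hpn⟩

/-- The factorization of the resultant. -/
theorem IsStructure.factorization {n e : ℕ} {f g : PolyXY} (h : R.IsStructure n f g e) :
    ∃ (c : ℂ) (L : Multiset PolyXY), c ≠ 0 ∧ (∀ l ∈ L, l.totalDegree = 1) ∧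
      R.H = C c * (f ^ n * g ^ (n * e)) * L.prod := by
  have hf := h.pair.1.1
  obtain ⟨h₁, hH₁, hf₁⟩ := h.pow_f
  have hrel : IsRelPrime (f ^ n) (g ^ (n * e)) := by
    refine isRelPrime_of_irreducible (pow_ne_zero _ hf.ne_zero) fun l hl h1 h2 => ?_
    have h3 := hl.prime.dvd_of_dvd_pow h1
    have h4 := hl.prime.dvd_of_dvd_pow h2
    exact h.pair.not_dvd ((hl.associated_of_dvd hf h3).symm.dvd.trans h4)
  have hgH : g ^ (n * e) ∣ R.H := by
    by_cases hg : g = 1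
    · rw [hg, one_pow]; exact one_dvd _
    · obtain ⟨h₂, hH₂, -⟩ := h.pow_g hg
      exact ⟨h₂, hH₂⟩
  obtain ⟨K, hK⟩ := hrel.mul_dvd ⟨h₁, hH₁⟩ hgH
  have hK0 : K ≠ 0 := by
    rintro rfl
    exact H_ne_zero (R := R) (by rw [hK, mul_zero])
  have hfK : ¬ f ∣ K := by
    rintro ⟨K', rfl⟩
    apply hf₁
    refine ⟨g ^ (n * e) * K', mul_left_cancel₀ (pow_ne_zero n hf.ne_zero) ?_⟩
    rw [← hH₁, hK]
    ring
  have hgK : g ≠ 1 → ¬ g ∣ K := by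
    rintro hg ⟨K', rfl⟩
    obtain ⟨h₂, hH₂, hg₂⟩ := h.pow_g hg
    apply hg₂
    have hg0 : g ≠ 0 := ((h.pair.2.1.resolve_left hg).1.1).ne_zero
    refine ⟨f ^ n * K', mul_left_cancel₀ (pow_ne_zero (n * e) hg0) ?_⟩
    rw [← hH₂, hK]
    ring
  obtain ⟨L, hL, hass⟩ := UniqueFactorizationMonoid.exists_prime_factors K hK0
  obtain ⟨c, hc, hKc⟩ := exists_eq_C_mul_of_associated hass
  refine ⟨c, L, hc, fun l hl => ?_, by rw [hK, hKc]; ring⟩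
  have hlK : l ∣ K := (Multiset.dvd_prod hl).trans hass.dvd
  have hli := (hL l hl).irreducible
  -- A nonlinear factor of the cofactor would be a main factor, hence `f` or `g`, whose full powers
  -- have already been removed.
  by_contra hl1
  have hmain : R.IsMain l := ⟨hli, hl1, hlK.trans (by rw [hK]; exact dvd_mul_left _ _)⟩
  rcases hli.prime.dvd_or_dvd (h.pair.2.2 l hmain) with h1 | h1
  · exact hfK ((hli.associated_of_dvd hf h1).symm.dvd.trans hlK)
  · rcases h.pair.2.1 with hg | hg
    · rw [hg] at h1
      exact hli.not_isUnit (isUnit_of_dvd_one h1)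
    · exact hgK (fun hg1 => hg.1.1.not_isUnit (hg1 ▸ isUnit_one))
        ((hli.associated_of_dvd hg.1.1 h1).symm.dvd.trans hlK)

theorem IsStructure.planeCurve_eq {n e : ℕ} {f g : PolyXY} (h : R.IsStructure n f g e)
    (hn : n ≠ 0) : planeCurve (f ^ n * g ^ (n * e)) = planeCurve (f * g) := by
  have he : n * e ≠ 0 := by
    refine mul_ne_zero hn ?_
    rcases h.e_eq with h1 | h1 <;> omega
  rw [planeCurve_mul, planeCurve_mul, planeCurve_pow _ hn, planeCurve_pow _ he]

/-- The nonlinear part of the resultant is determined by its zero set. -/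
theorem IsStructure.associated {n e : ℕ} {f g : PolyXY} (h : R.IsStructure n f g e)
    {F G : PolyXY} (hFG : R.H = F * G) (hF : planeCurve F = planeCurve (f * g))
    {L : Multiset PolyXY} (hL : ∀ l ∈ L, l.totalDegree = 1) (hG : G = L.prod) :
    Associated (f ^ n * g ^ (n * e)) F := by
  obtain ⟨c, L', hc, hL', hH⟩ := h.factorization
  have hF0 : F ≠ 0 := by
    rintro rfl
    exact H_ne_zero (R := R) (by rw [hFG, zero_mul])
  have hM0 : f ^ n * g ^ (n * e) ≠ 0 := by
    intro h0
    exact H_ne_zero (R := R) (by rw [hH, h0]; ring)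
  -- Irreducible factors of `F` vanish only on the offset, so they are main factors. This makes `F`
  -- coprime to the linear part.
  have hmain : ∀ l, Irreducible l → l ∣ F → l.totalDegree ≠ 1 := fun l hl hlF =>
    (h.pair.isMain_of_dvd hl (dvd_of_planeCurve_subset hl
      ((planeCurve_subset_of_dvd hlF).trans hF.subset))).2.1
  have hmain' : ∀ l, Irreducible l → l ∣ f ^ n * g ^ (n * e) → l.totalDegree ≠ 1 := by
    intro l hl hlM
    refine (h.pair.isMain_of_dvd hl ?_).2.1
    rcases hl.prime.dvd_or_dvd hlM with h1 | h1
    · exact (hl.prime.dvd_of_dvd_pow h1).trans (dvd_mul_right _ _)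
    · exact (hl.prime.dvd_of_dvd_pow h1).trans (dvd_mul_left _ _)
  have hcu : IsUnit (C c : PolyXY) := (isUnit_iff_ne_zero.2 hc).map C
  have key : F * G = C c * (f ^ n * g ^ (n * e)) * L'.prod := hFG.symm.trans hH
  refine associated_of_dvd_dvd ?_ ?_
  · have hrel : IsRelPrime (f ^ n * g ^ (n * e)) G := isRelPrime_of_irreducible hM0
      fun l hl h1 h2 => hmain' l hl h1 (totalDegree_eq_one_of_dvd_prod hL hl (hG ▸ h2))
    refine hrel.dvd_of_dvd_mul_right ⟨C c * L'.prod, ?_⟩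
    rw [key]; ring
  · have hrel : IsRelPrime F L'.prod := isRelPrime_of_irreducible hF0
      fun l hl h1 h2 => hmain l hl h1 (totalDegree_eq_one_of_dvd_prod hL' hl h2)
    have h1 : F ∣ C c * (f ^ n * g ^ (n * e)) := hrel.dvd_of_dvd_mul_right ⟨G, key.symm⟩
    exact (hcu.dvd_mul_left).1 h1

end

end OffsetResultant

/-! ### From real lines and circles to complex ones -/

theorem irreducible_of_totalDegree_eq_one {f : PolyXY} (hf : f.totalDegree = 1) :
    Irreducible f := by
  have hf0 : f ≠ 0 := by
    rintro rfl
    simp at hf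
  refine ⟨fun hu => ?_, fun a b hab => ?_⟩
  · have := (isUnit_iff_totalDegree_of_isReduced.1 hu).2
    omega
  · have ha : a ≠ 0 := left_ne_zero_of_mul (hab ▸ hf0)
    have hb : b ≠ 0 := right_ne_zero_of_mul (hab ▸ hf0)
    rw [hab, totalDegree_mul_of_isDomain ha hb] at hf
    have hunit : ∀ c : PolyXY, c ≠ 0 → c.totalDegree = 0 → IsUnit c := by
      intro c hc hc0
      have h1 := totalDegree_eq_zero_iff_eq_C.1 hc0
      rw [h1]
      refine (isUnit_iff_ne_zero.2 fun h0 => hc ?_).map C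
      rw [h1, h0, map_zero]
    rcases Nat.eq_zero_or_pos a.totalDegree with h | h
    · exact Or.inl (hunit a ha h)
    · exact Or.inr (hunit b hb (by omega))

theorem exists_linear_form {f : PolyXY} (hf : f.totalDegree = 1) : ∃ a b c : ℂ,
    (a ≠ 0 ∨ b ≠ 0) ∧ f = C a * X 0 + C b * X 1 + C c := by
  have hconst : ∀ i, pderiv i f = C (coeff 0 (pderiv i f)) := by
    intro i
    rw [← totalDegree_eq_zero_iff_eq_C]
    by_cases h : pderiv i f = 0
    · simp [h]
    · have := totalDegree_pderiv_lt i h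
      omega
  have h0 := eq_C_of_pderiv_eq_zero (f := f - C (coeff 0 (pderiv 0 f)) * X 0 -
    C (coeff 0 (pderiv 1 f)) * X 1) (by
      intro i
      fin_cases i
      · simp only [Fin.zero_eta, map_sub, pderiv_C_mul]
        rw [← hconst 0]
        simp
      · simp only [Fin.mk_one, map_sub, pderiv_C_mul]
        rw [← hconst 1]
        simp)
  refine ⟨coeff 0 (pderiv 0 f), coeff 0 (pderiv 1 f), coeff 0 (f - C (coeff 0 (pderiv 0 f)) * X 0 -
    C (coeff 0 (pderiv 1 f)) * X 1), ?_, by linear_combination h0⟩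
  by_contra! hne
  have : f = C (coeff 0 f) := by
    apply eq_C_of_pderiv_eq_zero
    intro i
    rw [hconst i]
    fin_cases i
    · simpa using hne.1
    · simpa using hne.2
  rw [this, totalDegree_C] at hf
  omega

theorem totalDegree_linear_form {a b c : ℂ} (hab : a ≠ 0 ∨ b ≠ 0) :
    (C a * X 0 + C b * X 1 + C c : PolyXY).totalDegree = 1 := by
  have h1 : ∀ (a : ℂ) (i : Fin 2), (C a * X i : PolyXY).totalDegree ≤ 1 := fun a i =>
    (totalDegree_mul _ _).trans (by simp)
  have h2 : (C a * X 0 + C b * X 1 + C c : PolyXY).totalDegree ≤ 1 :=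
    (totalDegree_add _ _).trans (max_le ((totalDegree_add _ _).trans (max_le (h1 _ _) (h1 _ _)))
      (by rw [totalDegree_C]; exact Nat.zero_le 1))
  have h3 : (C a * X 0 + C b * X 1 + C c : PolyXY).totalDegree ≠ 0 := by
    rw [Ne, totalDegree_eq_zero_iff_eq_C]
    intro h
    have e0 := congrArg (pderiv 0) h
    have e1 := congrArg (pderiv 1) h
    simp only [map_add, pderiv_C_mul, pderiv_C, pderiv_X_self, pderiv_X_of_ne zero_ne_one,
      pderiv_X_of_ne one_ne_zero, mul_one, mul_zero, add_zero, zero_add, C_eq_zero] at e0 e1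
    exact hab.elim (fun h => h e0) fun h => h e1
  omega

namespace RatParam

noncomputable section

variable (φ : RatParam)

/-- A polynomial with rational coefficients as a complex polynomial. -/
def toC (a : Polynomial ℚ) : Polynomial ℂ := a.map (algebraMap ℚ ℂ)

theorem eval_toC (a : Polynomial ℚ) (t : ℂ) : (toC a).eval t = Polynomial.aeval t a := by
  rw [toC, Polynomial.eval_map_algebraMap]

theorem toC_W_ne_zero : toC φ.W ≠ 0 := by
  rw [toC, Ne, Polynomial.map_eq_zero_iff (algebraMap ℚ ℂ).injective]
  exact φ.W_ne_zero

theorem map_conj_toC (a : Polynomial ℚ) : (toC a).map (starRingEnd ℂ) = toC a := by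
  rw [toC, Polynomial.map_map]
  congr 1
  exact Subsingleton.elim _ _

/-- The image of the parametrization. -/
def image : Set (Fin 2 → ℂ) := {p | ∃ t : ℂ, Polynomial.aeval t φ.W ≠ 0 ∧ p = φ.point t}

variable {φ}

theorem IsAdmissible.image_infinite (h : φ.IsAdmissible) : φ.image.Infinite := fun hfin =>
  h.1 (zariskiClosure_finite hfin)

theorem infinite_params {A : Set (Fin 2 → ℂ)} (h : (A ∩ φ.image).Infinite) :
    {t : ℂ | Polynomial.aeval t φ.W ≠ 0 ∧ φ.point t ∈ A}.Infinite := by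
  intro hfin
  refine h ((hfin.image φ.point).subset ?_)
  rintro p ⟨hp, t, ht, rfl⟩
  exact ⟨t, ⟨ht, hp⟩, rfl⟩

theorem curve_eq_planeCurve {f : PolyXY} (hf : Irreducible f) (hsub : φ.image ⊆ planeCurve f)
    (hinf : φ.image.Infinite) : φ.curve = planeCurve f :=
  (zariskiClosure_subset_planeCurve hsub).antisymm
    (planeCurve_subset_zariskiClosure hf (by rwa [Set.inter_eq_self_of_subset_right hsub]))

theorem IsAdmissible.no_real_line (h : φ.IsAdmissible) {a b c : ℝ}
    (e : Polynomial.C (a : ℂ) * toC φ.X + Polynomial.C (b : ℂ) * toC φ.Y =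
      Polynomial.C (c : ℂ) * toC φ.W) : a = 0 ∧ b = 0 := by
  by_contra hne
  have hab : a ≠ 0 ∨ b ≠ 0 := by tauto
  have hab' : (a : ℂ) ≠ 0 ∨ (b : ℂ) ≠ 0 := by exact_mod_cast hab
  refine h.2.1 a b (-c) hab ?_
  rw [curve_eq_planeCurve (irreducible_of_totalDegree_eq_one
    (totalDegree_linear_form (c := -(c : ℂ)) hab')) ?_ h.image_infinite]
  · ext p
    simp [planeCurve]
  · rintro p ⟨t, ht, rfl⟩
    have := congrArg (Polynomial.eval t) e
    simp only [Polynomial.eval_add, Polynomial.eval_mul, Polynomial.eval_C, eval_toC] at this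
    simp only [planeCurve, Set.mem_ofPred_eq, map_add, map_mul, eval_C, eval_X, point,
      Matrix.cons_val_zero, Matrix.cons_val_one]
    field_simp
    linear_combination this

/-- The coefficients of `X`, `Y`, `W` are rational, so the real and imaginary parts of a complex
relation are real relations. -/
theorem IsAdmissible.no_line (h : φ.IsAdmissible) {a b c : ℂ}
    (e : Polynomial.C a * toC φ.X + Polynomial.C b * toC φ.Y = Polynomial.C c * toC φ.W) :
    a = 0 ∧ b = 0 := by
  have hco : ∀ k, a * ((φ.X.coeff k : ℝ) : ℂ) + b * ((φ.Y.coeff k : ℝ) : ℂ) =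
      c * ((φ.W.coeff k : ℝ) : ℂ) := by
    intro k
    have := congrArg (fun p => Polynomial.coeff p k) e
    simpa [toC] using this
  have key : ∀ a b c : ℝ, (∀ k, a * (φ.X.coeff k : ℝ) + b * (φ.Y.coeff k : ℝ) =
      c * (φ.W.coeff k : ℝ)) → a = 0 ∧ b = 0 := by
    intro a b c hk
    refine h.no_real_line (c := c) ?_
    ext k
    have := congrArg (fun x : ℝ => (x : ℂ)) (hk k)
    simp only [toC, Polynomial.coeff_add, Polynomial.coeff_C_mul, Polynomial.coeff_map]
    simpa using this
  have h1 := key a.re b.re c.re fun k => by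
    have := congrArg Complex.re (hco k)
    simpa only [Complex.add_re, Complex.re_mul_ofReal] using this
  have h2 := key a.im b.im c.im fun k => by
    have := congrArg Complex.im (hco k)
    simpa only [Complex.add_im, Complex.im_mul_ofReal] using this
  exact ⟨Complex.ext h1.1 h2.1, Complex.ext h1.2 h2.2⟩

theorem IsAdmissible.finite_line (h : φ.IsAdmissible) {f : PolyXY} (hf : f.totalDegree = 1) :
    (planeCurve f ∩ φ.image).Finite := by
  by_contra hinf
  obtain ⟨a, b, c, hab, rfl⟩ := exists_linear_form hf
  have hz : Polynomial.C a * toC φ.X + Polynomial.C b * toC φ.Y + Polynomial.C c * toC φ.W = 0 := by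
    refine Polynomial.eq_zero_of_infinite_zeros ((infinite_params hinf).mono ?_)
    rintro t ⟨ht, hp⟩
    simp only [planeCurve, Set.mem_ofPred_eq, map_add, map_mul, eval_C, eval_X, point,
      Matrix.cons_val_zero, Matrix.cons_val_one] at hp
    simp only [Set.mem_ofPred_eq, Polynomial.eval_add, Polynomial.eval_mul, Polynomial.eval_C,
      eval_toC]
    field_simp at hp
    linear_combination hp
  obtain ⟨h1, h2⟩ := h.no_line (a := a) (b := b) (c := -c) (by
    rw [Polynomial.C_neg]
    linear_combination hz)
  exact hab.elim (fun h => h h1) fun h => h h2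

/-- The circle of centre `(a, b)` and radius `r`. -/
def circleXY (a b r : ℂ) : PolyXY := (MvPolynomial.X 0 - C a) ^ 2 + (MvPolynomial.X 1 - C b) ^ 2 - C (r ^ 2)

theorem totalDegree_circleXY (a b r : ℂ) : (circleXY a b r).totalDegree ≤ 2 := by
  have h1 : ∀ (a : ℂ) (i : Fin 2), ((MvPolynomial.X i - C a) ^ 2 : PolyXY).totalDegree ≤ 2 := by
    intro a i
    refine (totalDegree_pow _ _).trans ?_
    have : (MvPolynomial.X i - C a : PolyXY).totalDegree ≤ 1 :=
      (totalDegree_sub _ _).trans (max_le (by simp) (by rw [totalDegree_C]; exact Nat.zero_le 1))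
    omega
  exact (totalDegree_sub _ _).trans (max_le ((totalDegree_add _ _).trans (max_le (h1 _ _) (h1 _ _)))
    (by rw [totalDegree_C]; exact Nat.zero_le 2))

theorem IsAdmissible.irreducible_circleXY (h : φ.IsAdmissible) {a b r : ℂ}
    (hsub : φ.image ⊆ planeCurve (circleXY a b r)) : Irreducible (circleXY a b r) := by
  have h0 : circleXY a b r ≠ 0 := by
    intro h0
    -- The second difference of the circle equation in `x` is 2.
    have h1 := congrArg (eval ![a + r + 1, b]) h0
    have h2 := congrArg (eval ![a + r - 1, b]) h0
    have h3 := congrArg (eval ![a + r, b]) h0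
    simp only [circleXY, map_sub, map_add, map_pow, eval_X, eval_C, Matrix.cons_val_zero,
      Matrix.cons_val_one, map_zero] at h1 h2 h3
    have : (2 : ℂ) = 0 := by linear_combination h1 + h2 - 2 * h3
    norm_num at this
  obtain ⟨p₀, hp₀⟩ := h.image_infinite.nonempty
  obtain ⟨l, hl, k, hk⟩ := WfDvdMonoid.exists_irreducible_factor (a := circleXY a b r)
    (fun hu => by
      obtain ⟨c, hc, e⟩ := isUnit_iff_eq_C_of_isReduced.1 hu
      have := hsub hp₀
      rw [e] at this
      simp only [planeCurve, Set.mem_ofPred_eq, eval_C] at this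
      exact hc.ne_zero this) h0
  refine ⟨fun hu => ?_, fun f g hfg => ?_⟩
  · exact hl.not_isUnit (isUnit_of_dvd_unit ⟨k, hk⟩ hu)
  · by_contra! hne
    have hf0 : f ≠ 0 := left_ne_zero_of_mul (hfg ▸ h0)
    have hg0 : g ≠ 0 := right_ne_zero_of_mul (hfg ▸ h0)
    have hpos : ∀ c : PolyXY, c ≠ 0 → ¬ IsUnit c → 0 < c.totalDegree := by
      intro c hc hcu
      rw [Nat.pos_iff_ne_zero]
      intro hc0
      have h1 := totalDegree_eq_zero_iff_eq_C.1 hc0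
      apply hcu
      rw [h1]
      refine (isUnit_iff_ne_zero.2 fun h0 => hc ?_).map C
      rw [h1, h0, map_zero]
    have hdeg := totalDegree_circleXY a b r
    rw [hfg, totalDegree_mul_of_isDomain hf0 hg0] at hdeg
    have hf1 := hpos f hf0 hne.1
    have hg1 := hpos g hg0 hne.2
    -- The degree bound 2 makes both factors linear, and two lines meet the image in finitely many
    -- points.
    refine h.image_infinite (((h.finite_line (f := f) (by omega)).union
      (h.finite_line (f := g) (by omega))).subset fun p hp => ?_)
    have := hsub hp
    rw [hfg, planeCurve_mul] at this
    exact this.imp (fun h => ⟨h, hp⟩) fun h => ⟨h, hp⟩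

/-- Conjugation fixes the parametrization and `d`. Subtracting the conjugate circle leaves a linear
relation, so `no_line` makes the centre real; the circle is irreducible and hence is the whole
curve. -/
theorem IsAdmissible.no_circle (h : φ.IsAdmissible) {d : ℝ} (hd : 0 < d) (a b : ℂ) :
    (toC φ.X - Polynomial.C a * toC φ.W) ^ 2 + (toC φ.Y - Polynomial.C b * toC φ.W) ^ 2 ≠
      Polynomial.C ((d : ℂ) ^ 2) * toC φ.W ^ 2 := by
  intro e
  have e' := congrArg (Polynomial.map (starRingEnd ℂ)) e
  simp only [Polynomial.map_add, Polynomial.map_pow, Polynomial.map_sub, Polynomial.map_mul,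
    Polynomial.map_C, map_conj_toC, map_pow, Complex.conj_ofReal] at e'
  set a' := starRingEnd ℂ a with ha'
  set b' := starRingEnd ℂ b with hb'
  obtain ⟨h1, h2⟩ := h.no_line (a := 2 * (a' - a)) (b := 2 * (b' - b))
    (c := a' ^ 2 - a ^ 2 + b' ^ 2 - b ^ 2) (by
      apply mul_right_cancel₀ φ.toC_W_ne_zero
      simp only [Polynomial.C_mul, Polynomial.C_sub, Polynomial.C_add, Polynomial.C_pow] at e e' ⊢
      rw [show Polynomial.C (2 : ℂ) = 2 from rfl]
      linear_combination e - e')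
  have ha : ((a.re : ℝ) : ℂ) = a := Complex.conj_eq_iff_re.1 (by
    have := (mul_eq_zero.1 h1).resolve_left two_ne_zero
    exact sub_eq_zero.1 this)
  have hb : ((b.re : ℝ) : ℂ) = b := Complex.conj_eq_iff_re.1 (by
    have := (mul_eq_zero.1 h2).resolve_left two_ne_zero
    exact sub_eq_zero.1 this)
  have hsub : φ.image ⊆ planeCurve (circleXY a b d) := by
    rintro p ⟨t, ht, rfl⟩
    have := congrArg (Polynomial.eval t) e
    simp only [Polynomial.eval_add, Polynomial.eval_sub, Polynomial.eval_pow, Polynomial.eval_mul,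
      Polynomial.eval_C, eval_toC] at this
    simp only [planeCurve, circleXY, Set.mem_ofPred_eq, map_add, map_sub, map_pow, eval_C, eval_X,
      point, Matrix.cons_val_zero, Matrix.cons_val_one]
    field_simp
    linear_combination this
  refine h.2.2 a.re b.re d hd ?_
  rw [curve_eq_planeCurve (h.irreducible_circleXY hsub) hsub h.image_infinite, ha, hb]
  ext p
  simp [planeCurve, circleXY, sub_eq_zero]

/-- The offset data of an admissible parametrization. -/
def offsetData (h : φ.IsAdmissible) {d : ℝ} (hd : 0 < d) : OffsetData where
  X := toC φ.X
  Y := toC φ.Y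
  W := toC φ.W
  d := d
  W_ne_zero := φ.toC_W_ne_zero
  d_ne_zero := by exact_mod_cast hd.ne'
  no_line _ _ _ e := h.no_line e
  no_circle := h.no_circle hd

section

variable (h : φ.IsAdmissible) {d : ℝ} (hd : 0 < d)

theorem offsetData_U : (offsetData h hd).U = toC φ.U := by
  simp [OffsetData.U, offsetData, U, toC, Polynomial.derivative_map]

theorem offsetData_V : (offsetData h hd).V = toC φ.V := by
  simp [OffsetData.V, offsetData, V, toC, Polynomial.derivative_map]

theorem offsetData_pt (t : ℂ) : (offsetData h hd).pt t = φ.point t := by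
  simp only [OffsetData.pt, point, offsetData, eval_toC]

theorem liftT_eq (a : Polynomial ℚ) : liftT a = OffsetData.lift (toC a) := by
  rw [liftT, OffsetData.lift, toC, Polynomial.map_map]
  congr 1

theorem normalPoly_eq : φ.normalPoly = (offsetData h hd).normal := by
  rw [normalPoly, OffsetData.normal, offsetData_U, offsetData_V]
  simp only [liftT_eq, offsetData]

theorem circlePoly_eq : φ.circlePoly d = (offsetData h hd).circle := by
  rw [circlePoly, OffsetData.circle]
  simp only [liftT_eq, offsetData]

theorem paramGenerates_iff (t : ℂ) (p : Fin 2 → ℂ) : φ.ParamGenerates d t p ↔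
    ∃ s, (offsetData h hd).IsState t s ∧ (offsetData h hd).q t s = p := by
  simp only [ParamGenerates, OffsetData.IsState, OffsetData.q, OffsetData.qx, OffsetData.qy,
    OffsetData.S, offsetData_U, offsetData_V, Polynomial.eval_add, Polynomial.eval_pow, eval_toC]
  simp only [offsetData, eval_toC, point, Matrix.cons_val_zero, Matrix.cons_val_one]
  constructor
  · rintro ⟨hW, s, hs, hs2, rfl⟩
    exact ⟨s, ⟨hW, hs, hs2⟩, rfl⟩
  · rintro ⟨s, ⟨hW, hs, hs2⟩, rfl⟩
    exact ⟨hW, s, hs, hs2, rfl⟩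

theorem offset_eq : φ.offset d = zariskiClosure {p | (offsetData h hd).Generated p} := by
  rw [offset]
  congr 1
  ext p
  simp only [Set.mem_ofPred_eq, paramGenerates_iff h hd]
  rfl

theorem generators_eq (p : Fin 2 → ℂ) : φ.generators d p = (offsetData h hd).gens p := by
  ext z
  simp only [generators, OffsetData.gens, Set.mem_ofPred_eq, paramGenerates_iff h hd,
    offsetData_pt]
  constructor
  · rintro ⟨t, ⟨s, hs, hq⟩, rfl⟩
    exact ⟨t, s, hs, hq, rfl⟩
  · rintro ⟨t, s, hs, hq, rfl⟩
    exact ⟨t, ⟨s, hs, hq⟩, rfl⟩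

theorem fibre_eq (p : Fin 2 → ℂ) : φ.fibre p = (offsetData h hd).fib p := by
  ext t
  simp only [fibre, OffsetData.fib, Set.mem_ofPred_eq, offsetData_pt]
  rw [← eval_toC]
  rfl

theorem HasTracingIndex.hasIndex {n : ℕ} (hn : φ.HasTracingIndex n) :
    (offsetData h hd).HasIndex n := by
  refine (hn.biUnion fun p _ => (offsetData h hd).finite_fib p).subset ?_
  rintro t ⟨ht, hne⟩
  simp only [Set.mem_iUnion]
  refine ⟨(offsetData h hd).pt t, ⟨?_, by rwa [fibre_eq h hd]⟩, ht, rfl⟩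
  refine subset_zariskiClosure _ ⟨t, ?_, offsetData_pt h hd t⟩
  rw [← eval_toC]
  exact ht

end

end

end RatParam

/-! ### Special components and the conclusion -/

theorem planeCurve_C_mul {c : ℂ} (hc : c ≠ 0) (f : PolyXY) :
    planeCurve (C c * f) = planeCurve f := by
  ext p
  simp [planeCurve, hc]

namespace RatParam

variable {φ : RatParam} {h : φ.IsAdmissible} {d : ℝ} {hd : 0 < d} {R : OffsetResultant}
  {n e : ℕ} {f g : PolyXY}

theorem offset_eq_planeCurve (hD : R.D = offsetData h hd) (hp : R.IsMainPair f g) :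
    φ.offset d = planeCurve (f * g) := by
  rw [offset_eq h hd, ← hD, hp.zariskiClosure_generated]

/-- The offset has a special component exactly when the generic point of `{g = 0}` has two
generators, and then that component is `{g = 0}`. -/
theorem isSpecialComponent_iff (hD : R.D = offsetData h hd) (hs : R.IsStructure n f g e)
    (Z : Set (Fin 2 → ℂ)) : φ.IsSpecialComponent d Z ↔ e = 2 ∧ Z = planeCurve g := by
  have hoff := offset_eq_planeCurve hD hs.pair
  have hgen : ∀ p, φ.generators d p = R.D.gens p := fun p => by rw [generators_eq h hd, hD]
  have hf := hs.gens_f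
  have hg := hs.gens_g
  simp only [IsSpecialComponent, IsSimpleComponent, hoff, hgen]
  constructor
  · rintro ⟨hZ, hns⟩
    obtain ⟨l, hl, hlfg, rfl⟩ := hZ.exists_irreducible_factor hs.pair.ne_zero
    have hlf : planeCurve l ≠ planeCurve f := fun h1 => hns ⟨hZ, by rwa [h1]⟩
    rcases hl.prime.dvd_or_dvd hlfg with h1 | h1
    · exact absurd ((associated_iff_planeCurve_eq hl hs.pair.1.1).1
        (hl.associated_of_dvd hs.pair.1.1 h1)) hlf
    · rcases hs.pair.2.1 with rfl | hgm
      · exact absurd (isUnit_of_dvd_one h1) hl.not_isUnit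
      · have hlg := (associated_iff_planeCurve_eq hl hgm.1.1).1
          (hl.associated_of_dvd hgm.1.1 h1)
        refine ⟨?_, hlg⟩
        rcases hs.e_eq with he | he
        · rw [he, Nat.cast_one] at hg
          exact absurd ⟨hZ, by rwa [hlg]⟩ hns
        · exact he.1
  · rintro ⟨rfl, rfl⟩
    have hgm := hs.pair.2.1.resolve_left (hs.e_eq.resolve_left (by omega)).2
    refine ⟨isIrredComponent_planeCurve hgm.1.1 hs.pair.ne_zero (dvd_mul_left _ _), fun hsimple =>
      planeCurve_infinite hgm.1.1 ((hsimple.2.union hg).subset fun p hp => ?_)⟩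
    by_cases h1 : (R.D.gens p).encard = 1
    · refine Or.inr ⟨hp, ?_⟩
      rw [h1]
      norm_num
    · exact Or.inl ⟨hp, h1⟩

theorem hasSpecialComponent_iff (hD : R.D = offsetData h hd) (hs : R.IsStructure n f g e) :
    φ.HasSpecialComponent d ↔ e = 2 := by
  simp only [HasSpecialComponent, isSpecialComponent_iff hD hs]
  simp

theorem areComponentEquations_of_isStructure (hD : R.D = offsetData h hd)
    (hs : R.IsStructure n f g e) : φ.AreComponentEquations d f g := by
  refine ⟨hs.pair.1.1, hs.pair.2.1.symm.imp (fun h => h.1.1) id, fun he => ?_, ?_, fun Z hZ => ?_⟩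
  · exact hs.pair.not_dvd (dvd_of_planeCurve_subset hs.pair.1.1 he.subset)
  · rw [offset_eq_planeCurve hD hs.pair, planeCurve_mul]
  · exact (((isSpecialComponent_iff hD hs Z).1 hZ).2).symm

/-- Component equations are the main factors, up to constants and, if no component is special,
up to order. -/
theorem AreComponentEquations.associated {f₁ f₂ : PolyXY} (hc : φ.AreComponentEquations d f₁ f₂)
    (hD : R.D = offsetData h hd) (hs : R.IsStructure n f g e) :
    Associated f₁ f ∧ Associated f₂ g ∨ Associated f₁ g ∧ Associated f₂ f ∧ e = 1 := by
  obtain ⟨h1, h2, hne, hun, hsp⟩ := hc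
  have hp := hs.pair
  have hf := hp.1.1
  rw [offset_eq_planeCurve hD hp, ← planeCurve_mul] at hun
  have key : ∀ l, Irreducible l → l ∣ f₁ * f₂ → l ∣ f * g := fun l hl hd =>
    dvd_of_planeCurve_subset hl ((planeCurve_subset_of_dvd hd).trans hun.subset)
  have key' : ∀ l, Irreducible l → l ∣ f * g → l ∣ f₁ * f₂ := fun l hl hd =>
    dvd_of_planeCurve_subset hl ((planeCurve_subset_of_dvd hd).trans hun.symm.subset)
  have hnot : ¬ f₁ ∣ f₂ := by
    rintro hd
    rcases h2 with h2 | rfl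
    · exact hne ((associated_iff_planeCurve_eq h1 h2).1 (h1.associated_of_dvd h2 hd))
    · exact h1.not_isUnit (isUnit_of_dvd_one hd)
  rcases hp.2.1 with rfl | ⟨⟨hg, -⟩, hfg⟩
  · have hdiv : ∀ l, Irreducible l → l ∣ f₁ * f₂ → Associated l f := fun l hl hd =>
      hl.associated_of_dvd hf (by simpa using key l hl hd)
    have hf₁ := hdiv f₁ h1 (dvd_mul_right _ _)
    rcases h2 with h2 | rfl
    · exact absurd (hf₁.trans (hdiv f₂ h2 (dvd_mul_left _ _)).symm).dvd hnot
    · exact Or.inl ⟨hf₁, Associated.refl 1⟩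
  · have h2' : Irreducible f₂ := by
      refine h2.resolve_right ?_
      rintro rfl
      have hf' := hf.associated_of_dvd h1 (by simpa using key' f hf (dvd_mul_right _ _))
      have hg' := hg.associated_of_dvd h1 (by simpa using key' g hg (dvd_mul_left _ _))
      exact hfg (hf'.trans hg'.symm)
    have hdiv : ∀ l, Irreducible l → l ∣ f₁ * f₂ → Associated l f ∨ Associated l g :=
      fun l hl hd => (hl.prime.dvd_or_dvd (key l hl hd)).imp (hl.associated_of_dvd hf)
        (hl.associated_of_dvd hg)
    rcases hdiv f₁ h1 (dvd_mul_right _ _) with ha | ha <;>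
      rcases hdiv f₂ h2' (dvd_mul_left _ _) with hb | hb
    · exact absurd (ha.trans hb.symm).dvd hnot
    · exact Or.inl ⟨ha, hb⟩
    -- In the swapped order `g` cannot be special: `f₂` would then define both `{f = 0}` and `{g =
    -- 0}`.
    · refine Or.inr ⟨ha, hb, hs.e_eq.resolve_right fun he => hfg ?_⟩
      have hfg' := hsp (planeCurve g) ((isSpecialComponent_iff hD hs _).2 ⟨he.1, rfl⟩)
      exact hb.symm.trans ((associated_iff_planeCurve_eq h2' hg).2 hfg')
    · exact absurd (ha.trans hb.symm).dvd hnot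

end RatParam

theorem theorem3 (φ : RatParam) (hφ : φ.IsAdmissible) (d : ℝ) (hd : 0 < d)
    (n : ℕ) (hn : φ.HasTracingIndex n)
    (P Q : Polynomial PolyXY)
    (hP : IsPrimitivePartT φ.normalPoly P) (hQ : IsPrimitivePartT (φ.circlePoly d) Q) :
    (∃ F G : PolyXY, φ.IsOffsetFactorization d (Polynomial.resultant P Q) F G) ∧
    (∃ f₁ f₂ : PolyXY, φ.AreComponentEquations d f₁ f₂) ∧
    ∀ F G f₁ f₂ : PolyXY,
      φ.IsOffsetFactorization d (Polynomial.resultant P Q) F G →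
      φ.AreComponentEquations d f₁ f₂ →
      (¬ φ.HasSpecialComponent d →
        ∃ c : ℂ, c ≠ 0 ∧ F = MvPolynomial.C c * (f₁ ^ n * f₂ ^ n)) ∧
      (φ.HasSpecialComponent d →
        ∃ c : ℂ, c ≠ 0 ∧ F = MvPolynomial.C c * (f₁ ^ n * f₂ ^ (2 * n))) := by
  have hidx := RatParam.HasTracingIndex.hasIndex hφ hd hn
  obtain ⟨R, hD, hH⟩ : ∃ R : OffsetResultant, R.D = RatParam.offsetData hφ hd ∧
      R.H = Polynomial.resultant P Q :=
    ⟨⟨RatParam.offsetData hφ hd, P, Q, RatParam.normalPoly_eq hφ hd ▸ hP,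
      RatParam.circlePoly_eq hφ hd ▸ hQ⟩, rfl, rfl⟩
  rw [← hD] at hidx
  obtain ⟨f, g, e, hs⟩ := OffsetResultant.exists_isStructure hidx
  have hoff := RatParam.offset_eq_planeCurve hD hs.pair
  rw [← hH]
  refine ⟨?_, ⟨f, g, RatParam.areComponentEquations_of_isStructure hD hs⟩, ?_⟩
  · obtain ⟨c, L, hc, hL, hfac⟩ := hs.factorization
    exact ⟨_, _, hfac, by rw [planeCurve_C_mul hc, hs.planeCurve_eq hidx.ne_zero, hoff],
      L, hL, rfl⟩
  · rintro F G f₁ f₂ ⟨hFG, hF, L, hL, hG⟩ hc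
    have hass := hs.associated hFG (hF.trans hoff) hL hG
    have hcases := hc.associated hD hs
    rw [RatParam.hasSpecialComponent_iff hD hs]
    refine ⟨fun he => exists_eq_C_mul_of_associated ?_,
      fun he => exists_eq_C_mul_of_associated ?_⟩
    · obtain rfl := hs.e_eq.resolve_right fun h => he h.1
      rw [mul_one] at hass
      rcases hcases with ⟨ha, hb⟩ | ⟨ha, hb, -⟩
      · exact ((ha.pow_pow).mul_mul hb.pow_pow).trans hass
      · rw [mul_comm]
        exact ((hb.pow_pow).mul_mul ha.pow_pow).trans hass
    · subst he
      rw [mul_comm n 2] at hass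
      obtain ⟨ha, hb⟩ := hcases.resolve_right (by omega)
      exact ((ha.pow_pow).mul_mul hb.pow_pow).trans hass
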